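/- **Setting.** Fix an integer $k\ge 4$ and $\beta\in(-1,0)$. For a tensor field $T$ on $\mathbb R^3$ put $\|T\|_{H^{k,\beta}}=\big(\sum_{l=0}^{k}\int_{\mathbb R^3}\|D^lT\|^2\sigma^{-2(\beta-l)-3}\big)^{1/2}$ with $\sigma(x)=(1+|x|^2)^{1/2}$ ($D^l$ weak derivatives, Euclidean norms, Lebesgue measure), and let $H^{k,\beta}$ be the space of tensor fields (up to equality almost everywhere) with weak derivatives up to order $k$ and finite norm. Let $\mathcal J(\mathbb R^3)$ be the bundle of three-tensors with $J_{abc}+J_{cab}+J_{bca}=0$ and $J_{abc}+J_{acb}=0$. For a metric $g=\delta+h$, with $h\in H^{k,\beta}$ a symmetric two-tensor, let $\nabla$ be its Levi-Civita connection, $\varepsilon^{abc}$ its volume form, and let $$\mathcal P_g(J)=\big(\mathcal D_g^*(J),\mathcal Q_g(J)\big),\qquad [\mathcal D_g^*(J)]_{ac}=\nabla^bJ_{abc}+\nabla^bJ_{cba}-\tfrac23\nabla^bJ_{ubv}\,g^{uv}g_{ac},\qquad [\mathcal Q_g(J)]_a=\varepsilon^{ebc}\nabla_eJ_{abc},$$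 for $J\in H^{k-2,\beta-2}(\mathcal J(\mathbb R^3))$; $\mathrm{Im}(\mathcal P_g)$ is the image of this space. Let $\eta:\mathbb R^3\to[0,\infty)$ be smooth with compact support and $\int_{\mathbb R^3}\eta=1$, and let $$\mathcal C'=\{\eta\,\mu_{ij}\,dx^i\otimes dx^j:\mu_{ij}\in\mathbb R\}\times\{\eta\,\bar\lambda_i\,dx^i:\bar\lambda_i\in\mathbb R\}.$$ Free data are triples $b=(T,\bar T,\phi)$ with $T,\bar T\in H^{k-2,\beta-2}$ symmetric, trace-free and divergence-free two-tensors (with respect to $\delta$) and $\phi\in H^{k-1,\beta-1}$ a function; $\|b\|=\|T\|_{H^{k-2,\beta-2}}+\|\bar T\|_{H^{k-2,\beta-2}}+\|\phi\|_{H^{k-1,\beta-1}}$. **Proposition (transversality of $\mathcal C'$).** 1. There is $\varepsilon_0>0$ such that for every symmetric two-tensor $h\in H^{k,\beta}$ with $\|h\|_{H^{k,\beta}}\le\varepsilon_0$, the operator of the metric $g=\delta+h$ satisfies $\mathcal C'\cap\mathrm{Im}(\mathcal P_{g})=\{(0,0)\}$. 2. Consequently, for every family of symmetric two-tensors $h(b)$,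 indexed by free data $b$, with $h(b)\in H^{k,\beta}$ for $\|b\|$ small and $\|h(b)\|_{H^{k,\beta}}\to0$ as $\|b\|\to0$ (such as the metric part of a solution map that is continuous at $0$ and sends $0$ to $0$), there is $\varepsilon_0>0$ such that $\mathcal C'\cap\mathrm{Im}(\mathcal P_{\delta+h(b)})=\{(0,0)\}$ whenever $\|b\|\le\varepsilon_0$. -/

import Mathlib

open MeasureTheory
open scoped ContDiff

namespace ExtConstraint

/-- Euclidean three-space; `volume` on it is Lebesgue measure. -/
abbrev E3 : Type := EuclideanSpace ℝ (Fin 3)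

/-- Covariant `n`-tensor fields on `ℝ³`, given by their components in the standard coordinates:
`T ![a₁, …, aₙ]` is the scalar function `T_{a₁ … aₙ}`. Fields are considered up to equality almost
everywhere. -/
abbrev TensorField (n : ℕ) : Type := (Fin n → Fin 3) → E3 → ℝ

/-! ### Weak derivatives and weighted Sobolev spaces -/

/-- `v` is the weak partial derivative `∂ᵢ u`. -/
def IsWeakPartial (i : Fin 3) (u v : E3 → ℝ) : Prop :=
  LocallyIntegrable u volume ∧ LocallyIntegrable v volume ∧
    ∀ φ : E3 → ℝ, ContDiff ℝ ∞ φ → HasCompactSupport φ →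
      ∫ x, u x * fderiv ℝ φ x (EuclideanSpace.single i 1) = -∫ x, v x * φ x

open Classical in
/-- The weak partial derivative `∂ᵢ u` (unique up to null sets; `0` if there is none). -/
noncomputable def weakPartial (i : Fin 3) (u : E3 → ℝ) : E3 → ℝ :=
  if h : ∃ v, IsWeakPartial i u v then h.choose else 0

/-- Iterated weak partial derivatives, `weakD [i₁, …, iₗ] u = ∂_{i₁} ⋯ ∂_{iₗ} u`. -/
noncomputable def weakD : List (Fin 3) → (E3 → ℝ) → E3 → ℝ
  | [], u => u
  | i :: s, u => weakPartial i (weakD s u)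

/-- The weight function `σ(x) = (1 + r²)^{1/2}`. -/
noncomputable def sigma (x : E3) : ℝ := Real.sqrt (1 + ‖x‖ ^ 2)

/-- The weighted Sobolev norm
`‖T‖_{H^{k,β}} = (∑_{l ≤ k} ∫ ‖D^l T‖² σ^{-2(β-l)-3})^{1/2}`, as an extended real. The square of the
Euclidean norm of `D^l T` is the sum of the squares of all its components. -/
noncomputable def sobolevNorm (k : ℕ) (β : ℝ) {n : ℕ} (T : TensorField n) : ENNReal :=
  (∑ l ∈ Finset.range (k + 1), ∑ a : Fin n → Fin 3, ∑ s : Fin l → Fin 3,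
    ∫⁻ x, ENNReal.ofReal
      ((weakD (List.ofFn s) (T a) x) ^ 2 * sigma x ^ (-2 * (β - l) - 3))) ^ (1 / 2 : ℝ)

/-- `T ∈ H^{k,β}`: all weak derivatives of the components of `T` up to order `k` exist, and the
weighted Sobolev norm is finite. -/
def MemSobolev (k : ℕ) (β : ℝ) {n : ℕ} (T : TensorField n) : Prop :=
  (∀ a, LocallyIntegrable (T a) volume) ∧
  (∀ a, ∀ s : List (Fin 3), s.length < k → ∀ i, ∃ v, IsWeakPartial i (weakD s (T a)) v) ∧
  sobolevNorm k β T < ⊤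

/-! ### Algebraic types of tensors -/

/-- Symmetric two-tensors. -/
def IsSymm2 (h : TensorField 2) : Prop :=
  ∀ a b, h ![a, b] =ᵐ[volume] h ![b, a]

/-- The three-tensors with `J_{abc} + J_{cab} + J_{bca} = 0` and `J_{abc} + J_{acb} = 0`. -/
def IsJac (J : TensorField 3) : Prop :=
  ∀ a b c, ∀ᵐ x, J ![a, b, c] x + J ![c, a, b] x + J ![b, c, a] x = 0 ∧
    J ![a, b, c] x + J ![a, c, b] x = 0

/-- Symmetric two-tensors that are trace-free and (weakly) divergence-free with respect to the
Euclidean metric. -/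
def IsTT (T : TensorField 2) : Prop :=
  IsSymm2 T ∧ (∀ᵐ x, ∑ a, T ![a, a] x = 0) ∧
    ∀ b, ∀ᵐ x, ∑ a, weakPartial a (T ![a, b]) x = 0

/-! ### Riemannian geometry of a metric `g` on `ℝ³` -/

/-- The metric `g = δ + h`. -/
def metricOf (h : TensorField 2) : TensorField 2 :=
  fun a x => (if a 0 = a 1 then 1 else 0) + h a x

/-- The matrix `(g_{ab}(x))`. -/
def metricMatrix (g : TensorField 2) (x : E3) : Matrix (Fin 3) (Fin 3) ℝ :=
  Matrix.of fun a b => g ![a, b] x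

/-- The inverse metric `g^{ab}`. -/
noncomputable def invMetric (g : TensorField 2) (a b : Fin 3) (x : E3) : ℝ :=
  (metricMatrix g x)⁻¹ a b

/-- The Christoffel symbols `Γ^c_{ab}` of `g`. -/
noncomputable def christoffel (g : TensorField 2) (c a b : Fin 3) (x : E3) : ℝ :=
  (1 / 2) * ∑ d, invMetric g c d x *
    (weakPartial a (g ![b, d]) x + weakPartial b (g ![a, d]) x - weakPartial d (g ![a, b]) x)

/-- The covariant derivative `∇_e J_{abc}` of a three-tensor. -/
noncomputable def covDeriv (g : TensorField 2) (J : TensorField 3) (e a b c : Fin 3) (x : E3) : ℝ :=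
  weakPartial e (J ![a, b, c]) x
    - ∑ s, christoffel g s e a x * J ![s, b, c] x
    - ∑ s, christoffel g s e b x * J ![a, s, c] x
    - ∑ s, christoffel g s e c x * J ![a, b, s] x

/-- The permutation symbol: the sign of `(a, b, c)` as a permutation of `(0, 1, 2)`, and zero if two
indices agree. -/
noncomputable def permSign (a b c : Fin 3) : ℝ :=
  (((b.val : ℝ) - a.val) * ((c.val : ℝ) - a.val) * ((c.val : ℝ) - b.val)) / 2

/-- The volume form of `g` with raised indices, `ε^{abc} = (det g)^{-1/2} sign(a, b, c)`. -/
noncomputable def volUp (g : TensorField 2) (a b c : Fin 3) (x : E3) : ℝ :=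
  permSign a b c / Real.sqrt (metricMatrix g x).det

/-- The divergence `∇^b J_{abc}` in the middle index. -/
noncomputable def midDiv (g : TensorField 2) (J : TensorField 3) (a c : Fin 3) (x : E3) : ℝ :=
  ∑ b, ∑ d, invMetric g b d x * covDeriv g J d a b c x

/-- `[𝒟_g^*(J)]_{ac} = ∇^b J_{abc} + ∇^b J_{cba} - (2/3) ∇^b J_{ubv} g^{uv} g_{ac}`. -/
noncomputable def Dstar (g : TensorField 2) (J : TensorField 3) (a c : Fin 3) (x : E3) : ℝ :=
  midDiv g J a c x + midDiv g J c a x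
    - (2 / 3) * (∑ u, ∑ v, midDiv g J u v x * invMetric g u v x) * g ![a, c] x

/-- `[𝒬_g(J)]_a = ε^{ebc} ∇_e J_{abc}`. -/
noncomputable def Qop (g : TensorField 2) (J : TensorField 3) (a : Fin 3) (x : E3) : ℝ :=
  ∑ e, ∑ b, ∑ c, volUp g e b c x * covDeriv g J e a b c x

/-- The operator `𝒫 (J) = (𝒟_g^*(J), 𝒬_g(J))` of the metric `g`. -/
noncomputable def auxOp (g : TensorField 2) (J : TensorField 3) (x : E3) :
    (Fin 3 → Fin 3 → ℝ) × (Fin 3 → ℝ) :=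
  (fun a c => Dstar g J a c x, fun a => Qop g J a x)

/-! ### The image of the operator and the error space -/

/-- Pairs (two-tensor, one-form) on `ℝ³`, modulo equality almost everywhere. -/
abbrev PairField : Type := E3 →ₘ[volume] ((Fin 3 → Fin 3 → ℝ) × (Fin 3 → ℝ))

/-- The image of `𝒫` for the metric `g`, acting on `H^{k-2,β-2}` sections of the bundle of
three-tensors with the symmetries `IsJac`. -/
def auxImage (k : ℕ) (β : ℝ) (g : TensorField 2) : Set PairField :=
  {w | ∃ J : TensorField 3, MemSobolev (k - 2) (β - 2) J ∧ IsJac J ∧ ⇑w =ᵐ[volume] auxOp g J}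

/-- The error space `𝒞' = {η μ_{ij} dx^i ⊗ dx^j} × {η ν_i dx^i}`, with `μ_{ij}` and `ν_i` real. -/
def errorSpace (η : E3 → ℝ) : Set PairField :=
  {w | ∃ (μ : Fin 3 → Fin 3 → ℝ) (ν : Fin 3 → ℝ),
    ⇑w =ᵐ[volume] fun x => (fun i j => η x * μ i j, fun i => η x * ν i)}

/-! ### Free data -/

/-- Free data `(T, T̄, φ)` in `H^{k-2,β-2}(𝒮_TT) × H^{k-2,β-2}(𝒮_TT) × H^{k-1,β-1}(ℝ³)`. -/
structure FreeData (k : ℕ) (β : ℝ) where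
  T : TensorField 2
  Tbar : TensorField 2
  phi : TensorField 0
  memT : MemSobolev (k - 2) (β - 2) T
  memTbar : MemSobolev (k - 2) (β - 2) Tbar
  memPhi : MemSobolev (k - 1) (β - 1) phi
  ttT : IsTT T
  ttTbar : IsTT Tbar

/-- The norm of free data. -/
noncomputable def FreeData.size {k : ℕ} {β : ℝ} (b : FreeData k β) : ENNReal :=
  sobolevNorm (k - 2) (β - 2) b.T + sobolevNorm (k - 2) (β - 2) b.Tbar +
    sobolevNorm (k - 1) (β - 1) b.phi

end ExtConstraint

/-! Suppose that `𝒫_g(J) = η m` with a constant array `m`. The argument compares `𝒫_g` with the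
Euclidean operator `𝒫_δ`, which has constant coefficients and no zeroth-order term.

The components of `𝒫_δ(J)` are sums of derivatives. The decay of `J ∈ H^{k-2,β-2}` makes these
derivatives integrable with integral zero (`integral_flatComp`). Since `∫ η = 1`, this gives `m = ∫
(𝒫_g - 𝒫_δ)(J)`. The integrand has the schematic form `h ∂J + ∂h J`. By Cauchy-Schwarz its `L¹` norm
is at most `C ‖h‖ E`, where `E` is the first-order norm of `J` in the weights dual to those of `h`
and `∂h`: with `τ = 3/2 + β`, weight `σ^τ` on `∂J` and `σ^{τ-1}` on `J`. In the same weights `𝒫_g -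
𝒫_δ` has size `C ‖h‖ E` (`perturbation_le`). Hence `𝒫_δ(J) = η m - (𝒫_g - 𝒫_δ)(J)` is itself of size
`C ‖h‖ E`.

At this weaker weight `𝒫_δ` is injective with an estimate, `E ≤ C ‖𝒫_δ(J)‖` (`wnorm_weak_le`). For
small `h` this gives `E ≤ E/2`. As `E` is finite, `E = 0`, and then `m = 0`. The two weights have
different roles: that of the space `H^{k-2,β-2}` yields the vanishing integrals, while the dual
weight lies in the range `-1/2 < τ < 3/2` where potential estimates hold.

The Euclidean estimate has two parts. Writing `J_{abc} = ε_{bcd} s_{ad}` with `s` trace-free, `Δ² s`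
is a third-order expression in `(𝒟*J, 𝒬J)` (`lapl_lapl_eq`). Third derivatives of the biharmonic
kernel `|x|` are `O(|x|^{-2})`, so `|J|` is bounded by the Riesz potential of order one of
`|𝒫_δ(J)|`, and a Schur test gives the weighted bound of `J`. For `∂J`, a sum-of-squares identity
modulo integration by parts (`coercive_of_bilin`) gives an unweighted `L²` estimate, which is
applied to `σ^τ J`; the commutator is controlled by the bound of `J`. All this is done for test
functions and carried over by cutoff and mollification. The sup bounds on `h` and `σ ∂h` come from a
weighted Sobolev embedding proved with the same kernel. -/

namespace ExtConstraint

/-! ### Algebra of the Euclidean operators: coercivity and the bilaplacian identity. -/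

section FlatOperators

variable {V : Type*} [AddCommGroup V] [Module ℝ V]

/-- The divergence `∂_b J_{abc}` of the Euclidean metric, in terms of `G e a b c = ∂_e J_{abc}`. -/
def flatMid (G : Fin 3 → Fin 3 → Fin 3 → Fin 3 → V) (a c : Fin 3) : V := ∑ b, G b a b c

/-- The operator `𝒟*` of the Euclidean metric. -/
noncomputable def flatD (G : Fin 3 → Fin 3 → Fin 3 → Fin 3 → V) (a c : Fin 3) : V :=
  flatMid G a c + flatMid G c a - (if a = c then (2 / 3 : ℝ) • ∑ u, flatMid G u u else 0)

/-- The operator `𝒬` of the Euclidean metric. -/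
noncomputable def flatQ (G : Fin 3 → Fin 3 → Fin 3 → Fin 3 → V) (a : Fin 3) : V :=
  ∑ e, ∑ b, ∑ c, permSign e b c • G e a b c

/-- The symmetries of `IsJac`, for arrays with values in a module. -/
def JacSymm (J : Fin 3 → Fin 3 → Fin 3 → V) : Prop :=
  ∀ a b c, J a b c + J c a b + J b c a = 0 ∧ J a b c + J a c b = 0

variable {J : Fin 3 → Fin 3 → Fin 3 → V}

/-- Such an array is `J_{abc} = ε_{bcd} s_{ad}` with `s` trace-free. -/
theorem JacSymm.exists_eq (hJ : JacSymm J) : ∃ s : Fin 3 → Fin 3 → V,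
    s 2 2 = - s 0 0 - s 1 1 ∧
    J = fun a b c => ![![0, s a 2, - s a 1], ![- s a 2, 0, s a 0], ![s a 1, - s a 0, 0]] b c := by
  have self : ∀ a b, J a b b = 0 := fun a b => by
    have h := (hJ a b b).2
    rw [← two_smul ℝ] at h
    simpa using h
  have anti : ∀ a b c, J a b c = - J a c b := fun a b c => eq_neg_of_add_eq_zero_left (hJ a b c).2
  refine ⟨fun a => ![J a 1 2, J a 2 0, J a 0 1], ?_, ?_⟩
  -- The trace of `s` is the cyclic sum `J 0 1 2 + J 1 2 0 + J 2 0 1`.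
  · have h := (hJ 0 1 2).1
    simp only [Matrix.cons_val]
    rw [← sub_eq_zero, ← h]; abel
  · funext a b c
    fin_cases b <;> fin_cases c <;> simp [self] <;> exact anti _ _ _

-- Sum-of-squares argument: with `J` written through `s`, the right side minus the left side is a
-- nonnegative combination of squares, formed from the symmetrised curl of `s + sᵀ` and the curl of
-- the axial vector of `s - sᵀ`. The identity is not pointwise; it uses `hnull`, which lets
-- derivatives be exchanged between the two factors as integration by parts does. Keeping `B` and
-- `d` abstract turns the check into polynomial algebra.
set_option maxHeartbeats 4000000 in
theorem coercive_of_bilin (d : Fin 3 → V →ₗ[ℝ] V) (B : V →ₗ[ℝ] V →ₗ[ℝ] ℝ)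
    (hsymm : ∀ u v, B u v = B v u) (hpos : ∀ u, 0 ≤ B u u)
    (hnull : ∀ i j u v, B (d i u) (d j v) = B (d j u) (d i v)) (hJ : JacSymm J) :
    2 * ∑ e, ∑ a, ∑ b, ∑ c, B (d e (J a b c)) (d e (J a b c)) ≤
      3 * ∑ a, ∑ c, B (flatD (fun e a b c => d e (J a b c)) a c)
          (flatD (fun e a b c => d e (J a b c)) a c) +
      3 / 2 * ∑ a, B (flatQ (fun e a b c => d e (J a b c)) a)
          (flatQ (fun e a b c => d e (J a b c)) a) := by
  obtain ⟨s, hs, rfl⟩ := hJ.exists_eq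
  have hnull' : ∀ i j u v, B (d i u) (d j v) = B (d i v) (d j u) := fun i j u v => by
    rw [hnull, hsymm]
  -- the curls of the symmetric and of the antisymmetric part
  let A : Fin 3 → Fin 3 → V := fun a b => s a b + s b a
  let R : Fin 3 → Fin 3 → V := fun a c => d (c + 1) (A a (c + 2)) - d (c + 2) (A a (c + 1))
  let v : Fin 3 → V := fun k => s (k + 1) (k + 2) - s (k + 2) (k + 1)
  let w : Fin 3 → V := fun k => d (k + 1) (v (k + 2)) - d (k + 2) (v (k + 1))
  have key : 3 * ∑ a, ∑ c, B (flatD (fun e a b c => d e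
        (![![0, s a 2, - s a 1], ![- s a 2, 0, s a 0], ![s a 1, - s a 0, 0]] b c)) a c)
          (flatD (fun e a b c => d e
        (![![0, s a 2, - s a 1], ![- s a 2, 0, s a 0], ![s a 1, - s a 0, 0]] b c)) a c) +
      3 / 2 * ∑ a, B (flatQ (fun e a b c => d e
        (![![0, s a 2, - s a 1], ![- s a 2, 0, s a 0], ![s a 1, - s a 0, 0]] b c)) a)
          (flatQ (fun e a b c => d e
        (![![0, s a 2, - s a 1], ![- s a 2, 0, s a 0], ![s a 1, - s a 0, 0]] b c)) a)
      - 2 * ∑ e, ∑ a, ∑ b, ∑ c,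
        B (d e (![![0, s a 2, - s a 1], ![- s a 2, 0, s a 0], ![s a 1, - s a 0, 0]] b c))
        (d e (![![0, s a 2, - s a 1], ![- s a 2, 0, s a 0], ![s a 1, - s a 0, 0]] b c)) =
      1 / 2 * ∑ a, ∑ c, B (R a c + R c a) (R a c + R c a) + ∑ k, B (w k) (w k) := by
    simp only [R, w, v, A, flatD, flatQ, flatMid, permSign, Fin.sum_univ_three]
    simp [hs]
    simp only [hnull, hnull']
    ring
  have h1 : 0 ≤ 1 / 2 * ∑ a, ∑ c, B (R a c + R c a) (R a c + R c a) + ∑ k, B (w k) (w k) := by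
    have := Finset.sum_nonneg fun a (_ : a ∈ Finset.univ) =>
      Finset.sum_nonneg fun c (_ : c ∈ Finset.univ) => hpos (R a c + R c a)
    have := Finset.sum_nonneg fun a (_ : a ∈ Finset.univ) => hpos (w a)
    positivity
  linarith


/-- The Laplacian built from three commuting operators. -/
def lapl (d : Fin 3 → V →ₗ[ℝ] V) (u : V) : V := ∑ i, d i (d i u)

-- The overdetermined system is elliptic: `𝒬 J` is twice the divergence of the rows of `s` and `𝒟*
-- J` contains their curls, and third derivatives of these recover `Δ² s`. Only commutation of the
-- operators is used, so each of the nine components is a linear identity.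
set_option maxHeartbeats 4000000 in
theorem lapl_lapl_eq (d : Fin 3 → V →ₗ[ℝ] V) (hcomm : ∀ i j u, d i (d j u) = d j (d i u))
    (s : Fin 3 → Fin 3 → V) (hs : s 2 2 = - s 0 0 - s 1 1) (a k : Fin 3)
    (D : Fin 3 → Fin 3 → V) (Q : Fin 3 → V)
    (hD : D = flatD (fun e a b c => d e
        (![![0, s a 2, - s a 1], ![- s a 2, 0, s a 0], ![s a 1, - s a 0, 0]] b c)))
    (hQ : Q = flatQ (fun e a b c => d e
        (![![0, s a 2, - s a 1], ![- s a 2, 0, s a 0], ![s a 1, - s a 0, 0]] b c))) :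
    (4 : ℝ) • lapl d (lapl d (s a k)) =
      (2 : ℝ) • ∑ i, d i (d i (d k (Q a)))
      + (2 : ℝ) • ∑ b, ∑ c, permSign k b c • ∑ i, d i (d i (d b (D a c)))
      - (2 : ℝ) • ∑ b, permSign k b a • ∑ m, ∑ n, d b (d m (d n (D m n)))
      + ∑ m, d a (d k (d m (Q m)))
      + (2 : ℝ) • ∑ m, ∑ n, permSign k m n • ∑ c, d a (d m (d c (D n c)))
      - if k = a then ∑ i, ∑ m, d i (d i (d m (Q m))) else 0 := by
  subst hD hQ
  fin_cases a <;> fin_cases k <;>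
    simp [lapl, flatD, flatQ, flatMid, permSign, Fin.sum_univ_three, hs] <;>
    simp only [hcomm 1 0, hcomm 2 0, hcomm 2 1] <;> module

theorem abs_permSign_le (a b c : Fin 3) : |permSign a b c| ≤ 1 := by
  fin_cases a <;> fin_cases b <;> fin_cases c <;> norm_num [permSign]

theorem abs_sum_fin_three_le {f : Fin 3 → ℝ} {M : ℝ} (h : ∀ i, |f i| ≤ M) :
    |∑ i, f i| ≤ 3 * M :=
  (Finset.abs_sum_le_sum_abs _ _).trans <| (Finset.sum_le_sum fun i _ => h i).trans <| by simp

theorem abs_mul_le_of_abs_le_one {a b M : ℝ} (ha : |a| ≤ 1) (hb : |b| ≤ M) : |a * b| ≤ M := by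
  rw [abs_mul]
  exact (mul_le_mul ha hb (abs_nonneg _) zero_le_one).trans (one_mul M).le

/-- A linear functional that is bounded by `M` on all third derivatives of `𝒟* J` and `𝒬 J` is
bounded by `45 M` on the components of `Δ² J`. -/
theorem abs_lapl_lapl_le (d : Fin 3 → V →ₗ[ℝ] V) (hcomm : ∀ i j u, d i (d j u) = d j (d i u))
    (hJ : JacSymm J) (l : V →ₗ[ℝ] ℝ) {M : ℝ}
    (hD : ∀ i j k m n, |l (d i (d j (d k (flatD (fun e a b c => d e (J a b c)) m n))))| ≤ M)
    (hQ : ∀ i j k m, |l (d i (d j (d k (flatQ (fun e a b c => d e (J a b c)) m))))| ≤ M)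
    (a b c : Fin 3) : |l (lapl d (lapl d (J a b c)))| ≤ 45 * M := by
  have hM : 0 ≤ M := (abs_nonneg _).trans (hQ 0 0 0 0)
  obtain ⟨s, hs, rfl⟩ := hJ.exists_eq
  have main : ∀ a k, |l (lapl d (lapl d (s a k)))| ≤ 45 * M := fun a k => by
    have h := congrArg l (lapl_lapl_eq d hcomm s hs a k _ _ rfl rfl)
    set D := flatD (fun e a b c => d e
        (![![0, s a 2, - s a 1], ![- s a 2, 0, s a 0], ![s a 1, - s a 0, 0]] b c))
    set Q := flatQ (fun e a b c => d e
        (![![0, s a 2, - s a 1], ![- s a 2, 0, s a 0], ![s a 1, - s a 0, 0]] b c))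
    have h1 : |∑ i, l (d i (d i (d k (Q a))))| ≤ 3 * M := abs_sum_fin_three_le fun i => hQ _ _ _ _
    have h2 : |∑ b, ∑ c, permSign k b c * ∑ i, l (d i (d i (d b (D a c))))| ≤ 3 * (3 * (3 * M)) :=
      abs_sum_fin_three_le fun b => abs_sum_fin_three_le fun c =>
        abs_mul_le_of_abs_le_one (abs_permSign_le _ _ _) <| abs_sum_fin_three_le fun i => hD _ _ _ _ _
    have h3 : |∑ b, permSign k b a * ∑ m, ∑ n, l (d b (d m (d n (D m n))))| ≤ 3 * (3 * (3 * M)) :=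
      abs_sum_fin_three_le fun b =>
        abs_mul_le_of_abs_le_one (abs_permSign_le _ _ _) <|
        abs_sum_fin_three_le fun i => abs_sum_fin_three_le fun i => hD _ _ _ _ _
    have h4 : |∑ m, l (d a (d k (d m (Q m))))| ≤ 3 * M := abs_sum_fin_three_le fun i => hQ _ _ _ _
    have h5 : |∑ m, ∑ n, permSign k m n * ∑ c, l (d a (d m (d c (D n c))))| ≤ 3 * (3 * (3 * M)) :=
      abs_sum_fin_three_le fun b => abs_sum_fin_three_le fun c =>
        abs_mul_le_of_abs_le_one (abs_permSign_le _ _ _) <| abs_sum_fin_three_le fun i => hD _ _ _ _ _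
    have h6 : |l (if k = a then ∑ i, ∑ m, d i (d i (d m (Q m))) else 0)| ≤ 3 * (3 * M) := by
      split_ifs
      · simp only [map_sum]
        exact abs_sum_fin_three_le fun b => abs_sum_fin_three_le fun c => hQ _ _ _ _
      · simpa using by positivity
    simp only [map_add, map_sub, map_smul, map_sum, smul_eq_mul] at h
    rw [abs_le] at *
    -- The six terms contribute `6 + 54 + 54 + 3 + 54 + 9 = 180 = 4 · 45`, against the factor `4` on
    -- the left.
    constructor <;> linarith [h1.1, h1.2, h2.1, h2.2, h3.1, h3.2, h4.1, h4.2, h5.1, h5.2, h6.1, h6.2]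
  have neg : ∀ u, lapl d (lapl d (-u)) = - lapl d (lapl d u) := fun u => by simp [lapl]
  have zero : lapl d (lapl d 0) = 0 := by simp [lapl]
  fin_cases b <;> fin_cases c <;> simp [neg, zero, main, hM]

end FlatOperators

/-! ### Calculus of test functions and their `L²` pairing. -/

section TestFunctions

/-- The `i`-th standard basis vector. -/
noncomputable abbrev bvec (i : Fin 3) : E3 := EuclideanSpace.single i 1

/-- The partial derivative `∂ᵢ f` of a differentiable function. -/
noncomputable def pd (i : Fin 3) (f : E3 → ℝ) (x : E3) : ℝ := fderiv ℝ f x (bvec i)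

theorem pd_eq_of_hasFDerivAt {f : E3 → ℝ} {f' : E3 →L[ℝ] ℝ} {x : E3} (h : HasFDerivAt f f' x)
    (i : Fin 3) : pd i f x = f' (bvec i) := by rw [pd, h.fderiv]

theorem contDiff_pd {f : E3 → ℝ} (hf : ContDiff ℝ ∞ f) (i : Fin 3) : ContDiff ℝ ∞ (pd i f) :=
  (hf.fderiv_right (m := ∞) (by simp)).clm_apply contDiff_const

theorem hasCompactSupport_pd {f : E3 → ℝ} (hf : HasCompactSupport f) (i : Fin 3) :
    HasCompactSupport (pd i f) :=
  hf.fderiv_apply ℝ _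

theorem differentiable_of_smooth {f : E3 → ℝ} (hf : ContDiff ℝ ∞ f) : Differentiable ℝ f :=
  hf.differentiable (by simp)

theorem pd_add {f g : E3 → ℝ} (hf : ContDiff ℝ ∞ f) (hg : ContDiff ℝ ∞ g) (i : Fin 3) :
    pd i (f + g) = pd i f + pd i g := by
  funext x
  rw [pd_eq_of_hasFDerivAt ((differentiable_of_smooth hf x).hasFDerivAt.add
    (differentiable_of_smooth hg x).hasFDerivAt)]
  rfl

theorem pd_smul {f : E3 → ℝ} (hf : ContDiff ℝ ∞ f) (c : ℝ) (i : Fin 3) :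
    pd i (c • f) = c • pd i f := by
  funext x
  rw [pd_eq_of_hasFDerivAt ((differentiable_of_smooth hf x).hasFDerivAt.const_smul c)]
  rfl

theorem pd_mul {f g : E3 → ℝ} (hf : ContDiff ℝ ∞ f) (hg : ContDiff ℝ ∞ g) (i : Fin 3) (x : E3) :
    pd i (fun y => f y * g y) x = f x * pd i g x + pd i f x * g x := by
  refine (pd_eq_of_hasFDerivAt ((differentiable_of_smooth hf x).hasFDerivAt.mul
    (differentiable_of_smooth hg x).hasFDerivAt) i).trans ?_
  simp [pd, mul_comm]

theorem pd_comm {f : E3 → ℝ} (hf : ContDiff ℝ ∞ f) (i j : Fin 3) :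
    pd i (pd j f) = pd j (pd i f) := by
  funext x
  have h (k : Fin 3) : HasFDerivAt (pd k f) ((fderiv ℝ (fderiv ℝ f) x).flip (bvec k)) x := by
    have := ((hf.fderiv_right (m := ∞) (by simp)).differentiable (by simp) x).hasFDerivAt
    have h2 := this.clm_apply (hasFDerivAt_const (bvec k) x)
    simp only [ContinuousLinearMap.comp_zero, zero_add] at h2
    exact h2
  rw [pd_eq_of_hasFDerivAt (h j), pd_eq_of_hasFDerivAt (h i)]
  exact (hf.contDiffAt.isSymmSndFDerivAt (n := ∞) (by
    rw [minSmoothness_of_isRCLikeNormedField]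
    exact WithTop.coe_le_coe.2 (le_top (a := (2 : ℕ∞))))) (bvec i) (bvec j)

theorem pd_comp_sub_left {f : E3 → ℝ} (hf : ContDiff ℝ ∞ f) (i : Fin 3) (x y : E3) :
    pd i (fun z => f (x - z)) y = - pd i f (x - y) := by
  have h1 : HasFDerivAt (fun z : E3 => x - z) (-(ContinuousLinearMap.id ℝ E3)) y :=
    (hasFDerivAt_id y).const_sub x
  refine (pd_eq_of_hasFDerivAt
    ((differentiable_of_smooth hf (x - y)).hasFDerivAt.comp y h1) i).trans ?_
  simp [pd]

/-- Integration by parts. -/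
theorem integral_mul_pd {f g : E3 → ℝ} (hf : ContDiff ℝ ∞ f) (hg : ContDiff ℝ ∞ g)
    (hc : HasCompactSupport g) (i : Fin 3) : ∫ x, f x * pd i g x = - ∫ x, pd i f x * g x := by
  refine integral_mul_fderiv_eq_neg_fderiv_mul_of_integrable ?_ ?_ ?_ ?_ ?_
  · exact ((contDiff_pd hf i).continuous.mul hg.continuous).integrable_of_hasCompactSupport
      hc.mul_left
  · exact (hf.continuous.mul (contDiff_pd hg i).continuous).integrable_of_hasCompactSupport
      (hasCompactSupport_pd hc i).mul_left
  · exact (hf.continuous.mul hg.continuous).integrable_of_hasCompactSupport hc.mul_left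
  · exact fun x _ => differentiable_of_smooth hf x
  · exact fun x _ => differentiable_of_smooth hg x

theorem integral_sub_mul_pd {f g : E3 → ℝ} (hf : ContDiff ℝ ∞ f) (hg : ContDiff ℝ ∞ g)
    (hc : HasCompactSupport g) (i : Fin 3) (x : E3) :
    ∫ y, f (x - y) * pd i g y = ∫ y, pd i f (x - y) * g y := by
  rw [integral_mul_pd (f := fun y => f (x - y)) (hf.comp (contDiff_const.sub contDiff_id)) hg hc,
    ← integral_neg]
  simp [pd_comp_sub_left hf]

/-- Smooth functions with compact support. -/
def testFn : Submodule ℝ (E3 → ℝ) where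
  carrier := {f | ContDiff ℝ ∞ f ∧ HasCompactSupport f}
  add_mem' h1 h2 := ⟨h1.1.add h2.1, h1.2.add h2.2⟩
  zero_mem' := ⟨contDiff_const, HasCompactSupport.zero⟩
  smul_mem' c _ h := ⟨h.1.const_smul c, h.2.smul_left (f := fun _ => c)⟩

/-- The partial derivative as an operator on test functions. -/
noncomputable def testD (i : Fin 3) : testFn →ₗ[ℝ] testFn where
  toFun f := ⟨pd i f, contDiff_pd f.2.1 i, hasCompactSupport_pd f.2.2 i⟩
  map_add' f g := Subtype.ext (pd_add f.2.1 g.2.1 i)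
  map_smul' c f := Subtype.ext (pd_smul f.2.1 c i)

theorem testD_apply (i : Fin 3) (f : testFn) (x : E3) : (testD i f : E3 → ℝ) x = pd i f x := rfl

theorem testD_comm (i j : Fin 3) (f : testFn) : testD i (testD j f) = testD j (testD i f) :=
  Subtype.ext (pd_comm f.2.1 i j)

theorem integrable_mul_testFn {K : E3 → ℝ} (hK : Continuous K) (f : testFn) :
    Integrable fun x => K x * (f : E3 → ℝ) x :=
  (hK.mul f.2.1.continuous).integrable_of_hasCompactSupport f.2.2.mul_left

/-- The `L²` inner product of test functions. -/
noncomputable def testInner : testFn →ₗ[ℝ] testFn →ₗ[ℝ] ℝ :=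
  LinearMap.mk₂ ℝ (fun f g => ∫ x, (f : E3 → ℝ) x * (g : E3 → ℝ) x)
    (fun f g h => by
      rw [← integral_add (integrable_mul_testFn f.2.1.continuous _)
        (integrable_mul_testFn g.2.1.continuous _)]
      simp [add_mul])
    (fun c f g => by
      rw [smul_eq_mul, ← integral_const_mul]; simp [mul_assoc])
    (fun f g h => by
      rw [← integral_add (integrable_mul_testFn f.2.1.continuous _)
        (integrable_mul_testFn f.2.1.continuous _)]
      simp [mul_add])
    (fun c f g => by
      rw [smul_eq_mul, ← integral_const_mul]; simp [mul_left_comm])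

theorem testInner_apply (f g : testFn) :
    testInner f g = ∫ x, (f : E3 → ℝ) x * (g : E3 → ℝ) x := rfl

theorem testInner_symm (f g : testFn) : testInner f g = testInner g f := by
  simp [testInner_apply, mul_comm]

theorem testInner_self_nonneg (f : testFn) : 0 ≤ testInner f f :=
  integral_nonneg fun _ => mul_self_nonneg _

theorem testInner_testD_right (i : Fin 3) (f g : testFn) :
    testInner f (testD i g) = - testInner (testD i f) g :=
  integral_mul_pd f.2.1 g.2.1 g.2.2 i

/-- Integration by parts turns both sides into minus the pairing of a mixed second derivative of `f`
with `g`. This is the hypothesis `hnull` of `coercive_of_bilin`. -/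
theorem testInner_null (i j : Fin 3) (f g : testFn) :
    testInner (testD i f) (testD j g) = testInner (testD j f) (testD i g) := by
  rw [testInner_testD_right, testInner_testD_right, testD_comm]

/-- The functional `f ↦ ∫ K (x - y) f (y) dy`. -/
noncomputable def convFn (K : E3 → ℝ) (hK : Continuous K) (x : E3) : testFn →ₗ[ℝ] ℝ where
  toFun f := ∫ y, K (x - y) * (f : E3 → ℝ) y
  map_add' f g := by
    have h : Continuous fun y => K (x - y) := hK.comp (continuous_const.sub continuous_id)
    rw [← integral_add (integrable_mul_testFn h _) (integrable_mul_testFn h _)]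
    simp [mul_add]
  map_smul' c f := by
    rw [RingHom.id_apply, smul_eq_mul, ← integral_const_mul]; simp [mul_left_comm]

end TestFunctions

/-! ### The regularised biharmonic kernel `(|y|² + ε²)^{1/2}`. -/

section Kernel

open Filter Topology

/-- The regularised power `(|y|² + ε²)^s` of the distance to the origin. -/
noncomputable def qpow (ε s : ℝ) (y : E3) : ℝ := (‖y‖ ^ 2 + ε ^ 2) ^ s

theorem qbase_pos {ε : ℝ} (hε : 0 < ε) (y : E3) : 0 < ‖y‖ ^ 2 + ε ^ 2 := by positivity

theorem contDiff_qpow {ε : ℝ} (hε : 0 < ε) (s : ℝ) : ContDiff ℝ ∞ (qpow ε s) :=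
  ((contDiff_norm_sq ℝ).add contDiff_const).rpow_const_of_ne fun y => (qbase_pos hε y).ne'

theorem contDiff_coord (i : Fin 3) : ContDiff ℝ ∞ fun y : E3 => y i :=
  (EuclideanSpace.proj (𝕜 := ℝ) i).contDiff

theorem pd_coord (i j : Fin 3) (x : E3) : pd i (fun y : E3 => y j) x = if i = j then 1 else 0 := by
  refine (pd_eq_of_hasFDerivAt (EuclideanSpace.proj (𝕜 := ℝ) j).hasFDerivAt i).trans ?_
  simp [bvec, eq_comm]

theorem pd_const_mul {f : E3 → ℝ} (hf : ContDiff ℝ ∞ f) (c : ℝ) (i : Fin 3) (x : E3) :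
    pd i (fun y => c * f y) x = c * pd i f x :=
  congrFun (pd_smul hf c i) x

theorem pd_norm_sq_add_rpow {c : ℝ} (s : ℝ) (i : Fin 3) {y : E3} (h : 0 < ‖y‖ ^ 2 + c) :
    pd i (fun y => (‖y‖ ^ 2 + c) ^ s) y = 2 * s * (y i * (‖y‖ ^ 2 + c) ^ (s - 1)) := by
  have h1 : HasFDerivAt (fun y : E3 => ‖y‖ ^ 2 + c) (2 • innerSL ℝ y) y :=
    (hasStrictFDerivAt_norm_sq y).hasFDerivAt.add_const _
  refine (pd_eq_of_hasFDerivAt (h1.rpow_const (Or.inl h.ne')) i).trans ?_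
  simp [bvec, EuclideanSpace.inner_single_right]
  ring

theorem pd_qpow {ε : ℝ} (hε : 0 < ε) (s : ℝ) (i : Fin 3) :
    pd i (qpow ε s) = fun y => 2 * s * (y i * qpow ε (s - 1) y) :=
  funext fun y => pd_norm_sq_add_rpow s i (qbase_pos hε y)

theorem pd_pd_qpow {ε : ℝ} (hε : 0 < ε) (s : ℝ) (i j : Fin 3) :
    pd i (pd j (qpow ε s)) = fun y => 2 * s * (y j * (2 * (s - 1) * (y i * qpow ε (s - 1 - 1) y)) +
      (if i = j then 1 else 0) * qpow ε (s - 1) y) := by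
  funext y
  rw [pd_qpow hε, pd_const_mul ((contDiff_coord j).mul (contDiff_qpow hε _)),
    pd_mul (contDiff_coord j) (contDiff_qpow hε _), pd_qpow hε, pd_coord]

theorem pd_pd_pd_qpow {ε : ℝ} (hε : 0 < ε) (s : ℝ) (i j k : Fin 3) (y : E3) :
    pd k (pd i (pd j (qpow ε s))) y = 2 * s * (2 * (s - 1) * (y j * y i *
      (2 * (s - 1 - 1) * (y k * qpow ε (s - 1 - 1 - 1) y)) + (y j * (if k = i then 1 else 0) +
      (if k = j then 1 else 0) * y i) * qpow ε (s - 1 - 1) y) +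
      (if i = j then 1 else 0) * (2 * (s - 1) * (y k * qpow ε (s - 1 - 1) y))) := by
  have h1 := (contDiff_coord j).mul (contDiff_coord i)
  have h2 := h1.mul (contDiff_qpow hε (s - 1 - 1))
  have h3 := contDiff_qpow hε (s - 1)
  have e : pd i (pd j (qpow ε s)) = fun y => 2 * s * ((2 * (s - 1)) • (fun y : E3 =>
      y j * y i * qpow ε (s - 1 - 1) y) +
      (if i = j then (1 : ℝ) else 0) • qpow ε (s - 1)) y := by
    rw [pd_pd_qpow hε]
    funext y
    simp only [Pi.add_apply, Pi.smul_apply, smul_eq_mul]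
    ring
  rw [e]
  refine (pd_const_mul ((h2.const_smul (2 * (s - 1))).add (h3.const_smul
    (if i = j then (1 : ℝ) else 0))) (2 * s) k y).trans ?_
  refine congrArg (2 * s * ·) ?_
  have e1 := congrFun (pd_add (f := (2 * (s - 1)) • fun y : E3 => y j * y i * qpow ε (s - 1 - 1) y)
    (g := (if i = j then (1 : ℝ) else 0) • qpow ε (s - 1)) (h2.const_smul (2 * (s - 1)))
    (h3.const_smul (if i = j then (1 : ℝ) else 0)) k) y
  refine e1.trans ?_
  rw [pd_smul h2, pd_smul h3, pd_qpow hε]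
  simp only [Pi.add_apply, Pi.smul_apply, smul_eq_mul]
  rw [pd_mul h1 (contDiff_qpow hε _), pd_mul (contDiff_coord j) (contDiff_coord i), pd_coord,
    pd_coord, pd_qpow hε]

theorem abs_coord_le {ε : ℝ} (y : E3) (i : Fin 3) : |y i| ≤ qpow ε (1 / 2) y := by
  rw [qpow, ← Real.sqrt_eq_rpow]
  refine Real.le_sqrt_of_sq_le ?_
  rw [sq_abs, EuclideanSpace.norm_sq_eq]
  have := Finset.single_le_sum (f := fun i => ‖y i‖ ^ 2) (fun i _ => by positivity)
    (Finset.mem_univ i)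
  simp only [Real.norm_eq_abs, sq_abs] at this ⊢
  nlinarith [sq_nonneg ε]

theorem norm_le_qpow_half (ε : ℝ) (y : E3) : ‖y‖ ≤ qpow ε (1 / 2) y := by
  rw [qpow, ← Real.sqrt_eq_rpow]
  exact Real.le_sqrt_of_sq_le (by nlinarith [sq_nonneg ε])

theorem qpow_half_pos {ε : ℝ} (hε : 0 < ε) (y : E3) : 0 < qpow ε (1 / 2) y :=
  Real.rpow_pos_of_pos (qbase_pos hε y) _

theorem qpow_eq_inv_pow {ε : ℝ} (hε : 0 < ε) (y : E3) {s : ℝ} {n : ℕ} (hs : s = -(n / 2)) :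
    qpow ε s y = (qpow ε (1 / 2) y)⁻¹ ^ n := by
  rw [qpow, qpow, ← Real.rpow_neg (qbase_pos hε y).le, ← Real.rpow_natCast _ n,
    ← Real.rpow_mul (qbase_pos hε y).le, hs]
  congr 1
  ring

theorem abs_ite_one_zero_le (p : Prop) [Decidable p] : |(if p then 1 else 0 : ℝ)| ≤ 1 := by
  split_ifs <;> simp

theorem abs_pd_pd_kernel_le {ε : ℝ} (hε : 0 < ε) (i j : Fin 3) (y : E3) :
    |pd i (pd j (qpow ε (1 / 2))) y| ≤ 2 * (qpow ε (1 / 2) y)⁻¹ := by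
  simp only [pd_pd_qpow hε]
  rw [qpow_eq_inv_pow hε y (n := 1) (s := 1 / 2 - 1) (by norm_num),
    qpow_eq_inv_pow hε y (n := 3) (s := 1 / 2 - 1 - 1) (by norm_num)]
  set t := qpow ε (1 / 2) y
  have ht : 0 < t := qpow_half_pos hε y
  -- Each coordinate is `t` times a factor of size at most one, so the derivative becomes a power of
  -- `t` times a bounded polynomial, uniformly in `ε`.
  have key (k : Fin 3) : ∃ a, |a| ≤ 1 ∧ y k = a * t := ⟨y k / t, by
    rw [abs_div, abs_of_pos ht, div_le_one ht]; exact abs_coord_le y k, by field_simp⟩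
  obtain ⟨a, ha, ea⟩ := key i
  obtain ⟨b, hb, eb⟩ := key j
  have hd := abs_ite_one_zero_le (i = j)
  set d : ℝ := if i = j then 1 else 0
  rw [ea, eb]
  have : 2 * (1 / 2) * (b * t * (2 * (1 / 2 - 1) * (a * t * t⁻¹ ^ 3)) + d * t⁻¹ ^ 1) =
    (d - a * b) * t⁻¹ := by field_simp; ring
  rw [this, abs_mul, abs_of_pos (inv_pos.2 ht)]
  gcongr
  have hab := abs_mul_le_of_abs_le_one ha hb
  calc |d - a * b| ≤ |d| + |a * b| := abs_sub _ _
    _ ≤ 2 := by linarith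

theorem abs_pd_pd_pd_kernel_le {ε : ℝ} (hε : 0 < ε) (i j k : Fin 3) (y : E3) :
    |pd k (pd i (pd j (qpow ε (1 / 2)))) y| ≤ 6 * (qpow ε (1 / 2) y)⁻¹ ^ 2 := by
  rw [pd_pd_pd_qpow hε, qpow_eq_inv_pow hε y (n := 5) (s := 1 / 2 - 1 - 1 - 1) (by norm_num),
    qpow_eq_inv_pow hε y (n := 3) (s := 1 / 2 - 1 - 1) (by norm_num)]
  set t := qpow ε (1 / 2) y
  have ht : 0 < t := qpow_half_pos hε y
  have key (k : Fin 3) : ∃ a, |a| ≤ 1 ∧ y k = a * t := ⟨y k / t, by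
    rw [abs_div, abs_of_pos ht, div_le_one ht]; exact abs_coord_le y k, by field_simp⟩
  obtain ⟨a, ha, ea⟩ := key i
  obtain ⟨b, hb, eb⟩ := key j
  obtain ⟨c, hc, ec⟩ := key k
  have hd1 := abs_mul_le_of_abs_le_one (abs_ite_one_zero_le (k = i)) hb
  have hd2 := abs_mul_le_of_abs_le_one (abs_ite_one_zero_le (k = j)) ha
  have hd3 := abs_mul_le_of_abs_le_one (abs_ite_one_zero_le (i = j)) hc
  set d1 : ℝ := if k = i then 1 else 0
  set d2 : ℝ := if k = j then 1 else 0
  set d3 : ℝ := if i = j then 1 else 0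
  rw [ea, eb, ec]
  have : 2 * (1 / 2) * (2 * (1 / 2 - 1) * (b * t * (a * t) *
      (2 * (1 / 2 - 1 - 1) * (c * t * t⁻¹ ^ 5)) + (b * t * d1 +
      d2 * (a * t)) * t⁻¹ ^ 3) + d3 * (2 * (1 / 2 - 1) * (c * t * t⁻¹ ^ 3))) =
    (3 * (b * (a * c)) - d1 * b - d2 * a - d3 * c) * t⁻¹ ^ 2 := by field_simp; ring
  rw [this, abs_mul, abs_of_pos (a := t⁻¹ ^ 2) (by positivity)]
  gcongr
  have habc := abs_mul_le_of_abs_le_one hb (abs_mul_le_of_abs_le_one ha hc)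
  rw [abs_le] at *
  constructor <;> linarith [habc.1, habc.2, hd1.1, hd1.2, hd2.1, hd2.2, hd3.1, hd3.2]

theorem convFn_testD {K : E3 → ℝ} (hK : ContDiff ℝ ∞ K) (x : E3) (i : Fin 3) (f : testFn) :
    convFn K hK.continuous x (testD i f) =
      convFn (pd i K) (contDiff_pd hK i).continuous x f :=
  integral_sub_mul_pd hK f.2.1 f.2.2 i x

/-- In dimension three `Δ q^s = 2s(2s+1) q^{s-1} - 4s(s-1) ε² q^{s-2}` for `q = |y|² + ε²`. The
derivatives are first moved from `f` to the kernel. -/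
theorem convFn_qpow_lapl {ε : ℝ} (hε : 0 < ε) (s : ℝ) (x : E3) (f : testFn) :
    convFn (qpow ε s) (contDiff_qpow hε s).continuous x (lapl testD f) =
      2 * s * (2 * s + 1) * convFn (qpow ε (s - 1)) (contDiff_qpow hε _).continuous x f -
      4 * s * (s - 1) * ε ^ 2 *
        convFn (qpow ε (s - 1 - 1)) (contDiff_qpow hε _).continuous x f := by
  have hi (s : ℝ) : Integrable fun y => qpow ε s (x - y) * (f : E3 → ℝ) y :=
    integrable_mul_testFn ((contDiff_qpow hε s).continuous.comp (by fun_prop)) f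
  have hi2 (i : Fin 3) :
      Integrable fun y => pd i (pd i (qpow ε s)) (x - y) * (f : E3 → ℝ) y :=
    integrable_mul_testFn ((contDiff_pd (contDiff_pd (contDiff_qpow hε s) i) i).continuous.comp
      (by fun_prop)) f
  simp only [lapl, map_sum]
  simp only [convFn_testD (contDiff_qpow hε s),
    convFn_testD (contDiff_pd (contDiff_qpow hε s) _)]
  simp only [convFn, LinearMap.coe_mk, AddHom.coe_mk]
  rw [← integral_finsetSum _ fun i _ => hi2 i, ← integral_const_mul, ← integral_const_mul,
    ← integral_sub ((hi _).const_mul _) ((hi _).const_mul _)]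
  congr 1
  funext y
  simp only [pd_pd_qpow hε, Fin.sum_univ_three, if_true]
  have e : qpow ε (s - 1) (x - y) = (‖x - y‖ ^ 2 + ε ^ 2) * qpow ε (s - 1 - 1) (x - y) := by
    rw [qpow, qpow, Real.rpow_sub_one (qbase_pos hε _).ne' (s - 1), mul_div_cancel₀ _
      (qbase_pos hε _).ne']
  rw [e, EuclideanSpace.norm_sq_eq (x - y)]
  simp only [Real.norm_eq_abs, sq_abs, Fin.sum_univ_three]
  ring

/-- The recursion is used at `s = 1/2`, `-1/2` and `-3/2`. At `-1/2` the leading factor `2s + 1`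
vanishes, the two `q^{-5/2}` terms cancel, and only the concentrating term `ε⁴ q^{-7/2}` survives.
-/
theorem convFn_kernel_lapl_lapl {ε : ℝ} (hε : 0 < ε) (x : E3) (f : testFn) :
    convFn (qpow ε (1 / 2)) (contDiff_qpow hε _).continuous x (lapl testD (lapl testD f)) =
      -15 * ∫ y, ε ^ 4 * qpow ε (-(7 / 2)) (x - y) * (f : E3 → ℝ) y := by
  have e : convFn (qpow ε (-(7 / 2))) (contDiff_qpow hε _).continuous x f =
      ∫ y, qpow ε (-(7 / 2)) (x - y) * (f : E3 → ℝ) y := rfl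
  simp only [mul_assoc, integral_const_mul]
  rw [← e, convFn_qpow_lapl hε]
  norm_num only
  rw [convFn_qpow_lapl hε, convFn_qpow_lapl hε]
  norm_num only
  ring

/-- The mass of the approximate identity `ε⁴ (|y|² + ε²)^{-7/2}`. -/
noncomputable def kmass : ℝ := ∫ z : E3, qpow 1 (-(7 / 2)) z

theorem integrable_qpow_one : Integrable (qpow 1 (-(7 / 2))) := by
  have := integrable_rpow_neg_one_add_norm_sq (E := E3) (μ := volume) (r := 7) (by simp; norm_num)
  refine this.congr (.of_forall fun y => ?_)
  simp only [qpow]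
  congr 1 <;> ring

theorem kmass_pos : 0 < kmass := by
  refine (integral_pos_iff_support_of_nonneg (fun z => ?_) integrable_qpow_one).2 ?_
  · exact Real.rpow_nonneg (by positivity) _
  · have : Function.support (qpow 1 (-(7 / 2))) = Set.univ :=
      Set.eq_univ_of_forall fun z => (Real.rpow_pos_of_pos (qbase_pos one_pos z) _).ne'
    rw [this]
    simp

theorem integral_kernel_scale {ε : ℝ} (hε : 0 < ε) (x : E3) (f : testFn) :
    ∫ y, ε ^ 4 * qpow ε (-(7 / 2)) (x - y) * (f : E3 → ℝ) y =
      ∫ z, qpow 1 (-(7 / 2)) z * (f : E3 → ℝ) (x - ε • z) := by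
  rw [← integral_sub_left_eq_self (fun y => ε ^ 4 * qpow ε (-(7 / 2)) (x - y) * (f : E3 → ℝ) y)
    volume x]
  have h := Measure.integral_comp_smul (volume : Measure E3)
    (fun y => ε ^ 4 * qpow ε (-(7 / 2)) y * (f : E3 → ℝ) (x - y)) ε
  simp only [sub_sub_cancel]
  have e : ∀ z : E3, ε ^ 4 * qpow ε (-(7 / 2)) (ε • z) = (ε ^ 3)⁻¹ * qpow 1 (-(7 / 2)) z := by
    intro z
    have : ‖ε • z‖ ^ 2 + ε ^ 2 = ε ^ 2 * (‖z‖ ^ 2 + 1 ^ 2) := by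
      rw [norm_smul, Real.norm_eq_abs, abs_of_pos hε]; ring
    rw [qpow, qpow, this, Real.mul_rpow (by positivity) (by positivity), ← mul_assoc]
    congr 1
    -- The powers combine as `ε⁴ (ε²)^{-7/2} = ε^{-3}`, which is the Jacobian of the dilation.
    rw [← Real.rpow_natCast ε 2, ← Real.rpow_mul hε.le]
    rw [← Real.rpow_natCast, ← Real.rpow_natCast, ← Real.rpow_neg hε.le, ← Real.rpow_add hε]
    norm_num
  simp only [e, mul_assoc, integral_const_mul] at h
  simp only [finrank_euclideanSpace, Fintype.card_fin, smul_eq_mul] at h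
  rw [abs_of_pos (by positivity)] at h
  have h3 : (ε ^ 3)⁻¹ ≠ 0 := by positivity
  simpa [mul_assoc, integral_const_mul] using (mul_left_cancel₀ h3 h).symm

theorem tendsto_kernel (x : E3) (f : testFn) :
    Tendsto (fun ε : ℝ => ∫ z, qpow 1 (-(7 / 2)) z * (f : E3 → ℝ) (x - ε • z)) (𝓝[>] 0)
      (𝓝 (kmass * (f : E3 → ℝ) x)) := by
  have hf := f.2.1.continuous
  obtain ⟨C, hC⟩ := f.2.2.exists_bound_of_continuous hf
  have hk := (contDiff_qpow one_pos (-(7 / 2))).continuous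
  rw [kmass, ← integral_mul_const]
  refine tendsto_integral_filter_of_dominated_convergence (fun z => qpow 1 (-(7 / 2)) z * C)
    (.of_forall fun ε => ?_) (.of_forall fun ε => .of_forall fun z => ?_)
    (integrable_qpow_one.mul_const _) (.of_forall fun z => ?_)
  · exact (hk.mul (hf.comp (by fun_prop))).aestronglyMeasurable
  · have := (Real.rpow_pos_of_pos (qbase_pos one_pos z) (-(7 / 2))).le
    rw [norm_mul, qpow, Real.norm_of_nonneg this]
    exact mul_le_mul_of_nonneg_left (hC _) this
  · refine Tendsto.const_mul _ ?_
    have : Tendsto (fun ε : ℝ => (f : E3 → ℝ) (x - ε • z)) (𝓝 0)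
        (𝓝 ((f : E3 → ℝ) (x - (0 : ℝ) • z))) := (hf.comp (by fun_prop)).tendsto 0
    rw [zero_smul, sub_zero] at this
    exact this.mono_left nhdsWithin_le_nhds

/-- The value of a test function is controlled by the pairings of its bilaplacian with the
regularised biharmonic kernel. -/
theorem abs_le_of_kernel_bound (x : E3) (f : testFn) {M : ℝ}
    (h : ∀ ε (hε : 0 < ε), |convFn (qpow ε (1 / 2)) (contDiff_qpow hε _).continuous x
      (lapl testD (lapl testD f))| ≤ M) : |(f : E3 → ℝ) x| ≤ (15 * kmass)⁻¹ * M := by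
  have ht := ((tendsto_kernel x f).abs).const_mul 15
  have : 15 * |kmass * (f : E3 → ℝ) x| ≤ M := by
    refine le_of_tendsto ht ?_
    filter_upwards [self_mem_nhdsWithin] with ε hε
    have := h ε hε
    rw [convFn_kernel_lapl_lapl hε, integral_kernel_scale hε, abs_mul] at this
    norm_num at this ⊢
    exact this
  rw [abs_mul, abs_of_pos kmass_pos] at this
  rw [inv_mul_eq_div, le_div_iff₀ (by have := kmass_pos; positivity)]
  linarith

end Kernel

/-! ### Weighted integrals of the Riesz kernels `|z|^{-p}`. -/

section RieszKernel

open Filter Topology Metric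

theorem sigma_eq_qpow (x : E3) : sigma x = qpow 1 (1 / 2) x := by
  rw [sigma, qpow, Real.sqrt_eq_rpow, one_pow, add_comm]

theorem sigma_rpow_eq_qpow (s : ℝ) (x : E3) : sigma x ^ s = qpow 1 (s / 2) x := by
  rw [sigma_eq_qpow, qpow, qpow, ← Real.rpow_mul (qbase_pos one_pos x).le]
  congr 1; ring

theorem one_le_sigma (x : E3) : 1 ≤ sigma x := by
  rw [sigma, Real.one_le_sqrt]; nlinarith [sq_nonneg ‖x‖]

theorem sigma_pos (x : E3) : 0 < sigma x := one_pos.trans_le (one_le_sigma x)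

theorem norm_le_sigma (x : E3) : ‖x‖ ≤ sigma x := by
  rw [sigma_eq_qpow]; exact norm_le_qpow_half 1 x

theorem sigma_sq (x : E3) : sigma x ^ 2 = 1 + ‖x‖ ^ 2 := Real.sq_sqrt (by positivity)

theorem sigma_le_add_norm_sub (x y : E3) : sigma x ≤ sigma y + ‖x - y‖ := by
  refine Real.sqrt_le_iff.2 ⟨by have := sigma_pos y; positivity, ?_⟩
  have h1 := sigma_sq y
  have h2 : ‖x‖ ≤ ‖y‖ + ‖x - y‖ := norm_le_insert' x y
  have h3 := norm_le_sigma y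
  have : ‖x‖ ^ 2 ≤ (‖y‖ + ‖x - y‖) ^ 2 := by gcongr
  nlinarith [mul_le_mul_of_nonneg_right h3 (norm_nonneg (x - y))]

theorem contDiff_sigma_rpow (s : ℝ) : ContDiff ℝ ∞ fun x : E3 => sigma x ^ s := by
  simp only [sigma_rpow_eq_qpow]; exact contDiff_qpow one_pos _

theorem continuous_sigma_rpow (s : ℝ) : Continuous fun x : E3 => sigma x ^ s :=
  (contDiff_sigma_rpow s).continuous

/-- The function `‖z‖^{-p}`, as an extended real. -/
noncomputable def rieszK (p : ℝ) (z : E3) : ENNReal := ENNReal.ofReal (‖z‖ ^ (-p))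

theorem measurable_rieszK (p : ℝ) : Measurable (rieszK p) :=
  (measurable_norm.pow_const _).ennreal_ofReal

theorem lintegral_comp_smul_E3 {g : E3 → ENNReal} (hg : Measurable g) {r : ℝ} (hr : 0 < r) :
    ∫⁻ z, g z = ENNReal.ofReal (r ^ 3) * ∫⁻ z, g (r • z) := by
  have h := Measure.map_addHaar_smul (volume : Measure E3) hr.ne'
  have h2 : ∫⁻ z, g z ∂(Measure.map (r • ·) (volume : Measure E3)) = ∫⁻ z, g (r • z) :=
    lintegral_map hg (measurable_const_smul r)
  rw [h, lintegral_smul_measure, finrank_euclideanSpace, Fintype.card_fin,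
    abs_of_pos (by positivity)] at h2
  rw [← h2, smul_eq_mul, ← mul_assoc, ← ENNReal.ofReal_mul (by positivity),
    mul_inv_cancel₀ (by positivity), ENNReal.ofReal_one, one_mul]

theorem setLIntegral_rieszK_scale (p : ℝ) {r : ℝ} (hr : 0 < r) {S T : Set E3}
    (hS : MeasurableSet S) (hT : MeasurableSet T) (hST : ∀ z, r • z ∈ S ↔ z ∈ T) :
    ∫⁻ z in S, rieszK p z = ENNReal.ofReal (r ^ (3 - p)) * ∫⁻ z in T, rieszK p z := by
  rw [← lintegral_indicator hS, ← lintegral_indicator hT,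
    lintegral_comp_smul_E3 ((measurable_rieszK p).indicator hS) hr]
  have e : ∀ z, S.indicator (rieszK p) (r • z) =
      ENNReal.ofReal (r ^ (-p)) * T.indicator (rieszK p) z := fun z => by
    by_cases hz : z ∈ T
    · rw [Set.indicator_of_mem hz, Set.indicator_of_mem ((hST z).2 hz), rieszK, rieszK, norm_smul,
        Real.norm_of_nonneg hr.le, Real.mul_rpow hr.le (norm_nonneg _),
        ENNReal.ofReal_mul (by positivity)]
    · rw [Set.indicator_of_notMem hz, Set.indicator_of_notMem (mt (hST z).1 hz), mul_zero]
  simp only [e]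
  rw [lintegral_const_mul _ ((measurable_rieszK p).indicator hT), ← mul_assoc,
    ← ENNReal.ofReal_mul (by positivity), ← Real.rpow_natCast, ← Real.rpow_add hr]
  norm_num [sub_eq_add_neg]

theorem setLIntegral_ball_rieszK_lt_top {p : ℝ} (hp : p < 3) :
    ∫⁻ z in ball (0 : E3) 1, rieszK p z < ⊤ := by
  have h : IntegrableOn (fun z : E3 => ‖z‖ ^ (-p)) (ball 0 1) := by
    refine integrableOn_ball_of_norm_le_rpow (C := 1) (α := p) (by simp) (by simpa using hp)
      (.of_forall fun z => ?_) (measurable_norm.pow_const _).aestronglyMeasurable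
    rw [one_mul, Real.norm_of_nonneg (by positivity)]
  exact (h.lintegral_lt_top)

theorem setLIntegral_compl_ball_rieszK_lt_top {p : ℝ} (hp : 3 < p) :
    ∫⁻ z in (ball (0 : E3) 1)ᶜ, rieszK p z < ⊤ := by
  have h := finite_integral_one_add_norm (E := E3) (μ := volume) (r := p) (by simpa using hp)
  refine lt_of_le_of_lt ?_ (ENNReal.mul_lt_top (ENNReal.ofReal_lt_top (r := 2 ^ p)) h)
  rw [← lintegral_const_mul _ (by fun_prop)]
  refine (setLIntegral_mono' measurableSet_ball.compl fun z hz => ?_).trans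
    (setLIntegral_le_lintegral _ _)
  have hz : 1 ≤ ‖z‖ := by simpa using hz
  rw [rieszK, ← ENNReal.ofReal_mul (by positivity)]
  refine ENNReal.ofReal_le_ofReal ?_
  rw [Real.rpow_neg (by positivity), Real.rpow_neg (by positivity), ← div_eq_mul_inv,
    ← inv_inv ((2 : ℝ) ^ p), inv_div_left]
  refine inv_anti₀ (by positivity) ?_
  rw [← Real.inv_rpow zero_le_two, ← Real.mul_rpow (by positivity) (by positivity)]
  exact Real.rpow_le_rpow (by positivity) (by linarith) (by linarith)

theorem ae_ne_E3 (x : E3) : ∀ᵐ y : E3, y ≠ x := by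
  simp [ae_iff]

/-- The weighted integral of the Riesz kernel of order one. -/
theorem lintegral_rieszK_mul_sigma_le {a : ℝ} (ha : 1 < a) (ha' : a < 3) :
    ∃ C : ℝ, 0 < C ∧ ∀ x : E3, ∫⁻ y, rieszK 2 (x - y) * ENNReal.ofReal (sigma y ^ (-a)) ≤
      ENNReal.ofReal (C * sigma x ^ (1 - a)) := by
  set I1 := ∫⁻ z in ball (0 : E3) 1, rieszK 2 z
  set I2 := ∫⁻ z in ball (0 : E3) 1, rieszK a z
  set I3 := ∫⁻ z in (ball (0 : E3) 1)ᶜ, rieszK (2 + a) z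
  have h1 : I1 < ⊤ := setLIntegral_ball_rieszK_lt_top (by norm_num)
  have h2 : I2 < ⊤ := setLIntegral_ball_rieszK_lt_top ha'
  have h3 : I3 < ⊤ := setLIntegral_compl_ball_rieszK_lt_top (by linarith)
  refine ⟨2 ^ a * I1.toReal + 4 * I2.toReal + 9 * I3.toReal + 1, by positivity, fun x => ?_⟩
  have hs := sigma_pos x
  set s := sigma x with hs_def
  have hball : MeasurableSet (ball (0 : E3) (s / 2)) := measurableSet_ball
  have hb : MeasurableSet (ball (0 : E3) s) := measurableSet_ball
  -- Three regions, with `s = σ(x)`. Near `x` the weight is comparable to its value at `x`. In the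
  -- rest of the ball of radius `s` the kernel is at most `4 s^{-2}`, and `a < 3` makes `|y|^{-a}`
  -- integrable at `0`. Outside that ball the product decays like `|y|^{-2-a}`, integrable as `a >
  -- 1`. After rescaling, each region yields a multiple of `s^{1-a}`.
  have key : ∀ᵐ y : E3, rieszK 2 (x - y) * ENNReal.ofReal (sigma y ^ (-a)) ≤
      ENNReal.ofReal (2 ^ a * s ^ (-a)) * (ball (0 : E3) (s / 2)).indicator (rieszK 2) (x - y) +
      ENNReal.ofReal (4 * s ^ (-2 : ℝ)) * (ball (0 : E3) s).indicator (rieszK a) y +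
      ENNReal.ofReal 9 * (ball (0 : E3) s)ᶜ.indicator (rieszK (2 + a)) y := by
    filter_upwards [ae_ne_E3 0] with y hy
    have hy0 : 0 < ‖y‖ := norm_pos_iff.2 hy
    have hσ := sigma_pos y
    by_cases hxy : ‖x - y‖ < s / 2
    · refine le_add_right (le_add_right ?_)
      rw [Set.indicator_of_mem (by simpa using hxy), mul_comm]
      gcongr
      have : s / 2 ≤ sigma y := by have := sigma_le_add_norm_sub x y; linarith
      calc sigma y ^ (-a) ≤ (s / 2) ^ (-a) :=
            Real.rpow_le_rpow_of_nonpos (by positivity) this (by linarith)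
        _ = 2 ^ a * s ^ (-a) := by
            rw [div_eq_mul_inv, Real.mul_rpow hs.le (by positivity), Real.inv_rpow zero_le_two,
              Real.rpow_neg zero_le_two, inv_inv, mul_comm]
    · push Not at hxy
      by_cases hys : ‖y‖ < s
      · refine le_add_right (le_add_left ?_)
        rw [Set.indicator_of_mem (by simpa using hys), rieszK, rieszK]
        refine mul_le_mul' (ENNReal.ofReal_le_ofReal ?_) (ENNReal.ofReal_le_ofReal ?_)
        · calc ‖x - y‖ ^ (-2 : ℝ) ≤ (s / 2) ^ (-2 : ℝ) :=
              Real.rpow_le_rpow_of_nonpos (by positivity) hxy (by norm_num)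
            _ = 4 * s ^ (-2 : ℝ) := by
              rw [div_eq_mul_inv, Real.mul_rpow hs.le (by positivity), Real.inv_rpow zero_le_two,
                Real.rpow_neg zero_le_two, inv_inv, mul_comm]
              norm_num
        · exact Real.rpow_le_rpow_of_nonpos hy0 (norm_le_sigma y) (by linarith)
      · push Not at hys
        refine le_add_left ?_
        rw [Set.indicator_of_mem (by simpa using hys), rieszK, rieszK,
          ← ENNReal.ofReal_mul (by positivity), ← ENNReal.ofReal_mul (by positivity)]
        refine ENNReal.ofReal_le_ofReal ?_
        -- Here `‖x - y‖ ≥ s / 2` and `‖x‖ ≤ s`, so `‖y‖ ≤ s + ‖x - y‖ ≤ 3 ‖x - y‖`.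
        have h4 : ‖y‖ / 3 ≤ ‖x - y‖ := by
          have := norm_le_insert x y
          have := norm_le_sigma x
          linarith
        calc ‖x - y‖ ^ (-2 : ℝ) * sigma y ^ (-a) ≤ (‖y‖ / 3) ^ (-2 : ℝ) * ‖y‖ ^ (-a) := by
              refine mul_le_mul ?_ ?_ (by positivity) (by positivity)
              · exact Real.rpow_le_rpow_of_nonpos (by positivity) h4 (by norm_num)
              · exact Real.rpow_le_rpow_of_nonpos hy0 (norm_le_sigma y) (by linarith)
          _ = 9 * ‖y‖ ^ (-(2 + a)) := by
              rw [div_eq_mul_inv, Real.mul_rpow hy0.le (by positivity),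
                Real.inv_rpow (by norm_num), Real.rpow_neg (by norm_num : (0:ℝ) ≤ 3), inv_inv,
                neg_add, Real.rpow_add hy0]
              norm_num
              ring
  refine (lintegral_mono_ae key).trans ?_
  have m1 : Measurable fun y => (ball (0 : E3) (s / 2)).indicator (rieszK 2) (x - y) :=
    ((measurable_rieszK 2).indicator hball).comp (by fun_prop)
  have m2 : Measurable fun y => (ball (0 : E3) s).indicator (rieszK a) y :=
    (measurable_rieszK a).indicator hb
  have m3 : Measurable fun y => (ball (0 : E3) s)ᶜ.indicator (rieszK (2 + a)) y :=
    (measurable_rieszK _).indicator hb.compl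
  rw [lintegral_add_right _ (m3.const_mul _), lintegral_add_right _ (m2.const_mul _),
    lintegral_const_mul _ m1, lintegral_const_mul _ m2, lintegral_const_mul _ m3,
    lintegral_sub_left_eq_self (fun y => (ball (0 : E3) (s / 2)).indicator (rieszK 2) y) x,
    lintegral_indicator hball, lintegral_indicator hb, lintegral_indicator hb.compl,
    setLIntegral_rieszK_scale 2 (half_pos hs) hball (measurableSet_ball (x := (0 : E3)) (ε := 1)),
    setLIntegral_rieszK_scale a hs hb (measurableSet_ball (x := (0 : E3)) (ε := 1)),
    setLIntegral_rieszK_scale (2 + a) hs hb.compl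
      (measurableSet_ball (x := (0 : E3)) (ε := 1)).compl]
  · change _ * (_ * I1) + _ * (_ * I2) + _ * (_ * I3) ≤ _
    rw [← ENNReal.ofReal_toReal h1.ne, ← ENNReal.ofReal_toReal h2.ne,
      ← ENNReal.ofReal_toReal h3.ne]
    simp only [ENNReal.toReal_ofReal ENNReal.toReal_nonneg]
    rw [← ENNReal.ofReal_mul (by positivity), ← ENNReal.ofReal_mul (by positivity),
      ← ENNReal.ofReal_mul (by positivity), ← ENNReal.ofReal_mul (by positivity),
      ← ENNReal.ofReal_mul (by positivity), ← ENNReal.ofReal_mul (by positivity),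
      ← ENNReal.ofReal_add (by positivity) (by positivity),
      ← ENNReal.ofReal_add (by positivity) (by positivity)]
    refine ENNReal.ofReal_le_ofReal ?_
    have e1 : s ^ (-a) * (s / 2) ^ (3 - 2 : ℝ) = s ^ (1 - a) / 2 := by
      rw [show (3 - 2 : ℝ) = 1 by norm_num, Real.rpow_one, mul_div_assoc', ← Real.rpow_add_one hs.ne']
      ring_nf
    have e2 : s ^ (-2 : ℝ) * s ^ (3 - a) = s ^ (1 - a) := by
      rw [← Real.rpow_add hs]; ring_nf
    have e3 : s ^ (3 - (2 + a)) = s ^ (1 - a) := by ring_nf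
    have hp : 0 < s ^ (1 - a) := Real.rpow_pos_of_pos hs _
    have g1 : 0 ≤ 2 ^ a * I1.toReal * s ^ (1 - a) := by positivity
    calc _ = 2 ^ a * (s ^ (-a) * (s / 2) ^ (3 - 2 : ℝ)) * I1.toReal +
        4 * (s ^ (-2 : ℝ) * s ^ (3 - a)) * I2.toReal + 9 * s ^ (3 - (2 + a)) * I3.toReal := by ring
      _ ≤ _ := by rw [e1, e2, e3]; nlinarith
  · intro z; simp [norm_smul, abs_of_pos hs, hs]
  · intro z; simp [norm_smul, abs_of_pos hs, hs]
  · intro z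
    have h5 := half_pos hs
    simp only [mem_ball_zero_iff, norm_smul, Real.norm_of_nonneg h5.le]
    exact mul_lt_iff_lt_one_right h5

end RieszKernel

/-! ### Weighted `L²` norms and Riesz potential estimates. -/

section Weighted

open Filter Topology Metric

/-- The weighted `L²` norm `‖σ^s f‖_{L²}`. -/
noncomputable def wnorm (s : ℝ) (f : E3 → ℝ) : ENNReal :=
  eLpNorm (fun x => sigma x ^ s * f x) 2 volume

theorem eLpNorm_two_sq (f : E3 → ℝ) : eLpNorm f 2 volume ^ 2 = ∫⁻ x, ‖f x‖ₑ ^ 2 := by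
  have h := eLpNorm_nnreal_pow_eq_lintegral (f := f) (μ := volume) (p := 2) (by norm_num)
  have e : ((2 : NNReal) : ℝ) = ((2 : ℕ) : ℝ) := by norm_num
  simp only [e, ENNReal.rpow_natCast] at h
  exact_mod_cast h

theorem enorm_sigma_rpow (s : ℝ) (x : E3) : ‖sigma x ^ s‖ₑ = ENNReal.ofReal (sigma x ^ s) :=
  Real.enorm_of_nonneg (Real.rpow_nonneg (sigma_pos x).le _)

theorem wnorm_sq (s : ℝ) (f : E3 → ℝ) :
    wnorm s f ^ 2 = ∫⁻ x, ENNReal.ofReal (sigma x ^ (2 * s)) * ‖f x‖ₑ ^ 2 := by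
  rw [wnorm, eLpNorm_two_sq]
  congr 1
  funext x
  rw [enorm_mul, mul_pow, enorm_sigma_rpow, ← ENNReal.ofReal_pow
    (Real.rpow_nonneg (sigma_pos x).le _), ← Real.rpow_natCast, ← Real.rpow_mul (sigma_pos x).le]
  norm_num [mul_comm]

theorem eLpNorm_le_sum_of_abs_le {ι : Type*} [Fintype ι] {f : E3 → ℝ} {g : ι → E3 → ℝ} {c : ℝ}
    (hc : 0 ≤ c) (hg : ∀ i, AEStronglyMeasurable (g i) volume)
    (h : ∀ᵐ x, |f x| ≤ c * ∑ i, |g i x|) :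
    eLpNorm f 2 volume ≤ ENNReal.ofReal c * ∑ i, eLpNorm (g i) 2 volume := by
  have h1 : eLpNorm f 2 volume ≤ eLpNorm (fun x => c * (∑ i, fun x => ‖g i x‖) x) 2 volume := by
    refine eLpNorm_mono_ae_real ?_
    simpa [Finset.sum_apply] using h
  refine h1.trans ?_
  have h2 := eLpNorm_const_smul (𝕜 := ℝ) c (∑ i, fun x => ‖g i x‖) 2 (volume : Measure E3)
  rw [Real.enorm_of_nonneg hc] at h2
  refine h2.le.trans ?_
  gcongr
  refine (eLpNorm_sum_le (fun i _ => (hg i).norm) (by norm_num)).trans ?_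
  simp only [eLpNorm_norm, le_refl]

theorem wnorm_le_sum {ι : Type*} [Fintype ι] {f : E3 → ℝ} {g : ι → E3 → ℝ} {c s : ℝ} {t : ι → ℝ}
    (hc : 0 ≤ c) (hg : ∀ i, AEStronglyMeasurable (g i) volume)
    (h : ∀ᵐ x, sigma x ^ s * |f x| ≤ c * ∑ i, sigma x ^ t i * |g i x|) :
    wnorm s f ≤ ENNReal.ofReal c * ∑ i, wnorm (t i) (g i) := by
  refine eLpNorm_le_sum_of_abs_le hc
    (fun i => (continuous_sigma_rpow _).aestronglyMeasurable.mul (hg i)) ?_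
  filter_upwards [h] with x hx
  have e (s : ℝ) : |sigma x ^ s| = sigma x ^ s := abs_of_pos (Real.rpow_pos_of_pos (sigma_pos x) s)
  simpa only [abs_mul, e] using hx

theorem lintegral_mul_sq_le {f g : E3 → ENNReal} (hf : AEMeasurable f) (hg : AEMeasurable g) :
    (∫⁻ x, f x * g x) ^ 2 ≤ (∫⁻ x, f x ^ 2) * ∫⁻ x, g x ^ 2 := by
  have h := ENNReal.lintegral_mul_le_Lp_mul_Lq volume Real.HolderConjugate.two_two hf hg
  have e2 (a : ENNReal) : a ^ (2 : ℝ) = a ^ 2 := by rw [← ENNReal.rpow_natCast]; norm_num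
  simp only [Pi.mul_apply, e2] at h
  calc _ ≤ _ := pow_le_pow_left₀ zero_le h 2
    _ = _ := by
      rw [mul_pow, ← e2 (_ ^ _), ← e2 (_ ^ _), ← ENNReal.rpow_mul, ← ENNReal.rpow_mul]
      norm_num

/-- Cauchy-Schwarz after splitting `k F` as `(kφ)^{1/2} · (kψ)^{1/2} F`. It is the core of the Schur
test, with `φ` as the auxiliary weight. -/
theorem lintegral_kernel_sq_le {k φ ψ F : E3 → ENNReal} (hk : Measurable k) (hφ : Measurable φ)
    (hψ : Measurable ψ) (hF : Measurable F) (h1 : ∀ x, φ x * ψ x = 1) :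
    (∫⁻ x, k x * F x) ^ 2 ≤ (∫⁻ x, k x * φ x) * ∫⁻ x, k x * (ψ x * F x ^ 2) := by
  have h := lintegral_mul_sq_le (f := fun x => (k x * φ x) ^ (1 / 2 : ℝ))
    (g := fun x => (k x * ψ x) ^ (1 / 2 : ℝ) * F x) ((hk.mul hφ).pow_const _).aemeasurable
    (((hk.mul hψ).pow_const _).mul hF).aemeasurable
  have e (a : ENNReal) : (a ^ (1 / 2 : ℝ)) ^ 2 = a := by
    rw [← ENNReal.rpow_natCast, ← ENNReal.rpow_mul]; norm_num
  simp only [mul_pow, e, ← mul_assoc, ← ENNReal.mul_rpow_of_nonneg _ _ (by norm_num : 0 ≤ (1/2 : ℝ))]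
    at h
  refine le_of_eq_of_le ?_ (h.trans_eq ?_)
  · congr 2; funext x
    rw [show k x * φ x * k x * ψ x = k x * k x * (φ x * ψ x) by ring, h1, mul_one, ← sq,
      ← ENNReal.rpow_natCast, ← ENNReal.rpow_mul]
    norm_num
  · simp only [mul_assoc]

theorem rieszK_sub_comm (p : ℝ) (x y : E3) : rieszK p (x - y) = rieszK p (y - x) := by
  rw [rieszK, rieszK, norm_sub_rev]

theorem ofReal_sigma_mul (s t : ℝ) (x : E3) : ENNReal.ofReal (sigma x ^ s) *
    ENNReal.ofReal (sigma x ^ t) = ENNReal.ofReal (sigma x ^ (s + t)) := by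
  rw [← ENNReal.ofReal_mul (Real.rpow_nonneg (sigma_pos x).le _), ← Real.rpow_add (sigma_pos x)]

theorem measurable_ofReal_sigma (s : ℝ) : Measurable fun x => ENNReal.ofReal (sigma x ^ s) :=
  (continuous_sigma_rpow s).measurable.ennreal_ofReal

/-- Weighted boundedness of the Riesz potential of order one (Schur test). -/
theorem wnorm_le_of_riesz {τ : ℝ} (h1 : -(1 / 2) < τ) (h2 : τ < 3 / 2) :
    ∃ C : ℝ, 0 < C ∧ ∀ F u : E3 → ℝ, Measurable F →
      (∀ x, ‖u x‖ₑ ≤ ∫⁻ y, rieszK 2 (x - y) * ‖F y‖ₑ) →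
      wnorm (τ - 1) u ≤ ENNReal.ofReal C * wnorm τ F := by
  -- The two applications of the kernel integral, in `y` and then in `x`, need `1 < a < 3` and `1 <
  -- 1 + a - 2τ < 3`. With this choice both conditions amount to `-1/2 < τ < 3/2`.
  set a := τ + 3 / 2 with ha
  obtain ⟨C1, hC1, k1⟩ := lintegral_rieszK_mul_sigma_le (a := a) (by linarith) (by linarith)
  obtain ⟨C2, hC2, k2⟩ := lintegral_rieszK_mul_sigma_le (a := 1 + a - 2 * τ) (by linarith)
    (by linarith)
  refine ⟨√(C1 * C2), by positivity, fun F u hF hu => ?_⟩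
  have hFe : Measurable fun y => ‖F y‖ₑ := hF.enorm
  have mk (x : E3) : Measurable fun y => rieszK 2 (x - y) :=
    (measurable_rieszK 2).comp (by fun_prop)
  have mk2 : Measurable fun p : E3 × E3 => rieszK 2 (p.1 - p.2) :=
    (measurable_rieszK 2).comp (by fun_prop)
  have mf (s : ℝ) : Measurable fun y => ENNReal.ofReal (sigma y ^ s) * ‖F y‖ₑ ^ 2 :=
    (measurable_ofReal_sigma s).mul (hFe.pow_const 2)
  have mkf (x : E3) : Measurable fun y => rieszK 2 (x - y) *
      (ENNReal.ofReal (sigma y ^ a) * ‖F y‖ₑ ^ 2) := (mk x).mul (mf a)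
  have mks (x : E3) (s : ℝ) : Measurable fun y => rieszK 2 (x - y) * ENNReal.ofReal (sigma y ^ s) :=
    (mk x).mul (measurable_ofReal_sigma s)
  rw [← ENNReal.pow_le_pow_left_iff two_ne_zero, mul_pow, wnorm_sq, wnorm_sq,
    ← ENNReal.ofReal_pow (by positivity), Real.sq_sqrt (by positivity)]
  have pt (x : E3) : ENNReal.ofReal (sigma x ^ (2 * (τ - 1))) * ‖u x‖ₑ ^ 2 ≤
      ENNReal.ofReal C1 * ∫⁻ y, ENNReal.ofReal (sigma x ^ (-(1 + a - 2 * τ))) *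
        (rieszK 2 (x - y) * (ENNReal.ofReal (sigma y ^ a) * ‖F y‖ₑ ^ 2)) := by
    have cs := lintegral_kernel_sq_le (mk x) (measurable_ofReal_sigma (-a))
      (measurable_ofReal_sigma a) hFe fun y => by rw [ofReal_sigma_mul]; simp
    calc ENNReal.ofReal (sigma x ^ (2 * (τ - 1))) * ‖u x‖ₑ ^ 2
        ≤ ENNReal.ofReal (sigma x ^ (2 * (τ - 1))) * (ENNReal.ofReal (C1 * sigma x ^ (1 - a)) *
          ∫⁻ y, rieszK 2 (x - y) * (ENNReal.ofReal (sigma y ^ a) * ‖F y‖ₑ ^ 2)) := by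
          refine mul_le_mul_right ?_ _
          exact (pow_le_pow_left₀ zero_le (hu x) 2).trans
            (cs.trans (mul_le_mul_left (k1 x) _))
      _ = _ := by
          rw [lintegral_const_mul _ (mkf x),
            ENNReal.ofReal_mul hC1.le, ← mul_assoc, mul_left_comm, ofReal_sigma_mul, mul_assoc]
          ring_nf
  refine (lintegral_mono pt).trans ?_
  have mm : Measurable fun p : E3 × E3 => ENNReal.ofReal (sigma p.1 ^ (-(1 + a - 2 * τ))) *
        (rieszK 2 (p.1 - p.2) * (ENNReal.ofReal (sigma p.2 ^ a) * ‖F p.2‖ₑ ^ 2)) :=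
    ((measurable_ofReal_sigma _).comp measurable_fst).mul (mk2.mul
      (((measurable_ofReal_sigma a).mul (hFe.pow_const 2)).comp measurable_snd))
  rw [lintegral_const_mul _ mm.lintegral_prod_right', lintegral_lintegral_swap mm.aemeasurable,
    ENNReal.ofReal_mul hC1.le, mul_assoc]
  refine mul_le_mul_right ?_ _
  rw [← lintegral_const_mul _ (mf _)]
  refine lintegral_mono fun y => ?_
  calc ∫⁻ x, ENNReal.ofReal (sigma x ^ (-(1 + a - 2 * τ))) *
        (rieszK 2 (x - y) * (ENNReal.ofReal (sigma y ^ a) * ‖F y‖ₑ ^ 2))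
      = (∫⁻ x, rieszK 2 (y - x) * ENNReal.ofReal (sigma x ^ (-(1 + a - 2 * τ)))) *
          (ENNReal.ofReal (sigma y ^ a) * ‖F y‖ₑ ^ 2) := by
        rw [← lintegral_mul_const _ (mks y _)]
        congr 1; funext x
        rw [rieszK_sub_comm]; ring
    _ ≤ ENNReal.ofReal (C2 * sigma y ^ (1 - (1 + a - 2 * τ))) *
          (ENNReal.ofReal (sigma y ^ a) * ‖F y‖ₑ ^ 2) := mul_le_mul_left (k2 y) _
    _ = _ := by
        rw [ENNReal.ofReal_mul hC2.le, mul_assoc, ← mul_assoc (ENNReal.ofReal (sigma y ^ _)),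
          ofReal_sigma_mul]
        ring_nf

/-- Cauchy–Schwarz bound for the Riesz potential of order two. -/
theorem riesz_one_le {γ : ℝ} (h1 : -1 < γ) (h2 : γ < 0) :
    ∃ C : ℝ, 0 < C ∧ ∀ F : E3 → ℝ, Measurable F → ∀ x,
      ∫⁻ y, rieszK 1 (x - y) * ‖F y‖ₑ ≤
        ENNReal.ofReal (C * sigma x ^ γ) * wnorm (1 / 2 - γ) F := by
  -- Cauchy-Schwarz squares the kernel `|z|^{-1}` to `|z|^{-2}` and the weight to `σ^{-(1-2γ)}`; the
  -- requirement `1 < 1 - 2γ < 3` is `-1 < γ < 0`.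
  obtain ⟨C1, hC1, k1⟩ := lintegral_rieszK_mul_sigma_le (a := 1 - 2 * γ) (by linarith)
    (by linarith)
  refine ⟨√C1, by positivity, fun F hF x => ?_⟩
  have hs := sigma_pos x
  rw [← ENNReal.pow_le_pow_left_iff two_ne_zero, mul_pow, wnorm_sq,
    ← ENNReal.ofReal_pow (by positivity), mul_pow, Real.sq_sqrt hC1.le, ← Real.rpow_natCast,
    ← Real.rpow_mul hs.le]
  have mk : Measurable fun y => rieszK 1 (x - y) := (measurable_rieszK 1).comp (by fun_prop)
  have cs := lintegral_mul_sq_le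
    (f := fun y => rieszK 1 (x - y) * ENNReal.ofReal (sigma y ^ (-(1 / 2 - γ))))
    (g := fun y => ENNReal.ofReal (sigma y ^ (1 / 2 - γ)) * ‖F y‖ₑ)
    (mk.mul (measurable_ofReal_sigma _)).aemeasurable
    ((measurable_ofReal_sigma _).mul hF.enorm).aemeasurable
  have e1 : ∀ y, rieszK 1 (x - y) * ENNReal.ofReal (sigma y ^ (-(1 / 2 - γ))) *
      (ENNReal.ofReal (sigma y ^ (1 / 2 - γ)) * ‖F y‖ₑ) = rieszK 1 (x - y) * ‖F y‖ₑ := fun y => by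
    rw [mul_assoc, ← mul_assoc (ENNReal.ofReal _), ofReal_sigma_mul]; simp
  have e2 : ∀ y, (rieszK 1 (x - y) * ENNReal.ofReal (sigma y ^ (-(1 / 2 - γ)))) ^ 2 =
      rieszK 2 (x - y) * ENNReal.ofReal (sigma y ^ (-(1 - 2 * γ))) := fun y => by
    rw [mul_pow, sq (ENNReal.ofReal _), ofReal_sigma_mul, rieszK, rieszK,
      ← ENNReal.ofReal_pow (by positivity), ← Real.rpow_natCast, ← Real.rpow_mul (norm_nonneg _)]
    norm_num
    ring_nf
  have e3 : ∀ y, (ENNReal.ofReal (sigma y ^ (1 / 2 - γ)) * ‖F y‖ₑ) ^ 2 =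
      ENNReal.ofReal (sigma y ^ (2 * (1 / 2 - γ))) * ‖F y‖ₑ ^ 2 := fun y => by
    rw [mul_pow, sq (ENNReal.ofReal _), ofReal_sigma_mul]; ring_nf
  simp only [e1, e2, e3] at cs
  refine cs.trans (mul_le_mul_left ((k1 x).trans_eq ?_) _)
  congr 3
  push_cast
  ring

end Weighted

/-! ### Pointwise potential bounds and the unweighted estimate for test tensors. -/

section Apriori

theorem ofReal_abs_convFn_le {K : E3 → ℝ} (hK : Continuous K) {c p : ℝ} (hc : 0 ≤ c)
    (h : ∀ z, z ≠ 0 → |K z| ≤ c * ‖z‖ ^ (-p)) (x : E3) (f : testFn) {F : E3 → ℝ}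
    (hF : ∀ y, |(f : E3 → ℝ) y| ≤ F y) :
    ENNReal.ofReal |convFn K hK x f| ≤
      ENNReal.ofReal c * ∫⁻ y, rieszK p (x - y) * ‖F y‖ₑ := by
  rw [← Real.norm_eq_abs, ofReal_norm]
  refine (enorm_integral_le_lintegral_enorm _).trans ?_
  rw [← lintegral_const_mul' _ _ ENNReal.ofReal_ne_top]
  refine lintegral_mono_ae ?_
  filter_upwards [ae_ne_E3 x] with y hy
  rw [enorm_mul, rieszK, ← mul_assoc, ← ENNReal.ofReal_mul hc]
  refine mul_le_mul' ?_ ?_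
  · rw [Real.enorm_eq_ofReal_abs]
    exact ENNReal.ofReal_le_ofReal (h _ (sub_ne_zero.2 hy.symm))
  · rw [enorm_le_iff_norm_le, Real.norm_eq_abs, Real.norm_eq_abs]
    exact (hF y).trans (le_abs_self _)

theorem inv_qpow_half_le {ε : ℝ} {z : E3} (hz : z ≠ 0) :
    (qpow ε (1 / 2) z)⁻¹ ≤ ‖z‖⁻¹ :=
  inv_anti₀ (norm_pos_iff.2 hz) (norm_le_qpow_half ε z)

theorem le_of_ofReal_abs_le {a b : ℝ} {c : ENNReal} (hc : c ≠ ⊤)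
    (h : ENNReal.ofReal |a| ≤ ENNReal.ofReal b * c) (hb : 0 ≤ b) : |a| ≤ b * c.toReal := by
  rw [← ENNReal.ofReal_toReal hc, ← ENNReal.ofReal_mul hb] at h
  exact (ENNReal.ofReal_le_ofReal_iff (by positivity)).1 h

/-- Pointwise bound by the Riesz potential of order two of the Laplacian. -/
theorem enorm_le_riesz_one : ∃ C : ℝ, 0 < C ∧ ∀ (f : testFn) (x : E3),
    ‖(f : E3 → ℝ) x‖ₑ ≤ ENNReal.ofReal C *
      ∫⁻ y, rieszK 1 (x - y) * ‖(lapl testD f).1 y‖ₑ := by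
  have hm := kmass_pos
  refine ⟨(15 * kmass)⁻¹ * 6, by positivity, fun f x => ?_⟩
  by_cases htop : ∫⁻ y, rieszK 1 (x - y) * ‖(lapl testD f).1 y‖ₑ = ⊤
  · rw [htop, ENNReal.mul_top (by simp; positivity)]; exact le_top
  set I := ∫⁻ y, rieszK 1 (x - y) * ‖(lapl testD f).1 y‖ₑ with hI
  have key : |(f : E3 → ℝ) x| ≤ (15 * kmass)⁻¹ * (6 * I.toReal) := by
    -- One of the two Laplacians is moved to the kernel, whose second derivatives are at most `2 /
    -- |z|` for every `ε`.
    refine abs_le_of_kernel_bound x f fun ε hε => ?_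
    have h1 : ∀ i, |convFn (qpow ε (1 / 2)) (contDiff_qpow hε _).continuous x
        (testD i (testD i (lapl testD f)))| ≤ 2 * I.toReal := fun i => by
      rw [convFn_testD (contDiff_qpow hε _), convFn_testD (contDiff_pd (contDiff_qpow hε _) _)]
      refine le_of_ofReal_abs_le htop ?_ zero_le_two
      have := ofReal_abs_convFn_le
        (contDiff_pd (contDiff_pd (contDiff_qpow hε (1 / 2)) i) i).continuous (p := 1) zero_le_two
        (fun z hz => (abs_pd_pd_kernel_le hε i i z).trans ?_) x (lapl testD f) (fun y => le_rfl)
      · simpa using this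
      · rw [Real.rpow_neg_one]
        exact mul_le_mul_of_nonneg_left (inv_qpow_half_le hz) zero_le_two
    rw [lapl, map_sum]
    exact (abs_sum_fin_three_le h1).trans (by linarith)
  rw [Real.enorm_eq_ofReal_abs]
  refine (ENNReal.ofReal_le_ofReal key).trans_eq ?_
  rw [← mul_assoc, ENNReal.ofReal_mul (by positivity), ENNReal.ofReal_toReal htop]

/-- Pointwise bound for `J` by the Riesz potential of order one of `𝒟* J` and `𝒬 J`. -/
theorem enorm_le_riesz_two : ∃ C : ℝ, 0 < C ∧ ∀ j : Fin 3 → Fin 3 → Fin 3 → testFn, JacSymm j →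
    ∀ F : E3 → ℝ,
    (∀ m n y, |(flatD (fun e a b c => testD e (j a b c)) m n).1 y| ≤ F y) →
    (∀ m y, |(flatQ (fun e a b c => testD e (j a b c)) m).1 y| ≤ F y) →
    ∀ a b c x, ‖(j a b c : E3 → ℝ) x‖ₑ ≤ ENNReal.ofReal C *
      ∫⁻ y, rieszK 2 (x - y) * ‖F y‖ₑ := by
  have hm := kmass_pos
  refine ⟨(15 * kmass)⁻¹ * (45 * 6), by positivity, fun j hj F hD hQ a b c x => ?_⟩
  by_cases htop : ∫⁻ y, rieszK 2 (x - y) * ‖F y‖ₑ = ⊤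
  · rw [htop, ENNReal.mul_top (by simp; positivity)]; exact le_top
  set I := ∫⁻ y, rieszK 2 (x - y) * ‖F y‖ₑ with hI
  have key : |(j a b c : E3 → ℝ) x| ≤ (15 * kmass)⁻¹ * (45 * (6 * I.toReal)) := by
    refine abs_le_of_kernel_bound x _ fun ε hε => ?_
    -- All three derivatives in the bilaplacian identity fall on the kernel and leave `6 |z|^{-2}`,
    -- again uniformly in `ε`.
    have h3 : ∀ (i k l : Fin 3) (f : testFn), (∀ y, |(f : E3 → ℝ) y| ≤ F y) →
        |convFn (qpow ε (1 / 2)) (contDiff_qpow hε _).continuous x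
          (testD i (testD k (testD l f)))| ≤ 6 * I.toReal := fun i k l f hf => by
      have h1 := contDiff_qpow hε (1 / 2)
      have h2 := contDiff_pd h1 i
      have h3 := contDiff_pd h2 k
      rw [convFn_testD h1, convFn_testD h2, convFn_testD h3]
      refine le_of_ofReal_abs_le htop ?_ (by norm_num)
      refine ofReal_abs_convFn_le (contDiff_pd h3 l).continuous (by norm_num)
        (fun z hz => (abs_pd_pd_pd_kernel_le hε k i l z).trans ?_) x f hf
      rw [Real.rpow_neg (norm_nonneg _), Real.rpow_two, ← inv_pow]
      have := inv_qpow_half_le (ε := ε) hz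
      have := qpow_half_pos hε z
      gcongr
    exact abs_lapl_lapl_le testD testD_comm hj _ (fun i k l m n => h3 i k l _ (hD m n))
      (fun i k l m => h3 i k l _ (hQ m)) a b c
  rw [Real.enorm_eq_ofReal_abs]
  refine (ENNReal.ofReal_le_ofReal key).trans_eq ?_
  rw [← mul_assoc, ← mul_assoc, mul_assoc _ (45 : ℝ), ENNReal.ofReal_mul (by positivity),
    ENNReal.ofReal_toReal htop]

section LinearMaps

variable {V W : Type*} [AddCommGroup V] [Module ℝ V] [AddCommGroup W] [Module ℝ W]

theorem flatD_map (L : V →ₗ[ℝ] W) (G : Fin 3 → Fin 3 → Fin 3 → Fin 3 → V) (a c : Fin 3) :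
    L (flatD G a c) = flatD (fun e a b c => L (G e a b c)) a c := by
  simp only [flatD, flatMid, map_sub, map_add, map_sum]
  split_ifs <;> simp

theorem flatQ_map (L : V →ₗ[ℝ] W) (G : Fin 3 → Fin 3 → Fin 3 → Fin 3 → V) (a : Fin 3) :
    L (flatQ G a) = flatQ (fun e a b c => L (G e a b c)) a := by
  simp [flatQ]

theorem flatD_add (G H : Fin 3 → Fin 3 → Fin 3 → Fin 3 → V) (a c : Fin 3) :
    flatD (fun e a b c => G e a b c + H e a b c) a c = flatD G a c + flatD H a c := by
  simp only [flatD, flatMid, Finset.sum_add_distrib]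
  split_ifs
  · module
  · abel

theorem flatQ_add (G H : Fin 3 → Fin 3 → Fin 3 → Fin 3 → V) (a : Fin 3) :
    flatQ (fun e a b c => G e a b c + H e a b c) a = flatQ G a + flatQ H a := by
  simp only [flatQ, Finset.sum_add_distrib, smul_add]

end LinearMaps

/-- Index set of the components of `∂_e J_{abc}`. -/
abbrev I4 : Type := Fin 3 × Fin 3 × Fin 3 × Fin 3

/-- Index set of the components of `J_{abc}`. -/
abbrev I3 : Type := Fin 3 × Fin 3 × Fin 3

/-- Index set of the components of `(𝒟* J, 𝒬 J)`. -/
abbrev IP : Type := Fin 3 × Fin 3 ⊕ Fin 3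

/-- The components of the pair `(𝒟* J, 𝒬 J)` for the Euclidean metric. -/
noncomputable def flatP {V : Type*} [AddCommGroup V] [Module ℝ V]
    (G : Fin 3 → Fin 3 → Fin 3 → Fin 3 → V) : IP → V
  | .inl p => flatD G p.1 p.2
  | .inr a => flatQ G a

theorem flatP_map {V W : Type*} [AddCommGroup V] [Module ℝ V] [AddCommGroup W] [Module ℝ W]
    (L : V →ₗ[ℝ] W) (G : Fin 3 → Fin 3 → Fin 3 → Fin 3 → V) (i : IP) :
    L (flatP G i) = flatP (fun e a b c => L (G e a b c)) i := by
  rcases i with p | a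
  · exact flatD_map L G _ _
  · exact flatQ_map L G _

theorem flatP_add {V : Type*} [AddCommGroup V] [Module ℝ V]
    (G H : Fin 3 → Fin 3 → Fin 3 → Fin 3 → V) (i : IP) :
    flatP (fun e a b c => G e a b c + H e a b c) i = flatP G i + flatP H i := by
  rcases i with p | a
  · exact flatD_add G H _ _
  · exact flatQ_add G H _

theorem abs_le_sum_I4 (G : Fin 3 → Fin 3 → Fin 3 → Fin 3 → ℝ) (e a b c : Fin 3) :
    |G e a b c| ≤ ∑ i : I4, |G i.1 i.2.1 i.2.2.1 i.2.2.2| :=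
  Finset.single_le_sum (f := fun i : I4 => |G i.1 i.2.1 i.2.2.1 i.2.2.2|)
    (fun _ _ => abs_nonneg _) (Finset.mem_univ (e, a, b, c))

theorem abs_flatD_le (G : Fin 3 → Fin 3 → Fin 3 → Fin 3 → ℝ) {M : ℝ}
    (hM : ∀ e a b c, |G e a b c| ≤ M) (a c : Fin 3) : |flatD G a c| ≤ 27 * M := by
  have h0 : 0 ≤ M := (abs_nonneg _).trans (hM 0 0 0 0)
  have h1 : ∀ a c, |flatMid G a c| ≤ 3 * M := fun a c => abs_sum_fin_three_le fun b => hM _ _ _ _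
  have h2 : |if a = c then (2 / 3 : ℝ) • ∑ u, flatMid G u u else 0| ≤ 2 / 3 * (3 * (3 * M)) := by
    split_ifs
    · rw [smul_eq_mul, abs_mul, abs_of_pos (by norm_num : (0:ℝ) < 2 / 3)]
      gcongr
      exact abs_sum_fin_three_le fun u => h1 u u
    · simpa using by positivity
  have h3 := h1 a c
  have h4 := h1 c a
  rw [flatD]
  rw [abs_le] at h2 h3 h4 ⊢
  constructor <;> linarith [h2.1, h2.2, h3.1, h3.2, h4.1, h4.2]

theorem abs_flatQ_le (G : Fin 3 → Fin 3 → Fin 3 → Fin 3 → ℝ) {M : ℝ}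
    (hM : ∀ e a b c, |G e a b c| ≤ M) (a : Fin 3) : |flatQ G a| ≤ 27 * M := by
  have h : |∑ e, ∑ b, ∑ c, permSign e b c * G e a b c| ≤ 3 * (3 * (3 * M)) :=
    abs_sum_fin_three_le fun e => abs_sum_fin_three_le fun b => abs_sum_fin_three_le fun c =>
      abs_mul_le_of_abs_le_one (abs_permSign_le _ _ _) (hM _ _ _ _)
  simp only [flatQ, smul_eq_mul]
  linarith

theorem abs_flatP_le (G : Fin 3 → Fin 3 → Fin 3 → Fin 3 → ℝ) {M : ℝ}
    (hM : ∀ e a b c, |G e a b c| ≤ M) : ∀ i : IP, |flatP G i| ≤ 27 * M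
  | .inl p => abs_flatD_le G hM p.1 p.2
  | .inr a => abs_flatQ_le G hM a

theorem sum_sq_le_sq_sum {ι : Type*} [Fintype ι] (f : ι → ENNReal) :
    ∑ i, f i ^ 2 ≤ (∑ i, f i) ^ 2 := by
  rw [sq (∑ i, f i), Finset.sum_mul]
  refine Finset.sum_le_sum fun i hi => ?_
  rw [sq]
  exact mul_le_mul_right (Finset.single_le_sum (fun _ _ => zero_le) hi) _

/-- Multiplication of a test function by a smooth function. -/
noncomputable def smoothMul (w : E3 → ℝ) (hw : ContDiff ℝ ∞ w) : testFn →ₗ[ℝ] testFn where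
  toFun f := ⟨fun x => w x * (f : E3 → ℝ) x, hw.mul f.2.1, f.2.2.mul_left⟩
  map_add' f g := by ext x; simp [mul_add]
  map_smul' c f := by ext x; simp [mul_left_comm]

/-- Evaluation of a test function. -/
noncomputable def evalAt (x : E3) : testFn →ₗ[ℝ] ℝ where
  toFun f := (f : E3 → ℝ) x
  map_add' _ _ := rfl
  map_smul' _ _ := rfl

theorem flatP_apply (G : Fin 3 → Fin 3 → Fin 3 → Fin 3 → testFn) (i : IP) (x : E3) :
    (flatP G i).1 x = flatP (fun e a b c => (G e a b c : E3 → ℝ) x) i :=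
  flatP_map (evalAt x) G i

theorem JacSymm.map {V W : Type*} [AddCommGroup V] [Module ℝ V] [AddCommGroup W] [Module ℝ W]
    (L : V →ₗ[ℝ] W) {J : Fin 3 → Fin 3 → Fin 3 → V} (hJ : JacSymm J) :
    JacSymm fun a b c => L (J a b c) := fun a b c => by
  simp only [← map_add, (hJ a b c).1, (hJ a b c).2, map_zero, and_self]

theorem abs_pd_sigma_rpow_le (s : ℝ) (i : Fin 3) (x : E3) :
    |pd i (fun x => sigma x ^ s) x| ≤ |s| * sigma x ^ (s - 1) := by
  have h := abs_coord_le (ε := 1) x i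
  rw [← sigma_eq_qpow] at h
  have e0 : (fun x : E3 => sigma x ^ s) = qpow 1 (s / 2) := funext fun x => sigma_rpow_eq_qpow s x
  rw [e0]
  simp only [pd_qpow one_pos]
  have e : qpow 1 (s / 2 - 1) x = sigma x ^ (s - 1 - 1) := by
    rw [sigma_rpow_eq_qpow]; congr 1; ring
  rw [e, Real.rpow_sub_one (sigma_pos x).ne' (s - 1),
    show 2 * (s / 2) = s by ring, abs_mul, abs_mul, abs_div,
    abs_of_pos (Real.rpow_pos_of_pos (sigma_pos x) _), abs_of_pos (sigma_pos x)]
  refine mul_le_mul_of_nonneg_left ?_ (abs_nonneg s)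
  rw [← mul_div_assoc, div_le_iff₀ (sigma_pos x), mul_comm]
  exact mul_le_mul_of_nonneg_left h (Real.rpow_nonneg (sigma_pos x).le _)

theorem eLpNorm_testFn_sq (f : testFn) :
    eLpNorm (f : E3 → ℝ) 2 volume ^ 2 = ENNReal.ofReal (testInner f f) := by
  rw [eLpNorm_two_sq, testInner_apply, ofReal_integral_eq_lintegral_ofReal
    (integrable_mul_testFn f.2.1.continuous f) (.of_forall fun x => mul_self_nonneg _)]
  congr 1; funext x
  rw [Real.enorm_eq_ofReal_abs, ← ENNReal.ofReal_pow (abs_nonneg _), sq_abs, sq]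

/-- The unweighted `L²` estimate for test tensors. -/
theorem eLpNorm_testD_le {j : Fin 3 → Fin 3 → Fin 3 → testFn} (hj : JacSymm j) (e a b c : Fin 3) :
    eLpNorm (testD e (j a b c)).1 2 volume ≤
      2 * ∑ i : IP, eLpNorm (flatP (fun e a b c => testD e (j a b c)) i).1 2 volume := by
  rw [← ENNReal.pow_le_pow_left_iff two_ne_zero, eLpNorm_testFn_sq]
  set P := flatP fun e a b c => testD e (j a b c) with hP
  have h := coercive_of_bilin testD testInner testInner_symm testInner_self_nonneg testInner_null hj
  have h1 : testInner (testD e (j a b c)) (testD e (j a b c)) ≤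
      ∑ e, ∑ a, ∑ b, ∑ c, testInner (testD e (j a b c)) (testD e (j a b c)) := by
    have := Finset.single_le_sum (f := fun i : I4 =>
      testInner (testD i.1 (j i.2.1 i.2.2.1 i.2.2.2)) (testD i.1 (j i.2.1 i.2.2.1 i.2.2.2)))
      (fun _ _ => testInner_self_nonneg _) (Finset.mem_univ (e, a, b, c))
    simpa only [Fintype.sum_prod_type] using this
  -- Coercivity yields the constant `3/2`; it is enlarged to `4`, the square of the factor `2` in
  -- the statement.
  have h2 : testInner (testD e (j a b c)) (testD e (j a b c)) ≤
      4 * ∑ i, testInner (P i) (P i) := by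
    rw [Fintype.sum_sum_type, Fintype.sum_prod_type]
    have n1 := Finset.sum_nonneg fun a (_ : a ∈ Finset.univ) => Finset.sum_nonneg
      fun c (_ : c ∈ Finset.univ) => testInner_self_nonneg (P (.inl (a, c)))
    have n2 := Finset.sum_nonneg fun a (_ : a ∈ Finset.univ) => testInner_self_nonneg (P (.inr a))
    simp only [hP, flatP] at n1 n2 ⊢
    linarith
  refine (ENNReal.ofReal_le_ofReal h2).trans ?_
  rw [ENNReal.ofReal_mul (by norm_num), ENNReal.ofReal_sum_of_nonneg
    fun i _ => testInner_self_nonneg _, mul_pow]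
  simp only [← eLpNorm_testFn_sq]
  refine mul_le_mul' (by norm_num) ?_
  exact sum_sq_le_sq_sum _

end Apriori

/-! ### The weighted first-order estimate for test tensors. -/

section AprioriWeighted

theorem testFn_aesm (f : testFn) : AEStronglyMeasurable f.1 (volume : Measure E3) :=
  f.2.1.continuous.aestronglyMeasurable

theorem wnorm_const_mul_sum_le {ι : Type*} [Fintype ι] {g : ι → E3 → ℝ} {c τ : ℝ} (hc : 0 ≤ c)
    (hg : ∀ i, AEStronglyMeasurable (g i) volume) :
    wnorm τ (fun y => c * ∑ i, |g i y|) ≤ ENNReal.ofReal c * ∑ i, wnorm τ (g i) := by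
  refine wnorm_le_sum (t := fun _ => τ) hc hg (.of_forall fun x => ?_)
  rw [abs_of_nonneg (mul_nonneg hc (Finset.sum_nonneg fun _ _ => abs_nonneg _)), ← Finset.mul_sum]
  exact (mul_left_comm _ _ _).le

theorem wnorm_test_le {τ : ℝ} (h1 : -(1 / 2) < τ) (h2 : τ < 3 / 2) :
    ∃ C : ℝ, 0 < C ∧ ∀ j : Fin 3 → Fin 3 → Fin 3 → testFn, JacSymm j → ∀ a b c,
      wnorm (τ - 1) (j a b c).1 ≤ ENNReal.ofReal C *
        ∑ i : IP, wnorm τ (flatP (fun e a b c => testD e (j a b c)) i).1 := by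
  obtain ⟨C1, hC1, k1⟩ := enorm_le_riesz_two
  obtain ⟨C2, hC2, k2⟩ := wnorm_le_of_riesz h1 h2
  refine ⟨C2 * C1, by positivity, fun j hj a b c => ?_⟩
  set P := flatP (fun e a b c => testD e (j a b c)) with hP
  have hF (i : IP) (y : E3) : |(P i).1 y| ≤ ∑ i : IP, |(P i).1 y| :=
    Finset.single_le_sum (f := fun i => |(P i).1 y|) (fun _ _ => abs_nonneg _) (Finset.mem_univ i)
  have hc : Continuous fun y => ∑ i : IP, |(P i).1 y| :=
    continuous_finsetSum _ fun i _ => (P i).2.1.continuous.abs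
  have h := k2 (fun y => C1 * ∑ i : IP, |(P i).1 y|) (j a b c).1
    (hc.measurable.const_mul C1) (fun x => ?_)
  · refine h.trans ?_
    rw [ENNReal.ofReal_mul hC2.le, mul_assoc]
    exact mul_le_mul_right (wnorm_const_mul_sum_le hC1.le fun i => testFn_aesm _) _
  · refine (k1 j hj (fun y => ∑ i : IP, |(P i).1 y|) (fun m n y => hF (.inl (m, n)) y)
      (fun m y => hF (.inr m) y) a b c x).trans_eq ?_
    rw [← lintegral_const_mul' _ _ ENNReal.ofReal_ne_top]
    congr 1; funext y
    rw [enorm_mul, Real.enorm_of_nonneg hC1.le]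
    ring

theorem testD_smoothMul {w : E3 → ℝ} (hw : ContDiff ℝ ∞ w) (e : Fin 3) (f : testFn) :
    testD e (smoothMul w hw f) =
      smoothMul w hw (testD e f) + smoothMul (pd e w) (contDiff_pd hw e) f := by
  ext x
  exact pd_mul hw f.2.1 e x

theorem abs_le_sum_I3 (J : Fin 3 → Fin 3 → Fin 3 → ℝ) (a b c : Fin 3) :
    |J a b c| ≤ ∑ i : I3, |J i.1 i.2.1 i.2.2| :=
  Finset.single_le_sum (f := fun i : I3 => |J i.1 i.2.1 i.2.2|)
    (fun _ _ => abs_nonneg _) (Finset.mem_univ (a, b, c))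

/-- The weighted a priori estimate for test tensors. -/
theorem wnorm_testD_le {τ : ℝ} (h1 : -(1 / 2) < τ) (h2 : τ < 3 / 2) :
    ∃ C : ℝ, 0 < C ∧ ∀ j : Fin 3 → Fin 3 → Fin 3 → testFn, JacSymm j → ∀ a b c,
      wnorm (τ - 1) (j a b c).1 ≤ ENNReal.ofReal C *
        ∑ i : IP, wnorm τ (flatP (fun e a b c => testD e (j a b c)) i).1 ∧
      ∀ e, wnorm τ (testD e (j a b c)).1 ≤ ENNReal.ofReal C *
        ∑ i : IP, wnorm τ (flatP (fun e a b c => testD e (j a b c)) i).1 := by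
  obtain ⟨C, hC, k⟩ := wnorm_test_le h1 h2
  set A := |τ| with hA
  have hA0 : 0 ≤ A := abs_nonneg τ
  refine ⟨C + 2 * (12 * (1 + 27 * A * (27 * C))) + A * C, by positivity,
    fun j hj a b c => ⟨(k j hj a b c).trans ?_, fun e => ?_⟩⟩
  · refine mul_le_mul_left (ENNReal.ofReal_le_ofReal ?_) _
    rw [add_assoc]
    exact le_add_of_nonneg_right (by positivity)
  set S := ∑ i : IP, wnorm τ (flatP (fun e a b c => testD e (j a b c)) i).1 with hS
  have hw := contDiff_sigma_rpow τ
  set w := fun x : E3 => sigma x ^ τ with hw_def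
  -- The unweighted estimate is applied to `σ^τ J`. Since `|∂ σ^τ| ≤ |τ| σ^{τ-1}`, the commutator
  -- terms involve only `σ^{τ-1} J`, which `wnorm_test_le` already bounds by `S`.
  let u : Fin 3 → Fin 3 → Fin 3 → testFn := fun a b c => smoothMul w hw (j a b c)
  have hu : JacSymm u := hj.map _
  -- the commutator terms
  have q (e a b c : Fin 3) (x : E3) :
      |(smoothMul (pd e w) (contDiff_pd hw e) (j a b c)).1 x| ≤
        A * (sigma x ^ (τ - 1) * |(j a b c).1 x|) := by
    change |pd e w x * _| ≤ _
    rw [abs_mul, ← mul_assoc]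
    exact mul_le_mul_of_nonneg_right (abs_pd_sigma_rpow_le τ e x) (abs_nonneg _)
  have habs (x : E3) : |sigma x ^ (τ - 1)| = sigma x ^ (τ - 1) :=
    abs_of_pos (Real.rpow_pos_of_pos (sigma_pos x) _)
  have meas (f : testFn) :
      AEStronglyMeasurable (fun x => sigma x ^ (τ - 1) * f.1 x) (volume : Measure E3) :=
    ((continuous_sigma_rpow _).mul f.2.1.continuous).aestronglyMeasurable
  have q1 (e a b c : Fin 3) :
      eLpNorm (smoothMul (pd e w) (contDiff_pd hw e) (j a b c)).1 2 volume ≤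
        ENNReal.ofReal (A * C) * S := by
    have := eLpNorm_le_sum_of_abs_le (ι := Unit) (f := (smoothMul (pd e w) (contDiff_pd hw e) (j a b c)).1)
      (g := fun _ x => sigma x ^ (τ - 1) * (j a b c).1 x) hA0 (fun _ => meas _)
      (.of_forall fun x => by simpa [abs_mul, habs] using q e a b c x)
    refine this.trans ?_
    rw [ENNReal.ofReal_mul hA0, mul_assoc]
    rw [Fintype.sum_unique]
    exact mul_le_mul_right (k j hj a b c) _
  have q2 (i : IP) : eLpNorm (flatP (fun e a b c => testD e (u a b c)) i).1 2 volume ≤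
      ENNReal.ofReal (1 + 27 * A * (27 * C)) * S := by
    have split : (flatP (fun e a b c => testD e (u a b c)) i).1 =
        (smoothMul w hw (flatP (fun e a b c => testD e (j a b c)) i)).1 +
        (flatP (fun e a b c => smoothMul (pd e w) (contDiff_pd hw e) (j a b c)) i).1 := by
      have e1 : (fun e a b c => testD e (u a b c)) = fun e a b c =>
          smoothMul w hw (testD e (j a b c)) + smoothMul (pd e w) (contDiff_pd hw e) (j a b c) := by
        funext e a b c
        exact testD_smoothMul hw e _
      rw [e1, flatP_add, ← flatP_map]
      rfl
    have r1 : eLpNorm (smoothMul w hw (flatP (fun e a b c => testD e (j a b c)) i)).1 2 volume ≤ S :=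
      Finset.single_le_sum
        (f := fun i => wnorm τ (flatP (fun e a b c => testD e (j a b c)) i).1)
        (fun _ _ => zero_le) (Finset.mem_univ i)
    have r2 : eLpNorm (flatP (fun e a b c =>
        smoothMul (pd e w) (contDiff_pd hw e) (j a b c)) i).1 2 volume ≤
        ENNReal.ofReal (27 * A * (27 * C)) * S := by
      have := eLpNorm_le_sum_of_abs_le (ι := I3) (c := 27 * A) (f := (flatP (fun e a b c =>
        smoothMul (pd e w) (contDiff_pd hw e) (j a b c)) i).1)
        (g := fun i x => sigma x ^ (τ - 1) * (j i.1 i.2.1 i.2.2).1 x) (by positivity)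
        (fun _ => meas _) (.of_forall fun x => ?_)
      · refine this.trans ?_
        rw [ENNReal.ofReal_mul (p := 27 * A) (by positivity), mul_assoc]
        refine mul_le_mul_right ?_ _
        refine (Finset.sum_le_sum fun i _ => k j hj i.1 i.2.1 i.2.2).trans_eq ?_
        rw [← hS, Finset.sum_const, ENNReal.ofReal_mul (by norm_num)]
        simp [mul_assoc]
      · rw [flatP_apply, mul_assoc]
        refine abs_flatP_le _ (fun e a b c => (q e a b c x).trans ?_) i
        refine mul_le_mul_of_nonneg_left ?_ hA0
        have := abs_le_sum_I3 (fun a b c => sigma x ^ (τ - 1) * (j a b c).1 x) a b c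
        rwa [abs_mul, habs] at this
    rw [split]
    refine (eLpNorm_add_le (testFn_aesm _) (testFn_aesm _) (by norm_num)).trans ?_
    rw [ENNReal.ofReal_add zero_le_one (by positivity), add_mul, ENNReal.ofReal_one, one_mul]
    exact add_le_add r1 r2
  have q3 : wnorm τ (testD e (j a b c)).1 ≤ eLpNorm (testD e (u a b c)).1 2 volume +
      eLpNorm (smoothMul (pd e w) (contDiff_pd hw e) (j a b c)).1 2 volume := by
    have e1 : (fun x => sigma x ^ τ * (testD e (j a b c)).1 x) = (testD e (u a b c)).1 -
        (smoothMul (pd e w) (contDiff_pd hw e) (j a b c)).1 := by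
      have := testD_smoothMul hw e (j a b c)
      have h3 := eq_sub_of_add_eq this.symm
      exact congrArg Subtype.val h3
    rw [wnorm, e1]
    exact eLpNorm_sub_le (testFn_aesm _) (testFn_aesm _) (by norm_num)
  refine q3.trans ((add_le_add (eLpNorm_testD_le hu e a b c) (q1 e a b c)).trans ?_)
  refine (add_le_add_left (mul_le_mul_right (Finset.sum_le_sum fun i _ => q2 i) 2) _).trans ?_
  have hK : 0 ≤ 1 + 27 * A * (27 * C) := by positivity
  generalize 1 + 27 * A * (27 * C) = K at hK ⊢
  rw [Finset.sum_const, ENNReal.ofReal_add (by positivity) (by positivity), add_mul]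
  refine add_le_add ?_ le_rfl
  rw [ENNReal.ofReal_add hC.le (by positivity), add_mul]
  refine le_add_left ?_
  rw [ENNReal.ofReal_mul zero_le_two, ENNReal.ofReal_mul (by norm_num)]
  simp [mul_assoc]

end AprioriWeighted

/-! ### Mollification, in weighted norms and on weak derivatives. -/

section Mollification

open Filter Topology Metric

/-- A shrinking sequence of bump functions. -/
noncomputable def bump (n : ℕ) : ContDiffBump (0 : E3) where
  rIn := 1 / (n + 2)
  rOut := 2 / (n + 2)
  rIn_pos := by positivity
  rIn_lt_rOut := by gcongr; norm_num

/-- The mollifier of index `n`. -/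
noncomputable def mker (n : ℕ) : E3 → ℝ := (bump n).normed volume

theorem contDiff_mker (n : ℕ) : ContDiff ℝ ∞ (mker n) := (bump n).contDiff_normed

theorem hasCompactSupport_mker (n : ℕ) : HasCompactSupport (mker n) :=
  (bump n).hasCompactSupport_normed

theorem mker_nonneg (n : ℕ) (x : E3) : 0 ≤ mker n x := (bump n).nonneg_normed x

theorem mker_eq_zero {n : ℕ} {x : E3} (hx : 1 < ‖x‖) : mker n x = 0 := by
  by_contra h
  have h1 : x ∈ Function.support ((bump n).normed volume) := h
  rw [ContDiffBump.support_normed_eq, mem_ball_zero_iff] at h1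
  have h2 : (bump n).rOut ≤ 1 := by
    change (2 : ℝ) / (n + 2) ≤ 1
    rw [div_le_one (by positivity)]
    linarith [(Nat.cast_nonneg n : (0 : ℝ) ≤ n)]
  linarith

theorem lintegral_mker (n : ℕ) : ∫⁻ x, ENNReal.ofReal (mker n x) = 1 := by
  rw [← ofReal_integral_eq_lintegral_ofReal
    ((contDiff_mker n).continuous.integrable_of_hasCompactSupport (hasCompactSupport_mker n))
    (.of_forall (mker_nonneg n)), mker, ContDiffBump.integral_normed, ENNReal.ofReal_one]

/-- Mollification. -/
noncomputable def moll (n : ℕ) (f : E3 → ℝ) (x : E3) : ℝ := ∫ y, mker n (x - y) * f y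

theorem moll_eq_convolution (n : ℕ) (f : E3 → ℝ) :
    moll n f = convolution (mker n) f (ContinuousLinearMap.lsmul ℝ ℝ) volume := by
  funext x
  rw [convolution_lsmul_swap]
  rfl

theorem moll_congr {f g : E3 → ℝ} (h : f =ᵐ[volume] g) (n : ℕ) : moll n f = moll n g := by
  funext x
  refine integral_congr_ae ?_
  filter_upwards [h] with y hy
  rw [hy]

theorem contDiff_moll {f : E3 → ℝ} (hf : LocallyIntegrable f volume) (n : ℕ) :
    ContDiff ℝ ∞ (moll n f) := by
  rw [moll_eq_convolution]
  exact (hasCompactSupport_mker n).contDiff_convolution_left _ (contDiff_mker n) hf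

theorem hasCompactSupport_moll {f : E3 → ℝ} (hf : HasCompactSupport f) (n : ℕ) :
    HasCompactSupport (moll n f) := by
  rw [moll_eq_convolution]
  exact (hasCompactSupport_mker n).convolution _ hf

theorem integrable_mker_mul {f : E3 → ℝ} (hf : LocallyIntegrable f volume) (n : ℕ) (x : E3) :
    Integrable fun y => mker n (x - y) * f y := by
  have h := (hasCompactSupport_mker n).convolutionExists_left (ContinuousLinearMap.lsmul ℝ ℝ)
    (contDiff_mker n).continuous hf x
  rw [convolutionExistsAt_iff_integrable_swap] at h
  exact h

theorem tendsto_moll {f : E3 → ℝ} (hf : LocallyIntegrable f volume) :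
    ∀ᵐ x, Tendsto (fun n => moll n f x) atTop (𝓝 (f x)) := by
  simp only [moll_eq_convolution]
  -- The outer radius is always twice the inner one; this bounded ratio gives convergence at almost
  -- every point.
  refine ContDiffBump.ae_convolution_tendsto_right_of_locallyIntegrable (K := 2) ?_
    (.of_forall fun n => ?_) hf
  · have h : Tendsto (fun n : ℕ => (2 : ℝ) / ((n : ℝ) + 2)) atTop (𝓝 0) :=
      tendsto_const_nhds.div_atTop
        (tendsto_atTop_add_const_right _ _ tendsto_natCast_atTop_atTop)
    exact h
  · change (2 : ℝ) / (n + 2) ≤ 2 * (1 / (n + 2))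
    exact le_of_eq (by ring)

theorem pd_moll {u v : E3 → ℝ} {i : Fin 3} (h : IsWeakPartial i u v) (n : ℕ) :
    pd i (moll n u) = moll n v := by
  obtain ⟨hu, hv, h⟩ := h
  funext x
  have h1 := (hasCompactSupport_mker n).hasFDerivAt_convolution_left
    (ContinuousLinearMap.lsmul ℝ ℝ) ((contDiff_mker n).of_le (by simp)) hu x
  rw [← moll_eq_convolution] at h1
  rw [pd_eq_of_hasFDerivAt h1]
  have h2 := ((hasCompactSupport_mker n).fderiv ℝ).convolutionExists_left
    ((ContinuousLinearMap.lsmul ℝ ℝ).precompL E3)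
    ((contDiff_mker n).continuous_fderiv (by simp)) hu x
  rw [convolution_eq_swap, ContinuousLinearMap.integral_apply
    (convolutionExistsAt_iff_integrable_swap.1 h2)]
  have hs : ContDiff ℝ ∞ fun y => mker n (x - y) :=
    (contDiff_mker n).comp (contDiff_const.sub contDiff_id)
  have hc : HasCompactSupport fun y => mker n (x - y) :=
    (hasCompactSupport_mker n).comp_homeomorph (Homeomorph.subLeft x)
  have h3 := h _ hs hc
  have e : ∀ y, fderiv ℝ (fun y => mker n (x - y)) y (bvec i) = - pd i (mker n) (x - y) :=
    fun y => pd_comp_sub_left (contDiff_mker n) i x y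
  simp only [e, mul_neg, integral_neg, neg_inj] at h3
  simp only [moll, mul_comm (mker n _), ← h3]
  congr 1
  funext y
  simp [pd, mul_comm]

theorem sigma_rpow_le_of_norm_sub_le {x y : E3} (h : ‖x - y‖ ≤ 1) (s : ℝ) :
    sigma x ^ s ≤ 2 ^ |s| * sigma y ^ s := by
  have hx := sigma_pos x
  have hy := sigma_pos y
  have h1 := sigma_le_add_norm_sub x y
  have h2 := sigma_le_add_norm_sub y x
  have h3 := one_le_sigma x
  have h4 := one_le_sigma y
  rw [norm_sub_rev] at h2
  rcases le_total 0 s with hs | hs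
  · rw [abs_of_nonneg hs, ← Real.mul_rpow zero_le_two hy.le]
    exact Real.rpow_le_rpow hx.le (by linarith) hs
  · rw [abs_of_nonpos hs, Real.rpow_neg zero_le_two, ← Real.inv_rpow zero_le_two,
      ← Real.mul_rpow (by norm_num) hy.le]
    exact Real.rpow_le_rpow_of_nonpos (by positivity) (by linarith) hs

theorem wnorm_congr {f g : E3 → ℝ} (h : f =ᵐ[volume] g) (s : ℝ) : wnorm s f = wnorm s g := by
  refine eLpNorm_congr_ae ?_
  filter_upwards [h] with x hx
  rw [hx]

/-- Mollification is bounded in weighted `L²` spaces. -/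
theorem wnorm_moll_le (s : ℝ) : ∃ C : ℝ, 0 < C ∧ ∀ n, ∀ f : E3 → ℝ,
    AEStronglyMeasurable f volume → wnorm s (moll n f) ≤ ENNReal.ofReal C * wnorm s f := by
  refine ⟨√(2 ^ |2 * s|), by positivity, fun n f hf => ?_⟩
  obtain ⟨F, hF, hfF⟩ := hf.aemeasurable
  rw [moll_congr hfF, wnorm_congr hfF]
  have hFe : Measurable fun y => ‖F y‖ₑ := hF.enorm
  have hk : Measurable fun z => ENNReal.ofReal (mker n z) :=
    (contDiff_mker n).continuous.measurable.ennreal_ofReal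
  have mk (x : E3) : Measurable fun y => ENNReal.ofReal (mker n (x - y)) := hk.comp (by fun_prop)
  have mk2 : Measurable fun p : E3 × E3 => ENNReal.ofReal (mker n (p.1 - p.2)) :=
    hk.comp (by fun_prop)
  have mf : Measurable fun y => ENNReal.ofReal (sigma y ^ (2 * s)) * ‖F y‖ₑ ^ 2 :=
    (measurable_ofReal_sigma _).mul (hFe.pow_const 2)
  rw [← ENNReal.pow_le_pow_left_iff two_ne_zero, mul_pow, wnorm_sq, wnorm_sq,
    ← ENNReal.ofReal_pow (by positivity), Real.sq_sqrt (by positivity)]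
  have pt (x : E3) : ENNReal.ofReal (sigma x ^ (2 * s)) * ‖moll n F x‖ₑ ^ 2 ≤
      ENNReal.ofReal (2 ^ |2 * s|) * ∫⁻ y, ENNReal.ofReal (mker n (x - y)) *
        (ENNReal.ofReal (sigma y ^ (2 * s)) * ‖F y‖ₑ ^ 2) := by
    have h1 : ‖moll n F x‖ₑ ≤ ∫⁻ y, ENNReal.ofReal (mker n (x - y)) * ‖F y‖ₑ := by
      refine (enorm_integral_le_lintegral_enorm _).trans_eq ?_
      congr 1; funext y
      rw [enorm_mul, Real.enorm_of_nonneg (mker_nonneg n _)]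
    -- With trivial auxiliary weights and a kernel of mass one this is Jensen's inequality. The
    -- weight passes through because the mollifier lives in the unit ball, where `σ(x)` and `σ(y)`
    -- are comparable.
    have cs := lintegral_kernel_sq_le (mk x) (measurable_const (a := (1 : ENNReal)))
      (measurable_const (a := (1 : ENNReal))) hFe fun y => one_mul 1
    simp only [mul_one, one_mul] at cs
    rw [lintegral_sub_left_eq_self (fun y => ENNReal.ofReal (mker n y)) x, lintegral_mker,
      one_mul] at cs
    refine (mul_le_mul_right ((pow_le_pow_left₀ zero_le h1 2).trans cs) _).trans ?_
    rw [← lintegral_const_mul' _ _ ENNReal.ofReal_ne_top,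
      ← lintegral_const_mul' _ _ ENNReal.ofReal_ne_top]
    refine lintegral_mono fun y => ?_
    by_cases hxy : 1 < ‖x - y‖
    · simp [mker_eq_zero hxy]
    · have := sigma_rpow_le_of_norm_sub_le (not_lt.1 hxy) (2 * s)
      calc _ = ENNReal.ofReal (sigma x ^ (2 * s)) *
            (ENNReal.ofReal (mker n (x - y)) * ‖F y‖ₑ ^ 2) := rfl
        _ ≤ ENNReal.ofReal (2 ^ |2 * s| * sigma y ^ (2 * s)) *
            (ENNReal.ofReal (mker n (x - y)) * ‖F y‖ₑ ^ 2) :=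
            mul_le_mul_left (ENNReal.ofReal_le_ofReal this) _
        _ = _ := by rw [ENNReal.ofReal_mul (by positivity)]; ring
  refine (lintegral_mono pt).trans ?_
  have mm : Measurable fun p : E3 × E3 => ENNReal.ofReal (mker n (p.1 - p.2)) *
        (ENNReal.ofReal (sigma p.2 ^ (2 * s)) * ‖F p.2‖ₑ ^ 2) :=
    mk2.mul (mf.comp measurable_snd)
  rw [lintegral_const_mul _ mm.lintegral_prod_right', lintegral_lintegral_swap mm.aemeasurable]
  refine mul_le_mul_right (le_of_eq ?_) _
  congr 1; funext y
  have hk2 : Measurable fun x => ENNReal.ofReal (mker n (x - y)) := hk.comp (by fun_prop)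
  dsimp only
  rw [lintegral_mul_const _ hk2,
    lintegral_sub_right_eq_self (fun x => ENNReal.ofReal (mker n x)) y, lintegral_mker, one_mul]

/-- Locally integrable functions. -/
def locInt : Submodule ℝ (E3 → ℝ) where
  carrier := {f | LocallyIntegrable f volume}
  add_mem' h1 h2 := LocallyIntegrable.add h1 h2
  zero_mem' := locallyIntegrable_zero
  smul_mem' c _ h := LocallyIntegrable.smul h c

theorem locallyIntegrable_smooth_mul {ψ u : E3 → ℝ} (hψ : Continuous ψ)
    (hu : LocallyIntegrable u volume) : LocallyIntegrable (fun x => ψ x * u x) volume := by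
  rw [← locallyIntegrableOn_univ] at hu ⊢
  exact hu.continuousOn_mul hψ.continuousOn isOpen_univ.isLocallyClosed

/-- The mollification of `ψ u`, for a cutoff function `ψ`. -/
noncomputable def mollMul (n : ℕ) (ψ : testFn) : locInt →ₗ[ℝ] testFn where
  toFun u := ⟨moll n fun x => ψ.1 x * u.1 x,
    contDiff_moll (locallyIntegrable_smooth_mul ψ.2.1.continuous u.2) n,
    hasCompactSupport_moll ψ.2.2.mul_right n⟩
  map_add' u v := by
    ext x
    change moll n _ x = moll n _ x + moll n _ x
    rw [moll, moll, moll, ← integral_add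
      (integrable_mker_mul (locallyIntegrable_smooth_mul ψ.2.1.continuous u.2) n x)
      (integrable_mker_mul (locallyIntegrable_smooth_mul ψ.2.1.continuous v.2) n x)]
    simp [mul_add]
  map_smul' c u := by
    ext x
    change moll n _ x = c * moll n _ x
    rw [moll, moll, ← integral_const_mul]
    simp [mul_left_comm]

theorem mollMul_congr {u v : locInt} (h : u.1 =ᵐ[volume] v.1) (n : ℕ) (ψ : testFn) :
    mollMul n ψ u = mollMul n ψ v := by
  refine Subtype.ext (moll_congr ?_ n)
  filter_upwards [h] with x hx
  rw [hx]

/-- The product rule for weak derivatives. -/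
theorem IsWeakPartial.smooth_mul {u v ψ : E3 → ℝ} {i : Fin 3} (h : IsWeakPartial i u v)
    (hψ : ContDiff ℝ ∞ ψ) :
    IsWeakPartial i (fun x => ψ x * u x) (fun x => ψ x * v x + pd i ψ x * u x) := by
  obtain ⟨hu, hv, h⟩ := h
  have hψ' := contDiff_pd hψ i
  refine ⟨locallyIntegrable_smooth_mul hψ.continuous hu,
    (locallyIntegrable_smooth_mul hψ.continuous hv).add
      (locallyIntegrable_smooth_mul hψ'.continuous hu), fun φ hφ hc => ?_⟩
  have int {w ρ : E3 → ℝ} (hw : LocallyIntegrable w volume) (hρ : Continuous ρ)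
      (hρc : HasCompactSupport ρ) : Integrable fun x => w x * ρ x := by
    simpa [mul_comm] using hw.integrable_smul_left_of_hasCompactSupport hρ hρc
  have h1 := h (fun x => ψ x * φ x) (hψ.mul hφ) hc.mul_left
  have e : ∀ x, fderiv ℝ (fun x => ψ x * φ x) x (bvec i) = ψ x * pd i φ x + pd i ψ x * φ x :=
    fun x => pd_mul hψ hφ i x
  have a1 : Integrable fun x => u x * (ψ x * pd i φ x) :=
    int hu (hψ.continuous.mul (contDiff_pd hφ i).continuous) (hasCompactSupport_pd hc i).mul_left
  have a2 : Integrable fun x => u x * (pd i ψ x * φ x) :=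
    int hu (hψ'.continuous.mul hφ.continuous) hc.mul_left
  have a3 : Integrable fun x => v x * (ψ x * φ x) :=
    int hv (hψ.continuous.mul hφ.continuous) hc.mul_left
  simp only [e, mul_add] at h1
  rw [integral_add a1 a2] at h1
  have e1 : ∫ x, (ψ x * v x + pd i ψ x * u x) * φ x =
      (∫ x, v x * (ψ x * φ x)) + ∫ x, u x * (pd i ψ x * φ x) := by
    rw [← integral_add a3 a2]
    congr 1; funext x; ring
  rw [e1, neg_add, ← h1, ← sub_eq_add_neg, add_sub_cancel_right]
  congr 1; funext x
  simp only [pd]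
  ring

theorem testD_mollMul {u v : locInt} {i : Fin 3} (h : IsWeakPartial i u.1 v.1) (n : ℕ)
    (ψ : testFn) :
    testD i (mollMul n ψ u) = mollMul n ψ v + mollMul n (testD i ψ) u := by
  refine Subtype.ext ((pd_moll (h.smooth_mul ψ.2.1) n).trans ?_)
  funext x
  change moll n _ x = moll n _ x + moll n _ x
  rw [moll, moll, moll, ← integral_add
      (integrable_mker_mul (locallyIntegrable_smooth_mul ψ.2.1.continuous v.2) n x)
      (integrable_mker_mul (locallyIntegrable_smooth_mul (testD i ψ).2.1.continuous u.2) n x)]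
  simp [mul_add, testD_apply]

end Mollification

/-! ### Cutoffs at radius `n + 1` combined with mollification. -/

section Cutoff

open Filter Topology Metric

/-- The standard bump function, equal to one on the unit ball. -/
noncomputable def bump0 : ContDiffBump (0 : E3) where
  rIn := 1
  rOut := 2
  rIn_pos := one_pos
  rIn_lt_rOut := one_lt_two

/-- The standard bump function, as a test function. -/
noncomputable def chi0 : testFn := ⟨bump0, bump0.contDiff, bump0.hasCompactSupport⟩

/-- Rescaling of a test function. -/
noncomputable def scaleTest (c : ℝ) (hc : c ≠ 0) (f : testFn) : testFn :=
  ⟨fun x => f.1 (c • x), f.2.1.comp (contDiff_id.const_smul c),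
    f.2.2.comp_homeomorph (Homeomorph.smulOfNeZero c hc)⟩

theorem testD_scaleTest (c : ℝ) (hc : c ≠ 0) (f : testFn) (i : Fin 3) :
    testD i (scaleTest c hc f) = c • scaleTest c hc (testD i f) := by
  ext x
  have h1 : HasFDerivAt (fun z : E3 => c • z) (c • ContinuousLinearMap.id ℝ E3) x :=
    (hasFDerivAt_id x).const_smul c
  refine (pd_eq_of_hasFDerivAt
    ((differentiable_of_smooth f.2.1 (c • x)).hasFDerivAt.comp x h1) i).trans ?_
  simp [scaleTest, testD_apply, pd]

theorem inv_natCast_succ_ne (n : ℕ) : ((n : ℝ) + 1)⁻¹ ≠ 0 := by positivity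

/-- The cutoff function at radius `n + 1`. -/
noncomputable def chi (n : ℕ) : testFn := scaleTest ((n : ℝ) + 1)⁻¹ (inv_natCast_succ_ne n) chi0

theorem chi_eq_one {n : ℕ} {x : E3} (hx : ‖x‖ ≤ n + 1) : (chi n).1 x = 1 := by
  refine bump0.one_of_mem_closedBall ?_
  rw [mem_closedBall_zero_iff, norm_smul, Real.norm_of_nonneg (by positivity)]
  change _ ≤ (1 : ℝ)
  rw [inv_mul_le_iff₀ (by positivity)]
  linarith

theorem abs_chi_le (n : ℕ) (x : E3) : |(chi n).1 x| ≤ 1 := by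
  change |bump0 _| ≤ 1
  rw [abs_of_nonneg bump0.nonneg]
  exact bump0.le_one

theorem testD_chi_eq_zero {n : ℕ} {x : E3} (hx : ‖x‖ < n + 1) (i : Fin 3) :
    (testD i (chi n)).1 x = 0 := by
  have h : (chi n).1 =ᶠ[𝓝 x] fun _ => 1 := by
    filter_upwards [(isOpen_lt continuous_norm continuous_const).mem_nhds hx] with y hy
    exact chi_eq_one (le_of_lt hy)
  rw [testD_apply, pd, h.fderiv_eq]
  simp

/-- On the support of the rescaled function `‖x‖ ≤ 2(n + 1)`, hence `σ(x) ≤ 3(n + 1)`, so each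
factor `1/(n + 1)` from differentiating a cutoff costs at most `3 σ^{-1}`. This makes derivatives of
cutoffs fit the weighted scale uniformly in `n`. -/
theorem bump0_scale_bound (f : testFn) (hf : ∀ z, 2 < ‖z‖ → f.1 z = 0) (m : ℕ) :
    ∃ C : ℝ, 0 < C ∧ ∀ (n : ℕ) x, |((n : ℝ) + 1)⁻¹ ^ m *
      (scaleTest ((n : ℝ) + 1)⁻¹ (inv_natCast_succ_ne n) f).1 x| ≤ C * sigma x ^ (-(m : ℝ)) := by
  obtain ⟨C, hC⟩ := f.2.2.exists_bound_of_continuous f.2.1.continuous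
  have hC0 : 0 ≤ C := (norm_nonneg _).trans (hC 0)
  refine ⟨(C + 1) * 3 ^ m, by positivity, fun n x => ?_⟩
  have hs := sigma_pos x
  have hn : (0 : ℝ) < n + 1 := by positivity
  rw [abs_mul, abs_of_pos (a := _ ^ m) (by positivity), Real.rpow_neg hs.le, Real.rpow_natCast]
  by_cases hx : 2 < ‖((n : ℝ) + 1)⁻¹ • x‖
  · have : (scaleTest ((n : ℝ) + 1)⁻¹ (inv_natCast_succ_ne n) f).1 x = 0 := hf _ hx
    rw [this, abs_zero, mul_zero]
    positivity
  · rw [not_lt, norm_smul, Real.norm_of_nonneg (by positivity), inv_mul_le_iff₀ hn] at hx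
    have h1 : sigma x ≤ 3 * (n + 1) := by
      have := sigma_le_add_norm_sub x 0
      have e : sigma 0 = 1 := by simp [sigma]
      rw [e, sub_zero] at this
      linarith [(Nat.cast_nonneg n : (0 : ℝ) ≤ n)]
    have h2 : ((n : ℝ) + 1)⁻¹ ≤ 3 * (sigma x)⁻¹ := by
      rw [inv_le_iff_one_le_mul₀ hn, mul_assoc, mul_comm, mul_assoc, inv_mul_eq_div,
        le_div_iff₀ hs]
      linarith
    have h3 : |(scaleTest ((n : ℝ) + 1)⁻¹ (inv_natCast_succ_ne n) f).1 x| ≤ C + 1 :=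
      (hC _).trans (by linarith)
    calc ((n : ℝ) + 1)⁻¹ ^ m * |(scaleTest ((n : ℝ) + 1)⁻¹ (inv_natCast_succ_ne n) f).1 x|
        ≤ (3 * (sigma x)⁻¹) ^ m * (C + 1) := by gcongr
      _ = _ := by rw [mul_pow, inv_pow]; ring

theorem testD_eq_zero_of_norm {f : testFn} (hf : ∀ z, 2 < ‖z‖ → f.1 z = 0) (i : Fin 3) (z : E3)
    (hz : 2 < ‖z‖) : (testD i f).1 z = 0 := by
  have h : f.1 =ᶠ[𝓝 z] fun _ => 0 := by
    filter_upwards [(isOpen_lt continuous_const continuous_norm).mem_nhds hz] with y hy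
    exact hf y hy
  rw [testD_apply, pd, h.fderiv_eq]
  simp

theorem chi0_eq_zero (z : E3) (hz : 2 < ‖z‖) : chi0.1 z = 0 :=
  bump0.zero_of_le_dist (by rw [dist_zero_right]; exact hz.le)

theorem abs_testD_chi_le : ∃ C : ℝ, 0 < C ∧ ∀ i n x,
    |(testD i (chi n)).1 x| ≤ C * sigma x ^ (-1 : ℝ) := by
  choose C hC h using fun i => bump0_scale_bound (testD i chi0)
    (testD_eq_zero_of_norm chi0_eq_zero i) 1
  refine ⟨∑ i, C i, Finset.sum_pos (fun i _ => hC i) Finset.univ_nonempty, fun i n x => ?_⟩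
  have := h i n x
  rw [pow_one, Nat.cast_one] at this
  rw [chi, testD_scaleTest]
  refine this.trans (mul_le_mul_of_nonneg_right ?_ (Real.rpow_nonneg (sigma_pos x).le _))
  exact Finset.single_le_sum (fun i _ => (hC i).le) (Finset.mem_univ i)

theorem abs_testD_testD_chi_le : ∃ C : ℝ, 0 < C ∧ ∀ i j n x,
    |(testD j (testD i (chi n))).1 x| ≤ C * sigma x ^ (-2 : ℝ) := by
  choose C hC h using fun p : Fin 3 × Fin 3 => bump0_scale_bound (testD p.2 (testD p.1 chi0))
    (testD_eq_zero_of_norm (testD_eq_zero_of_norm chi0_eq_zero p.1) p.2) 2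
  refine ⟨∑ i, C i, Finset.sum_pos (fun i _ => hC i) Finset.univ_nonempty, fun i j n x => ?_⟩
  have := h (i, j) n x
  rw [chi, testD_scaleTest, map_smul, testD_scaleTest, smul_smul, ← sq]
  rw [Nat.cast_ofNat] at this
  refine this.trans (mul_le_mul_of_nonneg_right ?_ (Real.rpow_nonneg (sigma_pos x).le _))
  exact Finset.single_le_sum (f := C) (fun i _ => (hC i).le) (Finset.mem_univ (i, j))

/-- The mollifier at `x` sees only the unit ball around `x`, where the cutoff is eventually one;
what remains is convergence of plain mollifications. -/
theorem tendsto_mollMul_chi (u : locInt) :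
    ∀ᵐ x, Tendsto (fun n => (mollMul n (chi n) u).1 x) atTop (𝓝 (u.1 x)) := by
  filter_upwards [tendsto_moll u.2] with x hx
  refine hx.congr' ?_
  obtain ⟨N, hN⟩ := exists_nat_gt ‖x‖
  filter_upwards [eventually_ge_atTop N] with n hn
  change moll n _ x = moll n _ x
  refine integral_congr_ae (.of_forall fun y => ?_)
  simp only
  by_cases hxy : 1 < ‖x - y‖
  · simp [mker_eq_zero hxy]
  · have h1 : ‖y‖ ≤ n + 1 := by
      have := norm_le_insert x y
      have : (N : ℝ) ≤ n := by exact_mod_cast hn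
      linarith
    rw [chi_eq_one h1, one_mul]

theorem tendsto_mollMul_testD_chi (u : locInt) (i : Fin 3) (x : E3) :
    Tendsto (fun n => (mollMul n (testD i (chi n)) u).1 x) atTop (𝓝 0) := by
  refine tendsto_const_nhds.congr' ?_
  obtain ⟨N, hN⟩ := exists_nat_gt ‖x‖
  filter_upwards [eventually_ge_atTop N] with n hn
  change 0 = moll n _ x
  rw [moll, eq_comm]
  refine integral_eq_zero_of_ae (.of_forall fun y => ?_)
  by_cases hxy : 1 < ‖x - y‖
  · simp [mker_eq_zero hxy]
  · have h1 : ‖y‖ < n + 1 := by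
      have := norm_le_insert x y
      have : (N : ℝ) ≤ n := by exact_mod_cast hn
      linarith
    simp [testD_chi_eq_zero h1]

theorem wnorm_le_of_abs_le {f g : E3 → ℝ} {s t c : ℝ} (hc : 0 ≤ c)
    (hg : AEStronglyMeasurable g volume)
    (h : ∀ᵐ x, sigma x ^ s * |f x| ≤ c * (sigma x ^ t * |g x|)) :
    wnorm s f ≤ ENNReal.ofReal c * wnorm t g := by
  have := wnorm_le_sum (ι := Unit) (t := fun _ => t) (g := fun _ => g) (f := f) (s := s) hc
    (fun _ => hg) (by simpa using h)
  simpa using this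

theorem wnorm_mul_le {ψ u v : E3 → ℝ} {s m c : ℝ} (hc : 0 ≤ c)
    (hv : AEStronglyMeasurable v volume)
    (h : ∀ x, |ψ x * u x| ≤ c * sigma x ^ (-m) * |v x|) :
    wnorm s (fun x => ψ x * u x) ≤ ENNReal.ofReal c * wnorm (s - m) v := by
  refine wnorm_le_of_abs_le hc hv (.of_forall fun x => ?_)
  have hs := sigma_pos x
  calc sigma x ^ s * |ψ x * u x| ≤ sigma x ^ s * (c * sigma x ^ (-m) * |v x|) := by
        gcongr; exact h x
    _ = _ := by rw [sub_eq_add_neg, Real.rpow_add hs]; ring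

theorem aesm_locInt (u : locInt) : AEStronglyMeasurable u.1 (volume : Measure E3) :=
  u.2.aestronglyMeasurable

/-- The part of a function outside of a ball. -/
noncomputable def tail (n : ℕ) (u : E3 → ℝ) : E3 → ℝ := {x | (n : ℝ) + 1 ≤ ‖x‖}.indicator u

theorem aesm_tail (n : ℕ) (u : locInt) :
    AEStronglyMeasurable (tail n u.1) (volume : Measure E3) :=
  (aesm_locInt u).indicator (measurableSet_le measurable_const measurable_norm)

/-- Dominated convergence. The gradient of the cutoff is supported in the tail region, so this
removes the cutoff error in the limit. Finiteness of the norm is essential: for constant tensors `J`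
the Euclidean operator vanishes, and they are excluded only by their infinite norm. -/
theorem tendsto_wnorm_tail {u : locInt} {s : ℝ} (h : wnorm s u.1 ≠ ⊤) :
    Tendsto (fun n => wnorm s (tail n u.1)) atTop (𝓝 0) := by
  have h2 : Tendsto (fun n => wnorm s (tail n u.1) ^ 2) atTop (𝓝 0) := by
    simp only [wnorm_sq]
    have hfin : ∫⁻ x, ENNReal.ofReal (sigma x ^ (2 * s)) * ‖u.1 x‖ₑ ^ 2 ≠ ⊤ := by
      rw [← wnorm_sq]; exact ENNReal.pow_ne_top h
    have := tendsto_lintegral_of_dominated_convergence'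
      (F := fun n x => ENNReal.ofReal (sigma x ^ (2 * s)) * ‖tail n u.1 x‖ₑ ^ 2) (f := fun _ => 0)
      (μ := volume) (fun x => ENNReal.ofReal (sigma x ^ (2 * s)) * ‖u.1 x‖ₑ ^ 2)
      (fun n => (measurable_ofReal_sigma _).aemeasurable.mul ((aesm_tail n u).enorm.pow_const 2))
      (fun n => .of_forall fun x => ?_) hfin (.of_forall fun x => ?_)
    · simpa using this
    · refine mul_le_mul_right (pow_le_pow_left₀ zero_le ?_ 2) _
      exact enorm_indicator_le_enorm_self _ _
    · refine tendsto_const_nhds.congr' ?_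
      obtain ⟨N, hN⟩ := exists_nat_gt ‖x‖
      filter_upwards [eventually_ge_atTop N] with n hn
      have : (N : ℝ) ≤ n := by exact_mod_cast hn
      rw [tail, Set.indicator_of_notMem (by simp; linarith)]
      simp
  have h3 := (ENNReal.continuous_rpow_const (y := 1 / 2)).tendsto 0 |>.comp h2
  have e (a : ENNReal) : (a ^ 2) ^ (1 / 2 : ℝ) = a := by
    rw [← ENNReal.rpow_natCast, ← ENNReal.rpow_mul]; norm_num
  simp only [Function.comp_def, e] at h3
  simpa using h3

/-- Weighted bounds for the cut off and mollified functions. -/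
theorem wnorm_mollMul_le (s : ℝ) : ∃ C : ℝ, 0 < C ∧ ∀ n (u : locInt),
    wnorm s (mollMul n (chi n) u).1 ≤ ENNReal.ofReal C * wnorm s u.1 ∧
    (∀ i, wnorm s (mollMul n (testD i (chi n)) u).1 ≤
      ENNReal.ofReal C * wnorm (s - 1) (tail n u.1)) ∧
    ∀ i j, wnorm s (mollMul n (testD j (testD i (chi n))) u).1 ≤
      ENNReal.ofReal C * wnorm (s - 2) u.1 := by
  obtain ⟨C0, hC0, k0⟩ := wnorm_moll_le s
  obtain ⟨C1, hC1, k1⟩ := abs_testD_chi_le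
  obtain ⟨C2, hC2, k2⟩ := abs_testD_testD_chi_le
  refine ⟨C0 * (1 + C1 + C2), by positivity, fun n u => ⟨?_, fun i => ?_, fun i j => ?_⟩⟩
  · have h := wnorm_mul_le (ψ := (chi n).1) (u := u.1) (v := u.1) (s := s) (m := 0) (c := 1)
      zero_le_one (aesm_locInt u) fun x => by
        simp only [neg_zero, Real.rpow_zero, mul_one, one_mul, abs_mul]
        exact mul_le_of_le_one_left (abs_nonneg _) (abs_chi_le n x)
    refine (k0 n _ (locallyIntegrable_smooth_mul (chi n).2.1.continuous
      u.2).aestronglyMeasurable).trans ((mul_le_mul_right h _).trans ?_)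
    rw [← mul_assoc, ← ENNReal.ofReal_mul hC0.le, sub_zero]
    refine mul_le_mul_left (ENNReal.ofReal_le_ofReal ?_) _
    gcongr
    linarith
  · have h := wnorm_mul_le (ψ := (testD i (chi n)).1) (u := u.1) (v := tail n u.1) (s := s)
      (m := 1) (c := C1) hC1.le (aesm_tail n u) fun x => by
        by_cases hx : ‖x‖ < n + 1
        · rw [testD_chi_eq_zero hx, zero_mul, abs_zero]
          have := sigma_pos x
          positivity
        · rw [tail, Set.indicator_of_mem (by simpa using hx), abs_mul]
          exact mul_le_mul_of_nonneg_right (k1 i n x) (abs_nonneg _)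
    refine (k0 n _ (locallyIntegrable_smooth_mul (testD i (chi n)).2.1.continuous
      u.2).aestronglyMeasurable).trans ((mul_le_mul_right h _).trans ?_)
    rw [← mul_assoc, ← ENNReal.ofReal_mul hC0.le]
    refine mul_le_mul_left (ENNReal.ofReal_le_ofReal ?_) _
    gcongr
    linarith
  · have h := wnorm_mul_le (ψ := (testD j (testD i (chi n))).1) (u := u.1) (v := u.1) (s := s)
      (m := 2) (c := C2) hC2.le (aesm_locInt u) fun x => by
        rw [abs_mul]
        exact mul_le_mul_of_nonneg_right (k2 i j n x) (abs_nonneg _)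
    refine (k0 n _ (locallyIntegrable_smooth_mul (testD j (testD i (chi n))).2.1.continuous
      u.2).aestronglyMeasurable).trans ((mul_le_mul_right h _).trans ?_)
    rw [← mul_assoc, ← ENNReal.ofReal_mul hC0.le]
    refine mul_le_mul_left (ENNReal.ofReal_le_ofReal ?_) _
    gcongr
    linarith

end Cutoff

/-! ### From test functions to weakly differentiable tensors. -/

section WeakEstimates

open Filter Topology Metric

/-- Fatou's lemma, so that almost everywhere convergence of the approximations suffices. -/
theorem wnorm_le_of_tendsto {f : ℕ → E3 → ℝ} {g : E3 → ℝ} {s : ℝ} {b : ℕ → ENNReal} {B : ENNReal}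
    (hf : ∀ n, AEStronglyMeasurable (f n) volume)
    (hfg : ∀ᵐ x, Tendsto (fun n => f n x) atTop (𝓝 (g x)))
    (hb : ∀ n, wnorm s (f n) ≤ b n) (hB : Tendsto b atTop (𝓝 B)) : wnorm s g ≤ B := by
  refine (Lp.eLpNorm_lim_le_liminf_eLpNorm (f := fun n x => sigma x ^ s * f n x)
    (fun n => (continuous_sigma_rpow s).aestronglyMeasurable.mul (hf n)) _ ?_).trans ?_
  · filter_upwards [hfg] with x hx
    exact hx.const_mul _
  · refine (liminf_le_liminf (.of_forall hb)).trans ?_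
    rw [hB.liminf_eq]

theorem wnorm_add_le {f g : E3 → ℝ} {s : ℝ} (hf : AEStronglyMeasurable f volume)
    (hg : AEStronglyMeasurable g volume) : wnorm s (f + g) ≤ wnorm s f + wnorm s g := by
  have e : (fun x => sigma x ^ s * (f + g) x) =
      (fun x => sigma x ^ s * f x) + fun x => sigma x ^ s * g x := by
    funext x; simp [mul_add]
  rw [wnorm, e]
  exact eLpNorm_add_le ((continuous_sigma_rpow s).aestronglyMeasurable.mul hf)
    ((continuous_sigma_rpow s).aestronglyMeasurable.mul hg) (by norm_num)

theorem wnorm_tail_le (n : ℕ) (u : E3 → ℝ) (s : ℝ) : wnorm s (tail n u) ≤ wnorm s u := by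
  refine eLpNorm_mono fun x => ?_
  rw [norm_mul, norm_mul]
  exact mul_le_mul_of_nonneg_left (norm_indicator_le_norm_self _ _) (norm_nonneg _)

theorem wnorm_flatP_le {G : Fin 3 → Fin 3 → Fin 3 → Fin 3 → E3 → ℝ} {s : ℝ}
    (hG : ∀ e a b c, AEStronglyMeasurable (G e a b c) volume) (i : IP) :
    wnorm s (fun x => flatP (fun e a b c => G e a b c x) i) ≤
      27 * ∑ i : I4, wnorm s (G i.1 i.2.1 i.2.2.1 i.2.2.2) := by
  have := wnorm_le_sum (ι := I4) (c := 27) (s := s) (t := fun _ => s)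
    (f := fun x => flatP (fun e a b c => G e a b c x) i)
    (g := fun i => G i.1 i.2.1 i.2.2.1 i.2.2.2) (by norm_num) (fun _ => hG _ _ _ _)
    (.of_forall fun x => ?_)
  · simpa using this
  · rw [← Finset.mul_sum, mul_left_comm]
    refine mul_le_mul_of_nonneg_left ?_ (Real.rpow_nonneg (sigma_pos x).le _)
    exact abs_flatP_le _ (abs_le_sum_I4 fun e a b c => G e a b c x) i

theorem flatP_locInt_apply (G : Fin 3 → Fin 3 → Fin 3 → Fin 3 → locInt) (i : IP) (x : E3) :
    (flatP G i).1 x = flatP (fun e a b c => (G e a b c).1 x) i :=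
  flatP_map ((LinearMap.proj x).comp locInt.subtype) G i

/-- The weighted a priori estimate for the Euclidean operator. -/
theorem wnorm_weak_le {τ : ℝ} (h1 : -(1 / 2) < τ) (h2 : τ < 3 / 2) :
    ∃ C : ℝ, 0 < C ∧ ∀ (J : Fin 3 → Fin 3 → Fin 3 → locInt)
      (G : Fin 3 → Fin 3 → Fin 3 → Fin 3 → locInt),
      (∀ e a b c, IsWeakPartial e (J a b c).1 (G e a b c).1) →
      (∀ a b c, (J a b c + J c a b + J b c a).1 =ᵐ[volume] 0 ∧
        (J a b c + J a c b).1 =ᵐ[volume] 0) →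
      (∀ a b c, wnorm (τ - 1) (J a b c).1 ≠ ⊤) → ∀ a b c,
      wnorm (τ - 1) (J a b c).1 ≤ ENNReal.ofReal C * ∑ i : IP, wnorm τ (flatP G i).1 ∧
      ∀ e, wnorm τ (G e a b c).1 ≤ ENNReal.ofReal C * ∑ i : IP, wnorm τ (flatP G i).1 := by
  obtain ⟨C, hC, k⟩ := wnorm_testD_le h1 h2
  obtain ⟨M, hM, m⟩ := wnorm_mollMul_le τ
  refine ⟨C * M, by positivity, fun J G hJG hJ hfin => ?_⟩
  set S := ∑ i : IP, wnorm τ (flatP G i).1 with hS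
  let j : ℕ → Fin 3 → Fin 3 → Fin 3 → testFn := fun n a b c => mollMul n (chi n) (J a b c)
  let r : ℕ → Fin 3 → Fin 3 → Fin 3 → Fin 3 → testFn := fun n e a b c =>
    mollMul n (testD e (chi n)) (J a b c)
  -- Cutoff and mollification are linear and insensitive to null sets, so symmetries valid almost
  -- everywhere become exact ones.
  have hj (n : ℕ) : JacSymm (j n) := fun a b c => by
    simp only [j, ← map_add]
    constructor
    · rw [mollMul_congr (v := 0) (hJ a b c).1, map_zero]
    · rw [mollMul_congr (v := 0) (hJ a b c).2, map_zero]
  have hD (n : ℕ) (e a b c : Fin 3) :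
      testD e (j n a b c) = mollMul n (chi n) (G e a b c) + r n e a b c :=
    testD_mollMul (hJG e a b c) n _
  let t : ℕ → ENNReal := fun n => ∑ i : I4, wnorm (τ - 1) (tail n (J i.2.1 i.2.2.1 i.2.2.2).1)
  have ht : Tendsto t atTop (𝓝 0) := by
    have := tendsto_finsetSum (Finset.univ : Finset I4) fun i _ =>
      tendsto_wnorm_tail (hfin i.2.1 i.2.2.1 i.2.2.2)
    simpa using this
  have hP (n : ℕ) (i : IP) : wnorm τ (flatP (fun e a b c => testD e (j n a b c)) i).1 ≤
      ENNReal.ofReal M * wnorm τ (flatP G i).1 + 27 * (ENNReal.ofReal M * t n) := by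
    have e1 : (flatP (fun e a b c => testD e (j n a b c)) i).1 =
        (mollMul n (chi n) (flatP G i)).1 + (flatP (r n) i).1 := by
      simp only [hD]
      rw [flatP_add, flatP_map]
      rfl
    rw [e1]
    refine (wnorm_add_le (testFn_aesm _) (testFn_aesm _)).trans
      (add_le_add (m n (flatP G i)).1 ?_)
    have e2 : (flatP (r n) i).1 = fun x => flatP (fun e a b c => (r n e a b c).1 x) i :=
      funext fun x => flatP_apply (r n) i x
    rw [e2]
    refine (wnorm_flatP_le (fun e a b c => testFn_aesm (r n e a b c)) i).trans ?_
    refine mul_le_mul_right ?_ _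
    rw [Finset.mul_sum]
    exact Finset.sum_le_sum fun i _ => (m n (J i.2.1 i.2.2.1 i.2.2.2)).2.1 i.1
  let b : ℕ → ENNReal := fun n =>
    ENNReal.ofReal C * ∑ i : IP, (ENNReal.ofReal M * wnorm τ (flatP G i).1 +
      27 * (ENNReal.ofReal M * t n))
  have hb : Tendsto b atTop (𝓝 (ENNReal.ofReal (C * M) * S)) := by
    have h3 : Tendsto (fun n => 27 * (ENNReal.ofReal M * t n)) atTop (𝓝 0) := by
      have h4 := ENNReal.Tendsto.const_mul (a := 27) (ENNReal.Tendsto.const_mul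
        (a := ENNReal.ofReal M) ht (Or.inr ENNReal.ofReal_ne_top))
        (Or.inr (by norm_num : (27 : ENNReal) ≠ ⊤))
      simpa using h4
    have h5 := ENNReal.Tendsto.const_mul (a := ENNReal.ofReal C)
      (tendsto_finsetSum (Finset.univ : Finset IP) fun i _ =>
        (tendsto_const_nhds (x := ENNReal.ofReal M * wnorm τ (flatP G i).1)).add h3)
      (Or.inr ENNReal.ofReal_ne_top)
    simp only [add_zero] at h5
    rw [← Finset.mul_sum, ← mul_assoc, ← ENNReal.ofReal_mul hC.le] at h5
    exact h5
  have hle (n : ℕ) : ENNReal.ofReal C *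
      ∑ i : IP, wnorm τ (flatP (fun e a b c => testD e (j n a b c)) i).1 ≤ b n :=
    mul_le_mul_right (Finset.sum_le_sum fun i _ => hP n i) _
  refine fun a b' c => ⟨?_, fun e => ?_⟩
  · exact wnorm_le_of_tendsto (fun n => testFn_aesm (j n a b' c)) (tendsto_mollMul_chi _)
      (fun n => ((k (j n) (hj n) a b' c).1).trans (hle n)) hb
  · refine wnorm_le_of_tendsto (fun n => testFn_aesm (testD e (j n a b' c))) ?_
      (fun n => ((k (j n) (hj n) a b' c).2 e).trans (hle n)) hb
    filter_upwards [tendsto_mollMul_chi (G e a b' c)] with x hx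
    have := hx.add (tendsto_mollMul_testD_chi (J a b' c) e x)
    rw [add_zero] at this
    refine this.congr fun n => ?_
    rw [hD]
    rfl

/-- The weighted Sobolev embedding of `H^{2,γ}` into `L^∞`. -/
theorem ae_enorm_le_sobolev {γ : ℝ} (h1 : -1 < γ) (h2 : γ < 0) :
    ∃ C : ℝ, 0 < C ∧ ∀ (u : locInt) (v : Fin 3 → locInt) (w : Fin 3 → locInt),
      (∀ i, IsWeakPartial i u.1 (v i).1) → (∀ i, IsWeakPartial i (v i).1 (w i).1) →
      ∀ᵐ x, ‖u.1 x‖ₑ ≤ ENNReal.ofReal (C * sigma x ^ γ) * (wnorm (-γ - 3 / 2) u.1 +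
        ∑ i, wnorm (-γ - 1 / 2) (v i).1 + ∑ i, wnorm (1 / 2 - γ) (w i).1) := by
  obtain ⟨C1, hC1, k1⟩ := enorm_le_riesz_one
  obtain ⟨C2, hC2, k2⟩ := riesz_one_le h1 h2
  obtain ⟨M, hM, m⟩ := wnorm_mollMul_le (1 / 2 - γ)
  refine ⟨C1 * C2 * (3 * M), by positivity, fun u v w huv hvw => ?_⟩
  set B := wnorm (-γ - 3 / 2) u.1 + ∑ i, wnorm (-γ - 1 / 2) (v i).1 +
    ∑ i, wnorm (1 / 2 - γ) (w i).1 with hB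
  have hL (n : ℕ) : wnorm (1 / 2 - γ) (lapl testD (mollMul n (chi n) u)).1 ≤
      ENNReal.ofReal (3 * M) * B := by
    -- Product rule: each derivative that hits the cutoff lowers the weight exponent by one, exactly
    -- as the norms of `v` and `u` in `B` require. Only pure second derivatives occur, since the
    -- kernel bound needs just the Laplacian.
    have e (i : Fin 3) : testD i (testD i (mollMul n (chi n) u)) =
        mollMul n (chi n) (w i) + mollMul n (testD i (chi n)) (v i) +
        (mollMul n (testD i (chi n)) (v i) + mollMul n (testD i (testD i (chi n))) u) := by
      rw [testD_mollMul (huv i), map_add, testD_mollMul (hvw i), testD_mollMul (huv i)]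
    have e1 (i : Fin 3) : wnorm (1 / 2 - γ) (testD i (testD i (mollMul n (chi n) u))).1 ≤
        ENNReal.ofReal M * (wnorm (1 / 2 - γ) (w i).1 + wnorm (-γ - 1 / 2) (v i).1 +
          (wnorm (-γ - 1 / 2) (v i).1 + wnorm (-γ - 3 / 2) u.1)) := by
      rw [e]
      have a1 := (m n (w i)).1
      have a2 := ((m n (v i)).2.1 i).trans (mul_le_mul_right (wnorm_tail_le n _ _) _)
      have a3 := (m n u).2.2 i i
      rw [show 1 / 2 - γ - 1 = -γ - 1 / 2 by ring] at a2
      rw [show 1 / 2 - γ - 2 = -γ - 3 / 2 by ring] at a3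
      rw [mul_add, mul_add, mul_add]
      refine (wnorm_add_le (testFn_aesm _) (testFn_aesm _)).trans (add_le_add ?_ ?_)
      · exact (wnorm_add_le (testFn_aesm _) (testFn_aesm _)).trans (add_le_add a1 a2)
      · exact (wnorm_add_le (testFn_aesm _) (testFn_aesm _)).trans (add_le_add a2 a3)
    have e2 : (lapl testD (mollMul n (chi n) u)).1 =
        (testD 0 (testD 0 (mollMul n (chi n) u))).1 +
        (testD 1 (testD 1 (mollMul n (chi n) u))).1 +
        (testD 2 (testD 2 (mollMul n (chi n) u))).1 := by
      rw [lapl, Fin.sum_univ_three]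
      rfl
    rw [e2]
    refine (wnorm_add_le ((testFn_aesm _).add (testFn_aesm _)) (testFn_aesm _)).trans
      ((add_le_add_left (wnorm_add_le (testFn_aesm _) (testFn_aesm _)) _).trans ?_)
    refine (add_le_add (add_le_add (e1 0) (e1 1)) (e1 2)).trans ?_
    rw [← mul_add, ← mul_add, mul_comm 3 M, ENNReal.ofReal_mul hM.le, mul_assoc]
    refine mul_le_mul_right ?_ _
    rw [hB, Fin.sum_univ_three, Fin.sum_univ_three]
    generalize wnorm (-γ - 3 / 2) u.1 = x0
    generalize wnorm (-γ - 1 / 2) (v 0).1 = y0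
    generalize wnorm (-γ - 1 / 2) (v 1).1 = y1
    generalize wnorm (-γ - 1 / 2) (v 2).1 = y2
    generalize wnorm (1 / 2 - γ) (w 0).1 = z0
    generalize wnorm (1 / 2 - γ) (w 1).1 = z1
    generalize wnorm (1 / 2 - γ) (w 2).1 = z2
    have h3 : ENNReal.ofReal 3 = 3 := by norm_num
    rw [h3]
    calc _ = 3 * x0 + 2 * (y0 + y1 + y2) + 1 * (z0 + z1 + z2) := by ring
      _ ≤ 3 * x0 + 3 * (y0 + y1 + y2) + 3 * (z0 + z1 + z2) := by
        gcongr <;> norm_num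
      _ = _ := by ring
  filter_upwards [tendsto_mollMul_chi u] with x hx
  refine le_of_tendsto ((continuous_enorm.tendsto _).comp hx) (.of_forall fun n => ?_)
  refine (k1 (mollMul n (chi n) u) x).trans ?_
  refine (mul_le_mul_right ((k2 _ (lapl testD (mollMul n (chi n) u)).2.1.continuous.measurable
    x).trans (mul_le_mul_right (hL n) _)) _).trans_eq ?_
  have := sigma_pos x
  rw [← mul_assoc, ← mul_assoc, ← ENNReal.ofReal_mul hC1.le, ← ENNReal.ofReal_mul (by positivity)]
  congr 2
  ring

end WeakEstimates

/-! ### Calculus of `weakPartial` and sup bounds from the Sobolev norm. -/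

section Sobolev

open Filter Topology Metric

theorem weakPartial_spec {i : Fin 3} {u : E3 → ℝ} (h : ∃ v, IsWeakPartial i u v) :
    IsWeakPartial i u (weakPartial i u) := by
  rw [weakPartial, dif_pos h]
  exact h.choose_spec

theorem IsWeakPartial.congr {i : Fin 3} {u u' v v' : E3 → ℝ} (h : IsWeakPartial i u v)
    (hu : u =ᵐ[volume] u') (hv : v =ᵐ[volume] v') : IsWeakPartial i u' v' := by
  obtain ⟨h1, h2, h3⟩ := h
  refine ⟨(locallyIntegrable_congr hu).1 h1, (locallyIntegrable_congr hv).1 h2,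
    fun φ hφ hc => ?_⟩
  have e1 : ∫ x, u' x * fderiv ℝ φ x (EuclideanSpace.single i 1) =
      ∫ x, u x * fderiv ℝ φ x (EuclideanSpace.single i 1) := by
    refine integral_congr_ae ?_
    filter_upwards [hu] with x hx; rw [hx]
  have e2 : ∫ x, v' x * φ x = ∫ x, v x * φ x := by
    refine integral_congr_ae ?_
    filter_upwards [hv] with x hx; rw [hx]
  rw [e1, e2, h3 φ hφ hc]

theorem integrable_locInt_mul {w ρ : E3 → ℝ} (hw : LocallyIntegrable w volume)
    (hρ : Continuous ρ) (hρc : HasCompactSupport ρ) : Integrable fun x => w x * ρ x := by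
  simpa [mul_comm] using hw.integrable_smul_left_of_hasCompactSupport hρ hρc

theorem IsWeakPartial.add {i : Fin 3} {u u' v v' : E3 → ℝ} (h : IsWeakPartial i u v)
    (h' : IsWeakPartial i u' v') : IsWeakPartial i (u + u') (v + v') := by
  refine ⟨h.1.add h'.1, h.2.1.add h'.2.1, fun φ hφ hc => ?_⟩
  have c1 := (contDiff_pd hφ i).continuous
  have c2 := hasCompactSupport_pd hc i
  have e1 := h.2.2 φ hφ hc
  have e2 := h'.2.2 φ hφ hc
  have f1 := integral_add (integrable_locInt_mul h.1 c1 c2) (integrable_locInt_mul h'.1 c1 c2)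
  have f2 := integral_add (integrable_locInt_mul h.2.1 hφ.continuous hc)
    (integrable_locInt_mul h'.2.1 hφ.continuous hc)
  simp only [Pi.add_apply, add_mul]
  simp only [pd] at f1
  rw [f1, f2, e1, e2]
  ring

theorem isWeakPartial_const (i : Fin 3) (c : ℝ) : IsWeakPartial i (fun _ => c) 0 := by
  refine ⟨locallyIntegrable_const c, locallyIntegrable_zero, fun φ hφ hc => ?_⟩
  have h := integral_mul_pd (f := fun _ => c) contDiff_const hφ hc i
  have e : pd i (fun _ : E3 => c) = 0 := by funext x; simp [pd]
  rw [e] at h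
  exact h

theorem IsWeakPartial.unique {i : Fin 3} {u v w : E3 → ℝ} (h : IsWeakPartial i u v)
    (h' : IsWeakPartial i u w) : v =ᵐ[volume] w := by
  have hl : LocallyIntegrable (v - w) volume := h.2.1.sub h'.2.1
  have := ae_eq_zero_of_integral_contDiff_smul_eq_zero hl fun φ hφ hc => by
    have e1 := h.2.2 φ hφ hc
    have e2 := h'.2.2 φ hφ hc
    have f := integral_sub (integrable_locInt_mul h.2.1 hφ.continuous hc)
      (integrable_locInt_mul h'.2.1 hφ.continuous hc)
    have : ∀ x, φ x • (v - w) x = v x * φ x - w x * φ x := fun x => by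
      simp only [smul_eq_mul, Pi.sub_apply]; ring
    simp only [this]
    rw [f]
    linarith
  filter_upwards [this] with x hx
  exact sub_eq_zero.1 hx

theorem weakPartial_ae_eq {i : Fin 3} {u v : E3 → ℝ} (h : IsWeakPartial i u v) :
    weakPartial i u =ᵐ[volume] v :=
  (weakPartial_spec ⟨v, h⟩).unique h

theorem MemSobolev.isWeakPartial {k : ℕ} {β : ℝ} {n : ℕ} {T : TensorField n}
    (hT : MemSobolev k β T) (a : Fin n → Fin 3) {s : List (Fin 3)} (hs : s.length < k)
    (i : Fin 3) : IsWeakPartial i (weakD s (T a)) (weakD (i :: s) (T a)) :=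
  weakPartial_spec (hT.2.1 a s hs i)

/-- Dictionary between the two scales: twice the exponent `|s| - β - 3/2` is the exponent `-2(β -
|s|) - 3` of the Sobolev norm, so the left side is one summand of the right. -/
theorem wnorm_weakD_le {k : ℕ} {β : ℝ} {n : ℕ} (T : TensorField n) (a : Fin n → Fin 3)
    (s : List (Fin 3)) (hs : s.length ≤ k) :
    wnorm (s.length - β - 3 / 2) (weakD s (T a)) ≤ sobolevNorm k β T := by
  have e (a : ENNReal) : (a ^ 2) ^ (1 / 2 : ℝ) = a := by
    rw [← ENNReal.rpow_natCast, ← ENNReal.rpow_mul]; norm_num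
  rw [← e (wnorm _ _), wnorm_sq, sobolevNorm]
  refine ENNReal.rpow_le_rpow ?_ (by norm_num)
  have h1 : ∫⁻ x, ENNReal.ofReal (sigma x ^ (2 * (s.length - β - 3 / 2 : ℝ))) *
        ‖weakD s (T a) x‖ₑ ^ 2 = ∫⁻ x, ENNReal.ofReal
      ((weakD (List.ofFn s.get) (T a) x) ^ 2 * sigma x ^ (-2 * (β - s.length) - 3)) := by
    congr 1; funext x
    rw [List.ofFn_get, ENNReal.ofReal_mul (sq_nonneg _), mul_comm, ← sq_abs (weakD s (T a) x),
      ENNReal.ofReal_pow (abs_nonneg _), ← Real.enorm_eq_ofReal_abs]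
    ring_nf
  rw [h1]
  refine le_trans ?_ (Finset.single_le_sum (fun _ _ => zero_le)
    (Finset.mem_range.2 (Nat.lt_succ_of_le hs)))
  refine le_trans ?_ (Finset.single_le_sum (fun _ _ => zero_le) (Finset.mem_univ a))
  exact Finset.single_le_sum (f := fun t : Fin s.length → Fin 3 => ∫⁻ x, ENNReal.ofReal
      ((weakD (List.ofFn t) (T a) x) ^ 2 * sigma x ^ (-2 * (β - s.length) - 3)))
      (fun _ _ => zero_le) (Finset.mem_univ s.get)

theorem wnorm_mono_exponent {s t : ℝ} (h : s ≤ t) (f : E3 → ℝ) : wnorm s f ≤ wnorm t f := by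
  refine eLpNorm_mono fun x => ?_
  rw [norm_mul, norm_mul]
  refine mul_le_mul_of_nonneg_right ?_ (norm_nonneg _)
  have := sigma_pos x
  rw [Real.norm_of_nonneg (by positivity), Real.norm_of_nonneg (by positivity)]
  exact Real.rpow_le_rpow_of_exponent_le (one_le_sigma x) h

theorem MemSobolev.locallyIntegrable {k : ℕ} {β : ℝ} {n : ℕ} {T : TensorField n}
    (hT : MemSobolev k β T) (a : Fin n → Fin 3) :
    ∀ s : List (Fin 3), s.length ≤ k → LocallyIntegrable (weakD s (T a)) volume
  | [], _ => hT.1 a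
  | i :: s, h => (hT.isWeakPartial a (s := s) (by simpa using h) i).2.1

theorem abs_pd_sigma_le (i : Fin 3) (x : E3) : |pd i sigma x| ≤ 1 := by
  have h := abs_pd_sigma_rpow_le 1 i x
  simpa using h

theorem abs_pd_pd_sigma_le (i j : Fin 3) (x : E3) : |pd i (pd j sigma) x| ≤ 2 * sigma x ^ (-1 : ℝ) := by
  have e : sigma = qpow 1 (1 / 2) := funext sigma_eq_qpow
  have h := abs_pd_pd_kernel_le one_pos i j x
  rw [e, Real.rpow_neg_one]
  exact h

theorem contDiff_sigma : ContDiff ℝ ∞ sigma := by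
  have e : sigma = qpow 1 (1 / 2) := funext sigma_eq_qpow
  rw [e]; exact contDiff_qpow one_pos _

/-- Pointwise bounds for functions in `H^{3,β}`. -/
theorem ae_abs_le_of_sobolev {β : ℝ} (h1 : -1 < β) (h2 : β < 0) :
    ∃ C : ℝ, 0 < C ∧ ∀ (k : ℕ) (_ : 3 ≤ k) (n : ℕ) (T : TensorField n) (_ : MemSobolev k β T)
      (ε : ℝ) (_ : 0 ≤ ε) (_ : sobolevNorm k β T ≤ ENNReal.ofReal ε) (a : Fin n → Fin 3),
      (∀ᵐ x, |T a x| ≤ C * ε) ∧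
        ∀ i, ∀ᵐ x, |weakPartial i (T a) x| ≤ C * ε * sigma x ^ (-1 : ℝ) := by
  obtain ⟨C, hC, k0⟩ := ae_enorm_le_sobolev h1 h2
  -- The two estimates need `7 = 1 + 3 + 3` and `22 = 1 + 3 · 2 + 3 · 5` copies of the norm; `43`
  -- covers both.
  refine ⟨C * 43, by positivity, fun k hk n T hT ε hε hN a => ?_⟩
  set N := sobolevNorm k β T
  have loc (s : List (Fin 3)) (hs : s.length ≤ 3) : LocallyIntegrable (weakD s (T a)) volume :=
    hT.locallyIntegrable a s (hs.trans hk)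
  have par (s : List (Fin 3)) (hs : s.length < 3) (i : Fin 3) :
      IsWeakPartial i (weakD s (T a)) (weakD (i :: s) (T a)) :=
    hT.isWeakPartial a (by omega) i
  have nrm (s : List (Fin 3)) (hs : s.length ≤ 3) (t : ℝ) (ht : t = s.length - β - 3 / 2) :
      wnorm t (weakD s (T a)) ≤ N := by
    rw [ht]; exact wnorm_weakD_le T a s (hs.trans hk)
  have fin {c y : ℝ} {x : E3} {B : ENNReal} (hc : 0 ≤ c) (hB : B ≤ ENNReal.ofReal c * N)
      (hy : ‖y‖ₑ ≤ ENNReal.ofReal (C * sigma x ^ β) * B) : |y| ≤ C * c * ε := by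
    have hs := sigma_pos x
    have h3 : sigma x ^ β ≤ 1 := Real.rpow_le_one_of_one_le_of_nonpos (one_le_sigma x) h2.le
    have h4 : ‖y‖ₑ ≤ ENNReal.ofReal (C * c * ε) := by
      refine hy.trans ((mul_le_mul_right (hB.trans (mul_le_mul_right hN _)) _).trans ?_)
      rw [← ENNReal.ofReal_mul hc, ← ENNReal.ofReal_mul (by positivity)]
      refine ENNReal.ofReal_le_ofReal ?_
      have h6 : C * sigma x ^ β ≤ C * 1 := by gcongr
      calc C * sigma x ^ β * (c * ε) ≤ C * 1 * (c * ε) := by gcongr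
        _ = _ := by ring
    rw [Real.enorm_eq_ofReal_abs] at h4
    exact (ENNReal.ofReal_le_ofReal_iff (by positivity)).1 h4
  constructor
  · have := k0 ⟨_, loc [] (by simp)⟩ (fun i => ⟨_, loc [i] (by simp)⟩)
      (fun i => ⟨_, loc [i, i] (by simp)⟩) (fun i => par [] (by simp) i)
      (fun i => par [i] (by simp) i)
    filter_upwards [this] with x hx
    have h5 := fin (c := 7) (by norm_num) ?_ hx
    · refine h5.trans ?_
      have : C * 7 ≤ C * 43 := by linarith
      gcongr
    · simp only [Fin.sum_univ_three]
      refine (add_le_add (add_le_add (nrm [] (by simp) _ (by simp)) (add_le_add (add_le_add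
        (nrm [0] (by simp) _ ?_) (nrm [1] (by simp) _ ?_)) (nrm [2] (by simp) _ ?_)))
        (add_le_add (add_le_add
        (nrm [0, 0] (by simp) _ ?_) (nrm [1, 1] (by simp) _ ?_))
          (nrm [2, 2] (by simp) _ ?_))).trans_eq ?_
      all_goals first | (rw [ENNReal.ofReal_ofNat]; ring) | (simp; done) | (simp; ring)
  · intro i
    -- The embedding is applied to `σ ∂ᵢT`, which has the same decay weight as `T`. A bound of this
    -- product, after discarding the decay by `σ^β ≤ 1`, is a `σ^{-1}` bound of `∂ᵢT`.
    have hσ := contDiff_sigma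
    -- the weak derivatives of `σ ∂ᵢ T`
    let v : Fin 3 → E3 → ℝ := fun j x =>
      sigma x * weakD [j, i] (T a) x + pd j sigma x * weakD [i] (T a) x
    let w : Fin 3 → E3 → ℝ := fun j =>
      (fun x => sigma x * weakD [j, j, i] (T a) x + pd j sigma x * weakD [j, i] (T a) x) +
      fun x => pd j sigma x * weakD [j, i] (T a) x + pd j (pd j sigma) x * weakD [i] (T a) x
    have hv (j : Fin 3) : IsWeakPartial j (fun x => sigma x * weakD [i] (T a) x) (v j) :=
      (par [i] (by simp) j).smooth_mul hσ
    have hw (j : Fin 3) : IsWeakPartial j (v j) (w j) :=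
      ((par [j, i] (by simp) j).smooth_mul hσ).add
        ((par [i] (by simp) j).smooth_mul (contDiff_pd hσ j))
    have ae (s : List (Fin 3)) (hs : s.length ≤ 3) :
        AEStronglyMeasurable (weakD s (T a)) (volume : Measure E3) :=
      (loc s hs).aestronglyMeasurable
    have b0 (s : List (Fin 3)) (hs : s.length ≤ 3) (t : ℝ) (ht : t = s.length - β - 3 / 2 - 1) :
        wnorm t (fun x => sigma x * weakD s (T a) x) ≤ N := by
      have h3 := wnorm_mul_le (ψ := sigma) (u := weakD s (T a)) (v := weakD s (T a)) (s := t)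
        (m := -1) (c := 1) zero_le_one (ae s hs) fun x => by
          rw [abs_mul, abs_of_pos (sigma_pos x)]; simp
      rw [ENNReal.ofReal_one, one_mul] at h3
      exact h3.trans (nrm s hs _ (by rw [ht]; ring))
    have b1 (j : Fin 3) (s : List (Fin 3)) (hs : s.length ≤ 3) (t : ℝ)
        (ht : t = s.length - β - 3 / 2) :
        wnorm t (fun x => pd j sigma x * weakD s (T a) x) ≤ N := by
      have h3 := wnorm_mul_le (ψ := pd j sigma) (u := weakD s (T a)) (v := weakD s (T a)) (s := t)
        (m := 0) (c := 1) zero_le_one (ae s hs) fun x => by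
          rw [abs_mul]
          simpa using mul_le_mul_of_nonneg_right (abs_pd_sigma_le j x) (abs_nonneg _)
      rw [ENNReal.ofReal_one, one_mul] at h3
      exact h3.trans (nrm s hs _ (by rw [ht]; ring))
    have b2 (j : Fin 3) (s : List (Fin 3)) (hs : s.length ≤ 3) (t : ℝ)
        (ht : t = s.length - β - 3 / 2 + 1) :
        wnorm t (fun x => pd j (pd j sigma) x * weakD s (T a) x) ≤ 2 * N := by
      have h3 := wnorm_mul_le (ψ := pd j (pd j sigma)) (u := weakD s (T a)) (v := weakD s (T a))
        (s := t) (m := 1) (c := 2) zero_le_two (ae s hs) fun x => by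
          rw [abs_mul]
          exact mul_le_mul_of_nonneg_right (abs_pd_pd_sigma_le j j x) (abs_nonneg _)
      rw [ENNReal.ofReal_ofNat] at h3
      exact h3.trans (mul_le_mul_right (nrm s hs _ (by rw [ht]; ring)) _)
    have am {ψ : E3 → ℝ} (hψ : ContDiff ℝ ∞ ψ) (s : List (Fin 3)) (hs : s.length ≤ 3) :
        AEStronglyMeasurable (fun x => ψ x * weakD s (T a) x) (volume : Measure E3) :=
      hψ.continuous.aestronglyMeasurable.mul (ae s hs)
    have nv (j : Fin 3) : wnorm (-β - 1 / 2) (v j) ≤ 2 * N := by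
      refine (wnorm_add_le (am hσ _ (by simp)) (am (contDiff_pd hσ j) _ (by simp))).trans ?_
      rw [two_mul]
      exact add_le_add (b0 [j, i] (by simp) _ (by simp; ring))
        (b1 j [i] (by simp) _ (by simp; ring))
    have nw (j : Fin 3) : wnorm (1 / 2 - β) (w j) ≤ 5 * N := by
      have m1 := am hσ [j, j, i] (by simp)
      have m2 := am (contDiff_pd hσ j) [j, i] (by simp)
      have m3 := am (contDiff_pd (contDiff_pd hσ j) j) [i] (by simp)
      have d1 := b0 [j, j, i] (by simp) (1 / 2 - β) (by simp; ring)
      have d2 := b1 j [j, i] (by simp) (1 / 2 - β) (by simp; ring)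
      have d3 := b2 j [i] (by simp) (1 / 2 - β) (by simp; ring)
      refine (wnorm_add_le (m1.add m2) (m2.add m3)).trans ((add_le_add ((wnorm_add_le m1 m2).trans
        (add_le_add d1 d2)) ((wnorm_add_le m2 m3).trans (add_le_add d2 d3))).trans_eq ?_)
      ring
    have := k0 ⟨_, (hv 0).1⟩ (fun j => ⟨_, (hv j).2.1⟩) (fun j => ⟨_, (hw j).2.1⟩) hv hw
    filter_upwards [this] with x hx
    have hs := sigma_pos x
    have h5 := fin (c := 22) (by norm_num) ?_ hx
    · rw [abs_mul, abs_of_pos hs] at h5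
      change |weakD [i] (T a) x| ≤ _
      rw [Real.rpow_neg_one, ← div_eq_mul_inv, le_div_iff₀ hs, mul_comm]
      refine h5.trans ?_
      have : C * 22 ≤ C * 43 := by linarith
      gcongr
    · simp only [Fin.sum_univ_three]
      refine (add_le_add (add_le_add (b0 [i] (by simp) _ ?_) (add_le_add (add_le_add
        (nv 0) (nv 1)) (nv 2))) (add_le_add (add_le_add (nw 0) (nw 1)) (nw 2))).trans_eq ?_
      · simp; ring
      · rw [ENNReal.ofReal_ofNat]; ring

end Sobolev

/-! ### Pointwise comparison of the curved and the Euclidean operators. -/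

section Perturbation

theorem abs_mul_sub_mul_le {x y x' y' A B A' B' : ℝ} (hx : |x - x'| ≤ A') (hy : |y - y'| ≤ B')
    (hx' : |x'| ≤ A) (hyb : |y| ≤ B) : |x * y - x' * y'| ≤ A' * B + A * B' := by
  have h0 : x * y - x' * y' = (x - x') * y + x' * (y - y') := by ring
  have hA : 0 ≤ A' := (abs_nonneg _).trans hx
  have hA2 : 0 ≤ A := (abs_nonneg _).trans hx'
  rw [h0]
  refine (abs_add_le _ _).trans (add_le_add ?_ ?_) <;> rw [abs_mul] <;> gcongr

theorem abs_sum_sum_sub_le {f g : Fin 3 → Fin 3 → ℝ} {M : ℝ}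
    (h : ∀ i j, |f i j - g i j| ≤ M) : |∑ i, ∑ j, f i j - ∑ i, ∑ j, g i j| ≤ 9 * M := by
  rw [← Finset.sum_sub_distrib]
  refine (abs_sum_fin_three_le (M := 3 * M) fun i => ?_).trans_eq (by ring)
  rw [← Finset.sum_sub_distrib]
  exact abs_sum_fin_three_le (h i)

variable {h : TensorField 2} {J : TensorField 3} {x : E3} {θ D M N : ℝ}

/-- The Kronecker symbol. -/
def kron (a b : Fin 3) : ℝ := if a = b then 1 else 0

theorem abs_kron_le (a b : Fin 3) : |kron a b| ≤ 1 := by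
  unfold kron; split_ifs <;> simp

theorem metricOf_apply (a b : Fin 3) (x : E3) :
    metricOf h ![a, b] x = kron a b + h ![a, b] x := by
  simp [metricOf, kron]

theorem abs_det_metricMatrix_sub_le (hθ : θ ≤ 1 / 100) (hh : ∀ a b, |h ![a, b] x| ≤ θ) :
    |(metricMatrix (metricOf h) x).det - 1| ≤ 4 * θ := by
  have h0 : 0 ≤ θ := (abs_nonneg _).trans (hh 0 0)
  have h2 (a b c d) : |h ![a, b] x * h ![c, d] x| ≤ θ / 100 := by
    rw [abs_mul]
    calc _ ≤ θ * (1 / 100) := mul_le_mul (hh _ _) ((hh _ _).trans hθ) (abs_nonneg _) h0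
      _ = _ := by ring
  have h3 (a b c d e f) : |h ![a, b] x * h ![c, d] x * h ![e, f] x| ≤ θ / 100 := by
    rw [abs_mul]
    calc _ ≤ θ / 100 * 1 :=
          mul_le_mul (h2 _ _ _ _) ((hh _ _).trans (by linarith)) (abs_nonneg _) (by positivity)
      _ = _ := by ring
  have e1 : (metricMatrix (metricOf h) x).det - 1 =
      h ![0, 0] x + h ![1, 1] x + h ![2, 2] x + h ![0, 0] x * h ![1, 1] x
        + h ![0, 0] x * h ![2, 2] x + h ![1, 1] x * h ![2, 2] x - h ![0, 1] x * h ![1, 0] x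
        - h ![0, 2] x * h ![2, 0] x - h ![1, 2] x * h ![2, 1] x
        + h ![0, 0] x * h ![1, 1] x * h ![2, 2] x - h ![0, 0] x * h ![1, 2] x * h ![2, 1] x
        - h ![0, 1] x * h ![1, 0] x * h ![2, 2] x + h ![0, 1] x * h ![1, 2] x * h ![2, 0] x
        + h ![0, 2] x * h ![1, 0] x * h ![2, 1] x - h ![0, 2] x * h ![1, 1] x * h ![2, 0] x := by
    simp only [Matrix.det_fin_three, metricMatrix, Matrix.of_apply, metricOf_apply]
    simp [kron]
    ring
  have k1 := fun a b => abs_le.1 (hh a b)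
  have k2 := fun a b c d => abs_le.1 (h2 a b c d)
  have k3 := fun a b c d e f => abs_le.1 (h3 a b c d e f)
  rw [e1, abs_le]
  constructor <;>
  linarith [k1 0 0, k1 1 1, k1 2 2, k2 0 0 1 1, k2 0 0 2 2, k2 1 1 2 2, k2 0 1 1 0, k2 0 2 2 0,
    k2 1 2 2 1, k3 0 0 1 1 2 2, k3 0 0 1 2 2 1, k3 0 1 1 0 2 2, k3 0 1 1 2 2 0, k3 0 2 1 0 2 1,
    k3 0 2 1 1 2 0]

/-- From `A⁻¹ A = 1` and `A = 1 + h` one gets `A⁻¹ - 1 = -A⁻¹ h`. This bounds the deviation by `S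
θ`, where `S` is the absolute row sum of `A⁻¹`; the same identity gives `S ≤ 1 + 3 S θ`, hence `S ≤
2`. -/
theorem abs_invMetric_sub_le (hθ : θ ≤ 1 / 100) (hh : ∀ a b, |h ![a, b] x| ≤ θ) (a b : Fin 3) :
    |invMetric (metricOf h) a b x| ≤ 2 ∧ |invMetric (metricOf h) a b x - kron a b| ≤ 2 * θ := by
  have h0 : 0 ≤ θ := (abs_nonneg _).trans (hh 0 0)
  set A := metricMatrix (metricOf h) x with hA
  have hdet : IsUnit A.det := by
    rw [isUnit_iff_ne_zero]
    have := (abs_le.1 (abs_det_metricMatrix_sub_le hθ hh)).1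
    rw [← hA] at this
    exact (by linarith : 0 < A.det).ne'
  have hX (b : Fin 3) : A⁻¹ a b - kron a b = - ∑ c, A⁻¹ a c * h ![c, b] x := by
    have h1 : (A⁻¹ * A) a b = (1 : Matrix _ _ ℝ) a b := by rw [Matrix.nonsing_inv_mul _ hdet]
    rw [Matrix.mul_apply, Matrix.one_apply] at h1
    simp only [hA, metricMatrix, Matrix.of_apply, metricOf_apply] at h1
    simp only [mul_add, Finset.sum_add_distrib] at h1
    have h2 : ∑ c, A⁻¹ a c * kron c b = A⁻¹ a b := by simp [kron]
    change ∑ c, A⁻¹ a c * kron c b + ∑ c, A⁻¹ a c * h ![c, b] x = kron a b at h1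
    linarith
  set S := ∑ c, |A⁻¹ a c| with hS
  have hd (b : Fin 3) : |A⁻¹ a b - kron a b| ≤ S * θ := by
    rw [hX, abs_neg, hS, Finset.sum_mul]
    refine (Finset.abs_sum_le_sum_abs _ _).trans (Finset.sum_le_sum fun c _ => ?_)
    rw [abs_mul]
    gcongr
    exact hh c b
  have hS2 : S ≤ ∑ c, (|kron a c| + S * θ) := by
    refine Finset.sum_le_sum fun c _ => ?_
    have := abs_add_le (A⁻¹ a c - kron a c) (kron a c)
    rw [sub_add_cancel] at this
    linarith [hd c]
  have hk : ∑ c, |kron a c| = 1 := by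
    simp only [kron, apply_ite abs, abs_one, abs_zero]
    simp
  have hS0 : 0 ≤ S := Finset.sum_nonneg fun _ _ => abs_nonneg _
  rw [Finset.sum_add_distrib, hk, Finset.sum_const, Finset.card_univ, Fintype.card_fin] at hS2
  have hS3 : S * θ ≤ S * (1 / 100) := by gcongr
  have hS4 : S ≤ 2 := by
    simp only [nsmul_eq_mul] at hS2
    norm_num at hS2
    linarith
  refine ⟨(Finset.single_le_sum (f := fun c => |A⁻¹ a c|) (fun _ _ => abs_nonneg _)
    (Finset.mem_univ b)).trans hS4, (hd b).trans ?_⟩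
  gcongr

/-- The identity `(1/√d - 1)(√d + d) = 1 - d`, in which the second factor is at least one. -/
theorem abs_one_div_sqrt_sub_le {d : ℝ} (hd : 1 / 2 ≤ d) : |1 / √d - 1| ≤ |d - 1| := by
  have h1 : 0 < √d := Real.sqrt_pos.2 (by linarith)
  have h2 : √d * √d = d := Real.mul_self_sqrt (by linarith)
  have h3 : 1 / 2 ≤ √d := by
    refine Real.le_sqrt_of_sq_le ?_
    linarith
  have h4 : (1 / √d - 1) * (√d + d) = -(d - 1) := by
    rw [sub_mul, mul_add, one_div_mul_cancel h1.ne']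
    nth_rw 2 [← h2]
    field_simp; ring
  rw [← abs_neg (d - 1), ← h4, abs_mul]
  exact le_mul_of_one_le_right (abs_nonneg _) ((le_abs_self _).trans' (by linarith))

theorem abs_volUp_sub_le (hθ : θ ≤ 1 / 100) (hh : ∀ a b, |h ![a, b] x| ≤ θ) (a b c : Fin 3) :
    |volUp (metricOf h) a b c x - permSign a b c| ≤ 4 * θ := by
  have h1 := abs_det_metricMatrix_sub_le hθ hh
  have h2 := abs_one_div_sqrt_sub_le (d := (metricMatrix (metricOf h) x).det)
    (by linarith [(abs_le.1 h1).1])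
  have h3 : volUp (metricOf h) a b c x - permSign a b c =
      permSign a b c * (1 / √(metricMatrix (metricOf h) x).det - 1) := by
    rw [volUp]; ring
  rw [h3, abs_mul]
  calc _ ≤ 1 * (4 * θ) :=
        mul_le_mul (abs_permSign_le a b c) (h2.trans h1) (abs_nonneg _) zero_le_one
    _ = _ := one_mul _

theorem abs_christoffel_le (hθ : θ ≤ 1 / 100) (hh : ∀ a b, |h ![a, b] x| ≤ θ)
    (hD : ∀ e a b, |weakPartial e (metricOf h ![a, b]) x| ≤ D) (c a b : Fin 3) :
    |christoffel (metricOf h) c a b x| ≤ 9 * D := by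
  rw [christoffel, abs_mul, abs_of_pos (by norm_num : (0 : ℝ) < 1 / 2)]
  have : |∑ d, invMetric (metricOf h) c d x * (weakPartial a (metricOf h ![b, d]) x +
      weakPartial b (metricOf h ![a, d]) x - weakPartial d (metricOf h ![a, b]) x)| ≤
      3 * (2 * (3 * D)) := by
    refine abs_sum_fin_three_le fun d => ?_
    rw [abs_mul]
    refine mul_le_mul (abs_invMetric_sub_le hθ hh c d).1 ?_ (abs_nonneg _) zero_le_two
    have h1 := abs_le.1 (hD a b d)
    have h2 := abs_le.1 (hD b a d)
    have h3 := abs_le.1 (hD d a b)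
    rw [abs_le]
    constructor <;> linarith
  linarith

variable (hθ : θ ≤ 1 / 100) (hh : ∀ a b, |h ![a, b] x| ≤ θ)
  (hD : ∀ e a b, |weakPartial e (metricOf h ![a, b]) x| ≤ D) (hM : ∀ a b c, |J ![a, b, c] x| ≤ M)
  (hN : ∀ e a b c, |weakPartial e (J ![a, b, c]) x| ≤ N)
include hθ hh hD hM

theorem abs_covDeriv_sub_le (e a b c : Fin 3) :
    |covDeriv (metricOf h) J e a b c x - weakPartial e (J ![a, b, c]) x| ≤ 81 * (D * M) := by
  have hD0 : 0 ≤ D := (abs_nonneg _).trans (hD 0 0 0)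
  have hG := abs_christoffel_le hθ hh hD
  have key (Γ j : Fin 3 → ℝ) (h1 : ∀ s, |Γ s| ≤ 9 * D) (h2 : ∀ s, |j s| ≤ M) :
      |∑ s, Γ s * j s| ≤ 3 * (9 * D * M) := by
    refine abs_sum_fin_three_le fun s => ?_
    rw [abs_mul]
    exact mul_le_mul (h1 s) (h2 s) (abs_nonneg _) (by positivity)
  have k1 := abs_le.1 (key (fun s => christoffel (metricOf h) s e a x) (fun s => J ![s, b, c] x)
    (fun _ => hG _ _ _) fun _ => hM _ _ _)
  have k2 := abs_le.1 (key (fun s => christoffel (metricOf h) s e b x) (fun s => J ![a, s, c] x)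
    (fun _ => hG _ _ _) fun _ => hM _ _ _)
  have k3 := abs_le.1 (key (fun s => christoffel (metricOf h) s e c x) (fun s => J ![a, b, s] x)
    (fun _ => hG _ _ _) fun _ => hM _ _ _)
  rw [covDeriv, abs_le]
  constructor <;> linarith

include hN

theorem abs_midDiv_sub_le (a c : Fin 3) :
    |midDiv (metricOf h) J a c x - flatMid (fun e a b c => weakPartial e (J ![a, b, c]) x) a c| ≤
      1458 * (θ * N + D * M) := by
  have h0 : 0 ≤ θ := (abs_nonneg _).trans (hh 0 0)
  have hN0 : 0 ≤ N := (abs_nonneg _).trans (hN 0 0 0 0)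
  have e1 : flatMid (fun e a b c => weakPartial e (J ![a, b, c]) x) a c =
      ∑ b, ∑ d, weakPartial d (J ![a, b, c]) x * kron b d := by
    simp [flatMid, kron]
  rw [midDiv, e1]
  refine (abs_sum_sum_sub_le (M := 81 * (D * M) * 2 + N * (2 * θ)) fun b d => ?_).trans ?_
  · rw [mul_comm (invMetric _ _ _ _)]
    exact abs_mul_sub_mul_le (abs_covDeriv_sub_le hθ hh hD hM d a b c)
      (abs_invMetric_sub_le hθ hh b d).2 (hN _ _ _ _) (abs_invMetric_sub_le hθ hh b d).1
  · nlinarith [mul_nonneg h0 hN0]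

/-- Every term of the difference pairs either a deviation of the metric from `δ` with `∂J`, or a
Christoffel symbol with `J`; these are the products `θ N` and `D M`. The constant is generous and
shared with `abs_Qop_sub_le`. -/
theorem abs_Dstar_sub_le (a c : Fin 3) :
    |Dstar (metricOf h) J a c x - flatD (fun e a b c => weakPartial e (J ![a, b, c]) x) a c| ≤
      50000 * (θ * N + D * M) := by
  set G := fun e a b c => weakPartial e (J ![a, b, c]) x with hG
  have h0 : 0 ≤ θ := (abs_nonneg _).trans (hh 0 0)
  have hN0 : 0 ≤ N := (abs_nonneg _).trans (hN 0 0 0 0)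
  have hm := abs_midDiv_sub_le hθ hh hD hM hN
  have hf (a c : Fin 3) : |flatMid G a c| ≤ 3 * N := abs_sum_fin_three_le fun b => hN _ _ _ _
  have ht : |∑ u, ∑ v, midDiv (metricOf h) J u v x * invMetric (metricOf h) u v x -
      ∑ u, flatMid G u u| ≤ 9 * (1458 * (θ * N + D * M) * 2 + 3 * N * (2 * θ)) := by
    have e1 : ∑ u, flatMid G u u = ∑ u, ∑ v, flatMid G u v * kron u v := by simp [kron]
    rw [e1]
    exact abs_sum_sum_sub_le fun u v => abs_mul_sub_mul_le (hm u v)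
      (abs_invMetric_sub_le hθ hh u v).2 (hf u v) (abs_invMetric_sub_le hθ hh u v).1
  have hg : |metricOf h ![a, c] x - kron a c| ≤ θ := by
    rw [metricOf_apply, add_sub_cancel_left]; exact hh a c
  have hg2 : |metricOf h ![a, c] x| ≤ 101 / 100 := by
    have := abs_add_le (metricOf h ![a, c] x - kron a c) (kron a c)
    rw [sub_add_cancel] at this
    linarith [abs_kron_le a c]
  have hprod := abs_mul_sub_mul_le ht hg (abs_sum_fin_three_le fun u => hf u u) hg2
  have e2 : flatD G a c = flatMid G a c + flatMid G c a -
      2 / 3 * ((∑ u, flatMid G u u) * kron a c) := by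
    simp [flatD, kron]
  have e3 : Dstar (metricOf h) J a c x = midDiv (metricOf h) J a c x + midDiv (metricOf h) J c a x -
      2 / 3 * ((∑ u, ∑ v, midDiv (metricOf h) J u v x * invMetric (metricOf h) u v x) *
        metricOf h ![a, c] x) := by
    rw [Dstar]; ring
  have k1 := abs_le.1 (hm a c)
  have k2 := abs_le.1 (hm c a)
  have k3 := abs_le.1 hprod
  have hW : 0 ≤ θ * N := mul_nonneg h0 hN0
  have hW2 : 0 ≤ D * M :=
    mul_nonneg ((abs_nonneg _).trans (hD 0 0 0)) ((abs_nonneg _).trans (hM 0 0 0))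
  rw [e2, e3, abs_le]
  constructor <;> nlinarith

theorem abs_Qop_sub_le (a : Fin 3) :
    |Qop (metricOf h) J a x - flatQ (fun e a b c => weakPartial e (J ![a, b, c]) x) a| ≤
      50000 * (θ * N + D * M) := by
  have h0 : 0 ≤ θ := (abs_nonneg _).trans (hh 0 0)
  have hN0 : 0 ≤ N := (abs_nonneg _).trans (hN 0 0 0 0)
  have hW : 0 ≤ θ * N := mul_nonneg h0 hN0
  have hW2 : 0 ≤ D * M :=
    mul_nonneg ((abs_nonneg _).trans (hD 0 0 0)) ((abs_nonneg _).trans (hM 0 0 0))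
  rw [Qop, flatQ, ← Finset.sum_sub_distrib]
  have key (e b c : Fin 3) : |volUp (metricOf h) e b c x * covDeriv (metricOf h) J e a b c x -
      permSign e b c * weakPartial e (J ![a, b, c]) x| ≤ 81 * (D * M) * 2 + N * (4 * θ) := by
    have hv := abs_volUp_sub_le hθ hh e b c
    rw [mul_comm (volUp _ _ _ _ _), mul_comm (permSign _ _ _)]
    refine abs_mul_sub_mul_le (abs_covDeriv_sub_le hθ hh hD hM e a b c) hv (hN _ _ _ _) ?_
    have := abs_add_le (volUp (metricOf h) e b c x - permSign e b c) (permSign e b c)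
    rw [sub_add_cancel] at this
    linarith [abs_permSign_le e b c]
  refine (abs_sum_fin_three_le (M := 9 * (81 * (D * M) * 2 + N * (4 * θ)))
    fun e => abs_sum_sum_sub_le (key e)).trans ?_
  nlinarith

end Perturbation

/-! ### Vanishing integrals of weak derivatives. -/

section DivergenceTheorem

open Filter Topology

theorem memLp_sigma_rpow {s : ℝ} (hs : 3 / 2 < s) :
    MemLp (fun x : E3 => sigma x ^ (-s)) 2 volume := by
  have hc : Continuous fun x : E3 => sigma x ^ (-s) := continuous_sigma_rpow _
  refine (memLp_two_iff_integrable_sq hc.aestronglyMeasurable).2 ?_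
  have h := integrable_rpow_neg_one_add_norm_sq (E := E3) (r := 2 * s) (μ := volume)
    (by rw [finrank_euclideanSpace_fin]; push_cast; linarith)
  refine h.congr (Eventually.of_forall fun x => ?_)
  change (1 + ‖x‖ ^ 2) ^ (-(2 * s) / 2) = (sigma x ^ (-s)) ^ 2
  rw [← sigma_sq, ← Real.rpow_natCast (sigma x), ← Real.rpow_natCast (sigma x ^ (-s)),
    ← Real.rpow_mul (sigma_pos x).le, ← Real.rpow_mul (sigma_pos x).le]
  congr 1
  push_cast
  ring

/-- Cauchy-Schwarz against `σ^{-s}`, which is square integrable in dimension three because `2s > 3`.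
-/
theorem integrable_of_wnorm {s : ℝ} (hs : 3 / 2 < s) {f : E3 → ℝ}
    (hf : AEStronglyMeasurable f volume) (h : wnorm s f ≠ ⊤) : Integrable f := by
  have h1 : MemLp (fun x => sigma x ^ s * f x) 2 volume :=
    ⟨(continuous_sigma_rpow s).aestronglyMeasurable.mul hf, h.lt_top⟩
  refine ((memLp_sigma_rpow hs).integrable_mul h1).congr (Eventually.of_forall fun x => ?_)
  have hp := sigma_pos x
  change sigma x ^ (-s) * (sigma x ^ s * f x) = f x
  rw [← mul_assoc, ← Real.rpow_add hp, neg_add_cancel, Real.rpow_zero, one_mul]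

/-- The integral of a derivative vanishes, under the natural integrability assumptions. -/
theorem IsWeakPartial.integral_eq_zero {i : Fin 3} {u v : E3 → ℝ} (h : IsWeakPartial i u v)
    (hu : Integrable fun x => sigma x ^ (-1 : ℝ) * u x) (hv : Integrable v) : ∫ x, v x = 0 := by
  -- The cutoffs serve as test functions. Their gradients are at most `C σ^{-1}` and vanish
  -- eventually at each point, so that side tends to zero by dominated convergence.
  obtain ⟨C, hC, k1⟩ := abs_testD_chi_le
  have hev (x : E3) : ∀ᶠ n : ℕ in atTop, ‖x‖ < n + 1 := by
    filter_upwards [eventually_ge_atTop ⌈‖x‖⌉₊] with n hn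
    have := Nat.ceil_le.1 hn
    linarith
  have l1 : Tendsto (fun n => ∫ x, v x * (chi n).1 x) atTop (𝓝 (∫ x, v x)) := by
    refine tendsto_integral_of_dominated_convergence (fun x => |v x|) (fun n =>
      hv.aestronglyMeasurable.mul (chi n).2.1.continuous.aestronglyMeasurable) hv.abs
      (fun n => Eventually.of_forall fun x => ?_) (Eventually.of_forall fun x => ?_)
    · rw [Real.norm_eq_abs, abs_mul]
      exact mul_le_of_le_one_right (abs_nonneg _) (abs_chi_le n x)
    · refine tendsto_const_nhds.congr' ?_
      filter_upwards [hev x] with n hn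
      rw [chi_eq_one hn.le, mul_one]
  have l2 : Tendsto (fun n => ∫ x, u x * (testD i (chi n)).1 x) atTop (𝓝 (∫ _ : E3, (0 : ℝ))) := by
    refine tendsto_integral_of_dominated_convergence (fun x => C * |sigma x ^ (-1 : ℝ) * u x|)
      (fun n => h.1.aestronglyMeasurable.mul
        (testD i (chi n)).2.1.continuous.aestronglyMeasurable) (hu.abs.const_mul C)
      (fun n => Eventually.of_forall fun x => ?_) (Eventually.of_forall fun x => ?_)
    · have hs := sigma_pos x
      rw [Real.norm_eq_abs, abs_mul, abs_mul, abs_of_pos (Real.rpow_pos_of_pos hs _), mul_comm,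
        ← mul_assoc]
      exact mul_le_mul_of_nonneg_right (k1 i n x) (abs_nonneg _)
    · refine tendsto_const_nhds.congr' ?_
      filter_upwards [hev x] with n hn
      rw [testD_chi_eq_zero hn, mul_zero]
  have e (n : ℕ) : ∫ x, u x * (testD i (chi n)).1 x = - ∫ x, v x * (chi n).1 x :=
    h.2.2 _ (chi n).2.1 (chi n).2.2
  simp only [e, integral_zero] at l2
  exact neg_eq_zero.1 (tendsto_nhds_unique l1.neg l2)

theorem flatP_zero (i : IP) : flatP (fun _ _ _ _ => (0 : ℝ)) i = 0 := by
  have := abs_flatP_le (fun _ _ _ _ => (0 : ℝ)) (M := 0) (fun _ _ _ _ => by simp) i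
  simpa using this

/-- The flat operators are total divergences. -/
theorem integral_flatP_eq_zero {G : Fin 3 → Fin 3 → Fin 3 → Fin 3 → E3 → ℝ}
    (hG : ∀ e a b c, Integrable (G e a b c)) (h0 : ∀ e a b c, ∫ x, G e a b c x = 0) (i : IP) :
    Integrable (fun x => flatP (fun e a b c => G e a b c x) i) ∧
      ∫ x, flatP (fun e a b c => G e a b c x) i = 0 := by
  -- Integration is linear on integrable functions, so it commutes with the constant-coefficient
  -- combination `flatP` and sends it to the same combination of zeros.
  let S : Submodule ℝ (E3 → ℝ) :=
    { carrier := {f | Integrable f volume}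
      add_mem' := fun hf hg => Integrable.add hf hg
      zero_mem' := integrable_zero _ _ _
      smul_mem' := fun c _ hf => Integrable.smul c hf }
  let L : S →ₗ[ℝ] ℝ :=
    { toFun := fun f => ∫ x, f.1 x
      map_add' := fun f g => integral_add f.2 g.2
      map_smul' := fun c f => integral_const_mul c _ }
  let G' : Fin 3 → Fin 3 → Fin 3 → Fin 3 → S := fun e a b c => ⟨G e a b c, hG e a b c⟩
  have e1 : (fun x => flatP (fun e a b c => G e a b c x) i) = (flatP G' i).1 := by
    funext x
    exact (flatP_map ((LinearMap.proj x).comp S.subtype) G' i).symm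
  rw [e1]
  refine ⟨(flatP G' i).2, ?_⟩
  have e2 := flatP_map L G' i
  have e3 (e a b c) : L (G' e a b c) = 0 := h0 e a b c
  simp only [e3, flatP_zero] at e2
  exact e2

end DivergenceTheorem

/-! ### Smallness of the difference of the two operators. -/

section Transversality

open Filter Topology

/-- The components of `𝒫_g(J)`. -/
noncomputable def auxComp (g : TensorField 2) (J : TensorField 3) (i : IP) (x : E3) : ℝ :=
  Sum.elim (fun p : Fin 3 × Fin 3 => Dstar g J p.1 p.2 x) (fun a => Qop g J a x) i

/-- The components of the Euclidean `𝒫(J)`. -/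
noncomputable def flatComp (J : TensorField 3) (i : IP) (x : E3) : ℝ :=
  flatP (fun e a b c => weakPartial e (J ![a, b, c]) x) i

/-- The weighted first-order norm of `J`. -/
noncomputable def firstNorm (τ : ℝ) (J : TensorField 3) : ENNReal :=
  ∑ j : I4, wnorm τ (weakPartial j.1 (J ![j.2.1, j.2.2.1, j.2.2.2])) +
    ∑ j : I3, wnorm (τ - 1) (J ![j.1, j.2.1, j.2.2])

theorem weakPartial_metricOf {h : TensorField 2} {e a b : Fin 3} {v : E3 → ℝ}
    (hv : IsWeakPartial e (h ![a, b]) v) :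
    weakPartial e (metricOf h ![a, b]) =ᵐ[volume] v := by
  have h1 := (isWeakPartial_const e (kron a b)).add hv
  rw [zero_add] at h1
  have e1 : metricOf h ![a, b] = (fun _ => kron a b) + h ![a, b] := by
    funext x; rw [metricOf_apply]; rfl
  rw [e1]
  exact weakPartial_ae_eq h1

/-- The difference is bounded by `θ N + D M`. For the weighted norm, `θ` and `σ D` are taken in sup
norm, and the factor `σ^{-1}` in the bound of `D` matches the weight `τ - 1` of `J`. For the `L¹`
norm, `h` and `∂h` are taken in `L²` with weights `-τ` and `1 - τ`. These are the weights of
`H^{k,β}` exactly because `τ = 3/2 + β`, and they are dual to the weights of `∂J` and `J`. -/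
theorem perturbation_le {β : ℝ} (h1 : -1 < β) (h2 : β < 0) :
    ∃ C : ℝ, 0 < C ∧ ∀ (k : ℕ) (_ : 3 ≤ k) (h : TensorField 2) (J : TensorField 3) (ε : ℝ)
      (_ : 0 ≤ ε) (_ : C * ε ≤ 1) (_ : MemSobolev k β h) (_ : sobolevNorm k β h ≤ ENNReal.ofReal ε)
      (_ : ∀ a b c, AEStronglyMeasurable (J ![a, b, c]) volume)
      (_ : ∀ e a b c, AEStronglyMeasurable (weakPartial e (J ![a, b, c])) volume) (i : IP),
      wnorm (3 / 2 + β) (auxComp (metricOf h) J i - flatComp J i) ≤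
        ENNReal.ofReal (C * ε) * firstNorm (3 / 2 + β) J ∧
      eLpNorm (auxComp (metricOf h) J i - flatComp J i) 1 volume ≤
        ENNReal.ofReal (C * ε) * firstNorm (3 / 2 + β) J := by
  obtain ⟨C0, hC0, k0⟩ := ae_abs_le_of_sobolev h1 h2
  refine ⟨50000 * 36 + 50000 * 27 * C0, by positivity,
    fun k hk h J ε hε hCε hh hN mJ mG i => ?_⟩
  -- This follows from `C ε ≤ 1` and ensures `θ ≤ 9 C0 ε ≤ 1/100`, the smallness required by the
  -- pointwise comparison.
  have hC1 : C0 * ε * 900 ≤ 1 := by nlinarith [mul_nonneg hC0.le hε]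
  set τ := 3 / 2 + β with hτ
  let θ : E3 → ℝ := fun x => ∑ p : Fin 3 × Fin 3, |h ![p.1, p.2] x|
  let D : E3 → ℝ := fun x => ∑ p : I3, |weakPartial p.1 (h ![p.2.1, p.2.2]) x|
  let N : E3 → ℝ := fun x => ∑ j : I4, |weakPartial j.1 (J ![j.2.1, j.2.2.1, j.2.2.2]) x|
  let M : E3 → ℝ := fun x => ∑ j : I3, |J ![j.1, j.2.1, j.2.2] x|
  have θ0 (x : E3) : 0 ≤ θ x := Finset.sum_nonneg fun _ _ => abs_nonneg _
  have D0 (x : E3) : 0 ≤ D x := Finset.sum_nonneg fun _ _ => abs_nonneg _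
  have N0 (x : E3) : 0 ≤ N x := Finset.sum_nonneg fun _ _ => abs_nonneg _
  have M0 (x : E3) : 0 ≤ M x := Finset.sum_nonneg fun _ _ => abs_nonneg _
  have hθ : ∀ᵐ x, θ x ≤ 9 * (C0 * ε) := by
    have := fun a => (k0 k hk 2 h hh ε hε hN a).1
    filter_upwards [ae_all_iff.2 this] with x hx
    refine (Finset.sum_le_sum fun p _ => hx _).trans_eq ?_
    simp
  have hD : ∀ᵐ x, D x ≤ 27 * (C0 * ε * sigma x ^ (-1 : ℝ)) := by
    have := fun a i => (k0 k hk 2 h hh ε hε hN a).2 i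
    filter_upwards [ae_all_iff.2 fun a => ae_all_iff.2 (this a)] with x hx
    refine (Finset.sum_le_sum fun p _ => hx _ _).trans_eq ?_
    simp
  have hw : ∀ᵐ x, ∀ e a b, weakPartial e (metricOf h ![a, b]) x = weakPartial e (h ![a, b]) x := by
    simp only [ae_all_iff]
    exact fun e a b => weakPartial_metricOf (hh.isWeakPartial ![a, b] (s := []) (by simp; omega) e)
  have hR : ∀ᵐ x, |(auxComp (metricOf h) J i - flatComp J i) x| ≤
      50000 * (θ x * N x + D x * M x) := by
    filter_upwards [hθ, hw] with x hx hwx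
    have t1 : θ x ≤ 1 / 100 := by linarith
    have t2 (a b) : |h ![a, b] x| ≤ θ x :=
      Finset.single_le_sum (f := fun p : Fin 3 × Fin 3 => |h ![p.1, p.2] x|)
        (fun _ _ => abs_nonneg _) (Finset.mem_univ (a, b))
    have t3 (e a b) : |weakPartial e (metricOf h ![a, b]) x| ≤ D x := by
      rw [hwx]
      exact abs_le_sum_I3 (fun e a b => weakPartial e (h ![a, b]) x) e a b
    have t4 := abs_le_sum_I3 fun a b c => J ![a, b, c] x
    have t5 := abs_le_sum_I4 fun e a b c => weakPartial e (J ![a, b, c]) x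
    rcases i with p | a
    · exact abs_Dstar_sub_le t1 t2 t3 t4 t5 p.1 p.2
    · exact abs_Qop_sub_le t1 t2 t3 t4 t5 a
  let t : I4 ⊕ I3 → ℝ := Sum.elim (fun _ => τ) fun _ => τ - 1
  let H : I4 ⊕ I3 → E3 → ℝ := Sum.elim
    (fun j => weakPartial j.1 (J ![j.2.1, j.2.2.1, j.2.2.2])) fun j => J ![j.1, j.2.1, j.2.2]
  have mH (j) : AEStronglyMeasurable (H j) volume := by
    rcases j with j | j
    · exact mG _ _ _ _
    · exact mJ _ _ _
  have sH (x : E3) : ∑ j, sigma x ^ t j * |H j x| = sigma x ^ τ * N x + sigma x ^ (τ - 1) * M x := by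
    rw [Fintype.sum_sum_type, Finset.mul_sum, Finset.mul_sum]; rfl
  have nH : ∑ j, wnorm (t j) (H j) = firstNorm τ J := by
    rw [Fintype.sum_sum_type]; rfl
  constructor
  · have key : wnorm τ (auxComp (metricOf h) J i - flatComp J i) ≤
        ENNReal.ofReal (50000 * (27 * (C0 * ε))) * ∑ j, wnorm (t j) (H j) := by
      refine wnorm_le_sum (by positivity) mH ?_
      filter_upwards [hθ, hD, hR] with x x1 x2 x3
      rw [sH]
      have hs := Real.rpow_pos_of_pos (sigma_pos x) τ
      have e1 : sigma x ^ (τ - 1) = sigma x ^ τ * sigma x ^ (-1 : ℝ) := by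
        rw [← Real.rpow_add (sigma_pos x), sub_eq_add_neg]
      have e2 : θ x ≤ 27 * (C0 * ε) := x1.trans (by nlinarith [mul_nonneg hC0.le hε])
      calc _ ≤ sigma x ^ τ * (50000 * (27 * (C0 * ε) * N x +
            27 * (C0 * ε * sigma x ^ (-1 : ℝ)) * M x)) := by
              refine mul_le_mul_of_nonneg_left (x3.trans ?_) hs.le
              have := mul_le_mul_of_nonneg_right e2 (N0 x)
              have := mul_le_mul_of_nonneg_right x2 (M0 x)
              linarith
        _ = _ := by rw [e1]; ring
    rw [nH] at key
    refine key.trans (mul_le_mul_left (ENNReal.ofReal_le_ofReal ?_) _)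
    nlinarith [mul_nonneg hC0.le hε]
  · let t' : Fin 3 × Fin 3 ⊕ I3 → ℝ := Sum.elim (fun _ => -τ) fun _ => 1 - τ
    let H' : Fin 3 × Fin 3 ⊕ I3 → E3 → ℝ := Sum.elim
      (fun p => h ![p.1, p.2]) fun p => weakPartial p.1 (h ![p.2.1, p.2.2])
    have mH' (j) : AEStronglyMeasurable (H' j) volume := by
      rcases j with j | j
      · exact (hh.1 _).aestronglyMeasurable
      · exact (hh.locallyIntegrable ![j.2.1, j.2.2] [j.1] (by simp; omega)).aestronglyMeasurable
    let F : E3 → ℝ := fun x => ∑ j, |sigma x ^ t' j * H' j x|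
    let K : E3 → ℝ := fun x => 50000 * ∑ j, |sigma x ^ t j * H j x|
    have habs (s : ℝ) (x : E3) (y : ℝ) : |sigma x ^ s * y| = sigma x ^ s * |y| := by
      rw [abs_mul, abs_of_pos (Real.rpow_pos_of_pos (sigma_pos x) s)]
    have eF (x : E3) : F x = sigma x ^ (-τ) * θ x + sigma x ^ (1 - τ) * D x := by
      simp only [F, habs, Fintype.sum_sum_type]
      rw [Finset.mul_sum, Finset.mul_sum]; rfl
    have eK (x : E3) : K x = 50000 * (sigma x ^ τ * N x + sigma x ^ (τ - 1) * M x) := by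
      simp only [K, habs, sH]
    have mm (s : ℝ) {f : E3 → ℝ} (hf : AEStronglyMeasurable f volume) :
        AEStronglyMeasurable (fun x => sigma x ^ s * f x) volume :=
      (continuous_sigma_rpow _).aestronglyMeasurable.mul hf
    have mF : AEStronglyMeasurable F volume :=
      Finset.aestronglyMeasurable_fun_sum _ fun j _ => (mm _ (mH' j)).norm
    have mK : AEStronglyMeasurable K volume :=
      (Finset.aestronglyMeasurable_fun_sum _ fun j _ => (mm _ (mH j)).norm).const_mul _
    have nF : eLpNorm F 2 volume ≤ ENNReal.ofReal (36 * ε) := by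
      refine (eLpNorm_le_sum_of_abs_le (g := fun j x => sigma x ^ t' j * H' j x) zero_le_one
        (fun j => mm _ (mH' j)) (Eventually.of_forall fun x => ?_)).trans ?_
      · rw [one_mul, abs_of_nonneg (Finset.sum_nonneg fun _ _ => abs_nonneg _)]
      · rw [ENNReal.ofReal_one, one_mul, ENNReal.ofReal_mul (by norm_num), ENNReal.ofReal_ofNat]
        have hj (j) : wnorm (t' j) (H' j) ≤ ENNReal.ofReal ε := by
          refine le_trans ?_ hN
          rcases j with j | j
          · have := wnorm_weakD_le (β := β) (k := k) h ![j.1, j.2] [] (by simp)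
            rwa [show (([] : List (Fin 3)).length : ℝ) - β - 3 / 2 = -τ by simp [hτ]; ring] at this
          · have := wnorm_weakD_le (β := β) (k := k) h ![j.2.1, j.2.2] [j.1] (by simp; omega)
            rwa [show (([j.1] : List (Fin 3)).length : ℝ) - β - 3 / 2 = 1 - τ by
              simp [hτ]; ring] at this
        refine (Finset.sum_le_sum fun j _ => hj j).trans_eq ?_
        simp
    have nK : eLpNorm K 2 volume ≤ ENNReal.ofReal 50000 * firstNorm τ J := by
      rw [← nH]
      refine eLpNorm_le_sum_of_abs_le (g := fun j x => sigma x ^ t j * H j x) (by norm_num)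
        (fun j => mm _ (mH j)) (Eventually.of_forall fun x => ?_)
      rw [abs_of_nonneg (mul_nonneg (by norm_num) (Finset.sum_nonneg fun _ _ => abs_nonneg _))]
    have le1 : eLpNorm (auxComp (metricOf h) J i - flatComp J i) 1 volume ≤
        eLpNorm (F • K) 1 volume := by
      refine eLpNorm_mono_ae ?_
      filter_upwards [hR] with x hx
      refine hx.trans ((le_abs_self _).trans' ?_)
      change _ ≤ F x * K x
      rw [eF, eK]
      have hs := sigma_pos x
      have e1 : sigma x ^ (-τ) * sigma x ^ τ = 1 := by
        rw [← Real.rpow_add hs, neg_add_cancel, Real.rpow_zero]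
      have e2 : sigma x ^ (1 - τ) * sigma x ^ (τ - 1) = 1 := by
        rw [← Real.rpow_add hs]; simp
      -- The product `F K` contains the two wanted terms, whose weights cancel, and two nonnegative
      -- cross terms, which are dropped.
      have p1 : 0 ≤ sigma x ^ (-τ) * θ x * (sigma x ^ (τ - 1) * M x) := by
        have := θ0 x; have := M0 x; positivity
      have p2 : 0 ≤ sigma x ^ (1 - τ) * D x * (sigma x ^ τ * N x) := by
        have := D0 x; have := N0 x; positivity
      calc 50000 * (θ x * N x + D x * M x) = 50000 * ((sigma x ^ (-τ) * sigma x ^ τ) * (θ x * N x) +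
            (sigma x ^ (1 - τ) * sigma x ^ (τ - 1)) * (D x * M x)) := by rw [e1, e2]; ring
        _ ≤ _ := by linarith
    refine (le1.trans (eLpNorm_smul_le_mul_eLpNorm (p := 2) (q := 2) mK mF)).trans ?_
    refine (mul_le_mul' nF nK).trans ?_
    rw [← mul_assoc, ← ENNReal.ofReal_mul (by positivity)]
    refine mul_le_mul_left (ENNReal.ofReal_le_ofReal ?_) _
    nlinarith [mul_nonneg hC0.le hε]

end Transversality

/-! ### Vanishing of the coefficients and the two statements. -/

section MainArgument

open Filter Topology

variable {k : ℕ} {β : ℝ}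

/-- `weakPartial` is a choice among almost-everywhere equal functions, so even the derivatives of
zero are known only off a null set. -/
theorem weakD_zero_ae_eq (s : List (Fin 3)) : weakD s (0 : E3 → ℝ) =ᵐ[volume] 0 := by
  induction s with
  | nil => rfl
  | cons i s ih => exact weakPartial_ae_eq ((isWeakPartial_const i 0).congr ih.symm .rfl)

theorem memSobolev_zero (n : ℕ) : MemSobolev k β (0 : TensorField n) := by
  refine ⟨fun _ => locallyIntegrable_zero, fun a s _ i => ⟨0, (isWeakPartial_const i 0).congr
    (weakD_zero_ae_eq s).symm .rfl⟩, ?_⟩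
  have : sobolevNorm k β (0 : TensorField n) = 0 := by
    rw [sobolevNorm, Finset.sum_eq_zero, ENNReal.zero_rpow_of_pos (by norm_num)]
    refine fun l _ => Finset.sum_eq_zero fun a _ => Finset.sum_eq_zero fun s _ => ?_
    refine (lintegral_congr_ae ?_).trans lintegral_zero
    filter_upwards [weakD_zero_ae_eq (List.ofFn s)] with x hx
    change ENNReal.ofReal (weakD (List.ofFn s) 0 x ^ 2 * _) = 0
    simp [hx]
  simp [this]

theorem zero_mem_auxImage (g : TensorField 2) : (0 : PairField) ∈ auxImage k β g := by
  refine ⟨0, memSobolev_zero 3, fun a b c => by simp, AEEqFun.coeFn_zero.trans ?_⟩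
  have h : ∀ᵐ x, ∀ e : Fin 3, weakPartial e (0 : E3 → ℝ) x = 0 :=
    ae_all_iff.2 fun e => weakD_zero_ae_eq [e]
  filter_upwards [h] with x hx
  have hc (e a b c : Fin 3) : covDeriv g 0 e a b c x = 0 := by
    change weakPartial e 0 x - _ - _ - _ = 0
    simp [hx]
  have hm (a c : Fin 3) : midDiv g 0 a c x = 0 := by simp [midDiv, hc]
  simp only [auxOp, Dstar, Qop, hm, hc]
  simp
  rfl

theorem zero_mem_errorSpace (η : E3 → ℝ) : (0 : PairField) ∈ errorSpace η := by
  refine ⟨0, 0, AEEqFun.coeFn_zero.trans (Eventually.of_forall fun x => ?_)⟩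
  simp
  rfl

/-- Membership in `H^{k,β-2}` gives the weights `3/2 - β` for `∂J` and `1/2 - β` for `J`. They
exceed `3/2 + β` and `1/2 + β` since `β < 0`, and `σ ≥ 1`. -/
theorem firstNorm_ne_top {J : TensorField 3} (hβ : β < 0) (hk : 1 ≤ k)
    (hJ : MemSobolev k (β - 2) J) :
    firstNorm (3 / 2 + β) J ≠ ⊤ := by
  have hN := hJ.2.2
  refine ENNReal.add_ne_top.2 ⟨ENNReal.sum_ne_top.2 fun j _ => ?_,
    ENNReal.sum_ne_top.2 fun j _ => ?_⟩
  · refine (((wnorm_mono_exponent ?_ _).trans (wnorm_weakD_le J ![j.2.1, j.2.2.1, j.2.2.2] [j.1]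
      (by simpa using hk))).trans_lt hN).ne
    simp; linarith
  · refine (((wnorm_mono_exponent ?_ _).trans (wnorm_weakD_le J ![j.1, j.2.1, j.2.2] []
      (by simp))).trans_lt hN).ne
    simp; linarith

theorem wnorm_smooth_ne_top {η : E3 → ℝ} (hη : Continuous η) (hc : HasCompactSupport η) (s : ℝ) :
    wnorm s η ≠ ⊤ :=
  (((continuous_sigma_rpow s).mul hη).memLp_of_hasCompactSupport (p := 2) (μ := volume)
    hc.mul_left).2.ne

/-- The full decay of `J` is used here: `∂J` and `σ^{-1} J` have finite norm at weight `3/2 - β >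
3/2`, so both are integrable and the divergence theorem applies. The weaker weight `3/2 + β < 3/2`
would not give this. -/
theorem integral_flatComp {J : TensorField 3} (hβ : β < 0) (hk : 1 ≤ k)
    (hJ : MemSobolev k (β - 2) J) (i : IP) :
    Integrable (flatComp J i) ∧ ∫ x, flatComp J i x = 0 := by
  have hpart (e a b c : Fin 3) : IsWeakPartial e (J ![a, b, c]) (weakPartial e (J ![a, b, c])) :=
    hJ.isWeakPartial ![a, b, c] (s := []) (by simp; omega) e
  have hv (e a b c : Fin 3) : Integrable (weakPartial e (J ![a, b, c])) := by
    refine integrable_of_wnorm (s := 3 / 2 - β) (by linarith) (hpart e a b c).2.1.aestronglyMeasurable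
      (((wnorm_mono_exponent ?_ _).trans (wnorm_weakD_le J ![a, b, c] [e]
      (by simpa using hk))).trans_lt hJ.2.2).ne
    simp; linarith
  refine integral_flatP_eq_zero hv (fun e a b c => ?_) i
  refine (hpart e a b c).integral_eq_zero ?_ (hv e a b c)
  refine integrable_of_wnorm (s := 3 / 2 - β) (by linarith)
    ((continuous_sigma_rpow _).aestronglyMeasurable.mul (hJ.1 _).aestronglyMeasurable) ?_
  have e1 : wnorm (3 / 2 - β) (fun x => sigma x ^ (-1 : ℝ) * J ![a, b, c] x) =
      wnorm (1 / 2 - β) (J ![a, b, c]) := by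
    unfold wnorm
    congr 1
    funext x
    rw [← mul_assoc, ← Real.rpow_add (sigma_pos x)]
    congr 2; ring
  rw [e1]
  refine (((wnorm_mono_exponent ?_ _).trans (wnorm_weakD_le J ![a, b, c] []
      (by simp))).trans_lt hJ.2.2).ne
  simp; linarith

/-- Absorption argument: the coefficients `m` and the Euclidean operator are both of size `ε E`,
while coercivity bounds `E` by the Euclidean operator. The threshold depends only on the constants
of these estimates and on `η`. -/
theorem transversality (hk : 4 ≤ k) (h1 : -1 < β) (h2 : β < 0) {η : E3 → ℝ}
    (hη_smooth : ContDiff ℝ ∞ η) (hη_supp : HasCompactSupport η) (hη_int : ∫ x, η x = 1) :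
    ∃ ε₀ : ℝ, 0 < ε₀ ∧ ∀ (h : TensorField 2) (J : TensorField 3) (m : IP → ℝ),
      MemSobolev k β h → sobolevNorm k β h ≤ ENNReal.ofReal ε₀ →
      MemSobolev (k - 2) (β - 2) J → IsJac J →
      (∀ i, (fun x => η x * m i) =ᵐ[volume] auxComp (metricOf h) J i) → m = 0 := by
  obtain ⟨C₁, hC₁, k1⟩ := perturbation_le h1 h2
  obtain ⟨C₂, hC₂, k2⟩ := wnorm_weak_le (τ := 3 / 2 + β) (by linarith) (by linarith)
  set τ := 3 / 2 + β with hτ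
  set w := (wnorm τ η).toReal with hw
  have hw0 : 0 ≤ w := ENNReal.toReal_nonneg
  have hwη : wnorm τ η = ENNReal.ofReal w :=
    (ENNReal.ofReal_toReal (wnorm_smooth_ne_top hη_smooth.continuous hη_supp τ)).symm
  -- The factor `108 = 81 + 27` counts the components of `∂J` and `J`, and `12` those of `𝒫(J)`. In
  -- `C₁ (w + 1)` the part with `w` comes from `η m`, the other from the perturbation. The summand
  -- `C₁` secures `C₁ ε ≤ 1`.
  set B := C₁ + 108 * (C₂ * (12 * (C₁ * (w + 1)))) with hB
  have hB0 : 0 < B := by positivity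
  refine ⟨1 / (2 * B), by positivity, fun h J m hh hN hJ hJac hm => ?_⟩
  set ε := 1 / (2 * B) with hε
  have hε0 : 0 < ε := by positivity
  have hBε : B * ε = 1 / 2 := by rw [hε]; field_simp
  have hC₁ε : C₁ * ε ≤ 1 := by
    have : C₁ * ε ≤ B * ε := by
      refine mul_le_mul_of_nonneg_right ?_ hε0.le
      rw [hB]
      have : 0 ≤ 108 * (C₂ * (12 * (C₁ * (w + 1)))) := by positivity
      linarith
    linarith
  have hpart (e a b c : Fin 3) : IsWeakPartial e (J ![a, b, c]) (weakPartial e (J ![a, b, c])) :=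
    hJ.isWeakPartial ![a, b, c] (s := []) (by simp; omega) e
  set E := firstNorm τ J with hE
  have hEtop : E ≠ ⊤ := firstNorm_ne_top h2 (by omega) hJ
  have hpert := k1 k (by omega) h J ε hε0.le hC₁ε hh hN
    (fun a b c => (hJ.1 _).aestronglyMeasurable) fun e a b c => (hpart e a b c).2.1.aestronglyMeasurable
  have hη_int' : Integrable η := hη_smooth.continuous.integrable_of_hasCompactSupport hη_supp
  -- the coefficients are integrals of the perturbation
  have hmle (i : IP) : ENNReal.ofReal |m i| ≤ ENNReal.ofReal (C₁ * ε) * E := by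
    obtain ⟨f1, f2⟩ := integral_flatComp h2 (by omega) hJ i
    have hae : auxComp (metricOf h) J i - flatComp J i =ᵐ[volume]
        (fun x => η x * m i) - flatComp J i := by
      filter_upwards [hm i] with x hx
      simp [hx]
    have e1 : ∫ x, (auxComp (metricOf h) J i - flatComp J i) x = m i := by
      rw [integral_congr_ae hae]
      simp only [Pi.sub_apply]
      rw [integral_sub (hη_int'.mul_const _) f1, f2, integral_mul_const, hη_int]
      ring
    rw [← Real.enorm_eq_ofReal_abs, ← e1]
    refine (enorm_integral_le_lintegral_enorm _).trans ?_
    rw [← eLpNorm_one_eq_lintegral_enorm]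
    exact (hpert i).2
  -- the Euclidean operator is small
  have hflat (i : IP) : wnorm τ (flatComp J i) ≤ ENNReal.ofReal (C₁ * (w + 1) * ε) * E := by
    have mη : AEStronglyMeasurable (fun x => m i * η x) volume :=
      (hη_smooth.continuous.aestronglyMeasurable).const_mul _
    have mf : AEStronglyMeasurable (flatComp J i) volume :=
      (integral_flatComp h2 (by omega) hJ i).1.aestronglyMeasurable
    have mr : AEStronglyMeasurable (flatComp J i - auxComp (metricOf h) J i) volume := by
      refine mf.sub (mη.congr ?_)
      filter_upwards [hm i] with x hx
      rw [← hx, mul_comm]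
    have hae : flatComp J i =ᵐ[volume]
        (fun x => m i * η x) + (flatComp J i - auxComp (metricOf h) J i) := by
      filter_upwards [hm i] with x hx
      simp only [Pi.add_apply, Pi.sub_apply]
      rw [← hx]; ring
    rw [wnorm_congr hae]
    refine (wnorm_add_le mη mr).trans ?_
    have e2 : wnorm τ (flatComp J i - auxComp (metricOf h) J i) =
        wnorm τ (auxComp (metricOf h) J i - flatComp J i) := by
      unfold wnorm
      rw [← eLpNorm_neg]
      congr 1
      funext x
      simp only [Pi.neg_apply, Pi.sub_apply]
      ring
    have e3 : wnorm τ (fun x => m i * η x) = ENNReal.ofReal |m i| * ENNReal.ofReal w := by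
      rw [← hwη, ← Real.enorm_eq_ofReal_abs, wnorm, wnorm, ← eLpNorm_const_smul]
      congr 1
      funext x
      simp only [Pi.smul_apply, smul_eq_mul]
      ring
    rw [e2, e3]
    refine (add_le_add (mul_le_mul_left (hmle i) _) (hpert i).1).trans_eq ?_
    rw [mul_right_comm, ← ENNReal.ofReal_mul (by positivity), ← add_mul,
      ← ENNReal.ofReal_add (by positivity) (by positivity)]
    congr 2; ring
  -- coercivity of the Euclidean operator
  have hE_le : E ≤ ENNReal.ofReal (1 / 2) * E := by
    have hsum : ∑ i, wnorm τ (flatComp J i) ≤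
        ENNReal.ofReal (12 * (C₁ * (w + 1) * ε)) * E := by
      refine (Finset.sum_le_sum fun i _ => hflat i).trans_eq ?_
      rw [Finset.sum_const, ENNReal.ofReal_mul (p := 12) (by norm_num), ENNReal.ofReal_ofNat, mul_assoc,
        nsmul_eq_mul]
      simp [mul_assoc]
    let J' : Fin 3 → Fin 3 → Fin 3 → locInt := fun a b c => ⟨J ![a, b, c], hJ.1 _⟩
    let G' : Fin 3 → Fin 3 → Fin 3 → Fin 3 → locInt := fun e a b c =>
      ⟨weakPartial e (J ![a, b, c]), (hpart e a b c).2.1⟩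
    have hG' (i : IP) : (flatP G' i).1 = flatComp J i := by
      funext x; rw [flatP_locInt_apply]; rfl
    have hfin (a b c : Fin 3) : wnorm (τ - 1) (J ![a, b, c]) ≠ ⊤ :=
      ENNReal.sum_ne_top.1 (ENNReal.add_ne_top.1 hEtop).2 (a, b, c) (Finset.mem_univ _)
    have key := k2 J' G' hpart (fun a b c => ?_) hfin
    · simp only [hG'] at key
      have hle : E ≤ ∑ _ : I4, ENNReal.ofReal C₂ * ∑ i, wnorm τ (flatComp J i) +
          ∑ _ : I3, ENNReal.ofReal C₂ * ∑ i, wnorm τ (flatComp J i) :=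
        add_le_add (Finset.sum_le_sum fun j _ => (key j.2.1 j.2.2.1 j.2.2.2).2 j.1)
          (Finset.sum_le_sum fun j _ => (key j.1 j.2.1 j.2.2).1)
      have hcard : ∀ z : ENNReal, ∑ _ : I4, z + ∑ _ : I3, z = ENNReal.ofReal 108 * z := fun z => by
        rw [Finset.sum_const, Finset.sum_const, ← add_nsmul, nsmul_eq_mul, ENNReal.ofReal_ofNat]
        simp
      rw [hcard] at hle
      refine hle.trans ((mul_le_mul_right (mul_le_mul_right hsum _) _).trans ?_)
      rw [← mul_assoc, ← mul_assoc, ← ENNReal.ofReal_mul (by norm_num),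
        ← ENNReal.ofReal_mul (by positivity)]
      refine mul_le_mul_left (ENNReal.ofReal_le_ofReal ?_) _
      rw [← hBε, hB]
      nlinarith [mul_pos hC₁ hε0]
    · have := hJac a b c
      constructor
      · filter_upwards [this] with x hx
        exact hx.1
      · filter_upwards [this] with x hx
        exact hx.2
  -- Absorbing `E/2` is legitimate only because `E` is finite.
  have hE0 : E = 0 := by
    by_contra hne
    have : ENNReal.ofReal (1 / 2) * E < 1 * E := by
      rw [ENNReal.mul_lt_mul_iff_left hne hEtop]
      rw [ENNReal.ofReal_lt_one]; norm_num
    rw [one_mul] at this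
    exact absurd hE_le this.not_ge
  funext i
  have := hmle i
  rw [hE0, mul_zero, nonpos_iff_eq_zero, ENNReal.ofReal_eq_zero] at this
  exact abs_nonpos_iff.1 this

theorem errorSpace_inter_auxImage (hk : 4 ≤ k) (h1 : -1 < β) (h2 : β < 0) {η : E3 → ℝ}
    (hη_smooth : ContDiff ℝ ∞ η) (hη_supp : HasCompactSupport η) (hη_int : ∫ x, η x = 1) :
    ∃ ε₀ : ℝ, 0 < ε₀ ∧ ∀ h : TensorField 2, MemSobolev k β h →
      sobolevNorm k β h ≤ ENNReal.ofReal ε₀ →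
        errorSpace η ∩ auxImage k β (metricOf h) = {0} := by
  obtain ⟨ε₀, h0, key⟩ := transversality hk h1 h2 hη_smooth hη_supp hη_int
  refine ⟨ε₀, h0, fun h hh hN => Set.Subset.antisymm ?_ ?_⟩
  · rintro u ⟨⟨μ, ν, hu⟩, J, hJ, hJac, hu'⟩
    have hm := key h J (Sum.elim (fun p => μ p.1 p.2) ν) hh hN hJ hJac fun i => by
      filter_upwards [hu, hu'] with x hx hx'
      have e := hx.symm.trans hx'
      rcases i with p | a
      · exact congrFun (congrFun (congrArg Prod.fst e) p.1) p.2
      · exact congrFun (congrArg Prod.snd e) a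
    have hμ (a c : Fin 3) : μ a c = 0 := congrFun hm (.inl (a, c))
    have hν (a : Fin 3) : ν a = 0 := congrFun hm (.inr a)
    refine AEEqFun.ext (hu.trans (EventuallyEq.trans (Eventually.of_forall fun x => ?_)
      AEEqFun.coeFn_zero.symm))
    simp only [hμ, hν, mul_zero]
    rfl
  · rintro u rfl
    exact ⟨zero_mem_errorSpace η, zero_mem_auxImage _⟩

end MainArgument

end ExtConstraint

/-! ### The proposition. -/

theorem mainTheorem10 (k : ℕ) (hk : 4 ≤ k) (β : ℝ) (hβ : β ∈ Set.Ioo (-1 : ℝ) 0)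
    (η : ExtConstraint.E3 → ℝ) (hη_smooth : ContDiff ℝ ∞ η) (hη_nonneg : ∀ x, 0 ≤ η x)
    (hη_supp : HasCompactSupport η) (hη_int : ∫ x, η x = 1) :
    -- all metrics `g = δ + h` close to the Euclidean one, with one threshold
    (∃ ε₀ : ℝ, 0 < ε₀ ∧ ∀ h : ExtConstraint.TensorField 2,
      ExtConstraint.MemSobolev k β h → ExtConstraint.IsSymm2 h →
      ExtConstraint.sobolevNorm k β h ≤ ENNReal.ofReal ε₀ →
        ExtConstraint.errorSpace η ∩
          ExtConstraint.auxImage k β (ExtConstraint.metricOf h) = {0}) ∧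
    -- all families of metrics depending on free data that tend to the Euclidean metric in
    -- `H^{k,β}` as the free data tend to zero, in terms of the norm of the free data
    (∀ H : ExtConstraint.FreeData k β → ExtConstraint.TensorField 2,
      (∀ ρ : ℝ, 0 < ρ → ∃ r : ℝ, 0 < r ∧ ∀ b : ExtConstraint.FreeData k β,
        b.size ≤ ENNReal.ofReal r →
          ExtConstraint.MemSobolev k β (H b) ∧ ExtConstraint.IsSymm2 (H b) ∧
            ExtConstraint.sobolevNorm k β (H b) ≤ ENNReal.ofReal ρ) →
      ∃ ε₀ : ℝ, 0 < ε₀ ∧ ∀ b : ExtConstraint.FreeData k β, b.size ≤ ENNReal.ofReal ε₀ →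
        ExtConstraint.errorSpace η ∩
          ExtConstraint.auxImage k β (ExtConstraint.metricOf (H b)) = {0}) := by
  have key := ExtConstraint.errorSpace_inter_auxImage hk hβ.1 hβ.2 hη_smooth hη_supp hη_int
  obtain ⟨ε₀, h0, hε⟩ := key
  refine ⟨⟨ε₀, h0, fun h hh _ hN => hε h hh hN⟩, fun H hH => ?_⟩
  -- Continuity of the family at zero is used at the threshold of the first part.
  obtain ⟨r, hr, hb⟩ := hH ε₀ h0
  exact ⟨r, hr, fun b hbr => hε (H b) (hb b hbr).1 (hb b hbr).2.2⟩
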